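/- **Notation.** For a partition $\mu=(\mu_1\ge\mu_2\ge\cdots)$ let $|\mu|=\sum_j\mu_j$, $\kappa(\mu)=|\mu|+\sum_{j=1}^{l(\mu)}\mu_j(\mu_j-2j)$, and let $\mu^t$ be the conjugate partition. Let $s_{\lambda/\mu}(q^{\nu+\rho})$ be the skew Schur function at $x_i=q^{\nu_i-i+1/2}$ $(i\ge1)$, regarded as a rational function of $q^{1/2}$, and let $$C_{\lambda_1,\lambda_2,\lambda_3}(q)=q^{\frac12\kappa(\lambda_3)}s_{\lambda_2}(q^\rho)\sum_{\mu}s_{\lambda_1/\mu}(q^{\lambda_2^t+\rho})\,s_{\lambda_3^t/\mu}(q^{\lambda_2+\rho})$$ be the topological vertex. For a smooth toric Calabi–Yau threefold with toric graph $\Gamma$ (trivalent vertices $V_3$, compact directed edges $E_3$, framings $n(e)\in\mathbb Z$, where $n(e)$ is half the difference of the intersection numbers of the curve $C_e$ with the two toric divisors containing it, that on the right of $e$ minus that on the left) the partition function is the formal power series $$Z(q,\vec Q)=\sum_{\vec\lambda:E_3\to\{\text{partitions}\}}\ \prod_{e\in E_3}(-1)^{|\vec\lambda(e)|(n(e)+1)}q^{\frac12\kappa(\vec\lambda(e))n(e)}Q_e^{|\vec\lambda(e)|}\prod_{v\in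 V_3}C_{\vec\lambda_v}(q),$$ where $\vec\lambda_v$ lists the partitions on the three edges at $v$ in counterclockwise order, transposed for incoming edges, and empty on noncompact edges. Let $X$ be the toric Calabi–Yau threefold containing two disjoint copies of $\mathbb P^1\times\mathbb P^1$ joined by a $(-1,-1)$-curve: its fan, cut by the plane $z=1$, has the rays $(0,0),(\pm1,0),(0,\pm1),(1,1),(2,1),(1,2)$, and $(0,0)$ and $(1,1)$ are each joined to their four lattice neighbours, and $(1,0)$ to $(0,1)$. Its toric graph consists of two squares (all edges directed clockwise, framing $-1$) and one edge of framing $0$ from the top right corner of the first square to the bottom left corner of the second. Both horizontal edges of the $k$-th square carry the variable $Q_{B_k}$, both vertical ones $Q_{F_k}$, the joining edge $Q_0$. Let $Z_X$ be the resulting power series in $Q_{B_1},Q_{B_2},Q_{F_1},Q_{F_2},Q_0$ and $$Z_X^{\rm inst}=\frac{Z_X}{Z_X|_{Q_{B_1}=Q_{B_2}=0}} .$$ Let $$a^{(k)}_{11}=a^{(k)}_{22}=0,\qquad a^{(1)}_{12}=-a^{(1)}_{21}=2a_1,\qquad a^{(2)}_{12}=-a^{(2)}_{21}=-2a_2,$$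 $$a^{(1,2)}_{11}=a_1+a_2,\quad a^{(1,2)}_{21}=-a_1+a_2,\quad a^{(1,2)}_{12}=a_1-a_2,\quad a^{(1,2)}_{22}=-a_1-a_2 .$$ An infinite product $\prod_{i,j\ge1}\varphi(\mu_i-\nu_j+j-i)/\varphi(j-i)$ (or its reciprocal) is read after cancellation of common factors: $\varphi(k)$, $k\in\mathbb Z$, occurs with the exponent $\lim_{N\to\infty}\big(\#\{i,j\le N:\mu_i-\nu_j+j-i=k\}-\#\{i,j\le N:j-i=k\}\big)$, which is nonzero for only finitely many $k$. **Proposition 4.1.** (1) Let $R,\hbar,m,a_1,a_2\in\mathbb C$ and put $$q^{1/2}=e^{-R\hbar},\quad Q_{F_k}=e^{-4Ra_k},\quad Q_{F_k}^{1/2}=e^{-2Ra_k},\quad Q_0=e^{2R(a_1+a_2-m)},$$ where $\sinh(R\hbar n)\ne0$ for all integers $n\ne0$ and $\sinh R(2a_k+\hbar n)\ne0$ for all $n\in\mathbb Z$, $k=1,2$. Then, as formal power series in $Q_{B_1},Q_{B_2}$ (each coefficient of the left side is the expansion in $Q_{F_1},Q_{F_2},Q_0$ of a rational function, regular at the given values),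 $$\begin{aligned}Z_X^{\rm inst}=\sum_{\mu^1_1,\mu^1_2,\mu^2_1,\mu^2_2}\ &\prod_{k=1}^2\Big(\frac{Q_{B_k}}{2^4Q_{F_k}}\Big)^{|\mu^k_1|+|\mu^k_2|}\prod_{l,n=1}^2\prod_{i,j\ge1}\frac{\sinh R\big(a^{(k)}_{ln}+\hbar(\mu^k_{l,i}-\mu^k_{n,j}+j-i)\big)}{\sinh R\big(a^{(k)}_{ln}+\hbar(j-i)\big)}\\ &\times q^{\frac12(\kappa(\mu^1_1)+\kappa(\mu^1_2)-\kappa(\mu^2_1)-\kappa(\mu^2_2))}(2^2Q_0)^{|\mu^1_1|+|\mu^1_2|+|\mu^2_1|+|\mu^2_2|}\\ &\times(Q_{F_1}^{1/2})^{2|\mu^1_1|+|\mu^2_1|+|\mu^2_2|}(Q_{F_2}^{1/2})^{|\mu^1_1|+|\mu^1_2|+2|\mu^2_1|}\\ &\times\prod_{l,n=1}^2\prod_{i,j\ge1}\frac{\sinh R\big(a^{(1,2)}_{ln}+m+\hbar(j-i)\big)}{\sinh R\big(a^{(1,2)}_{ln}+m+\hbar(\mu^1_{l,i}-\mu^2_{n,j}+j-i)\big)}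 .\end{aligned}$$ (2) Let $\hbar\ne0$ and $2a_k+\hbar n\ne0$ for all $n\in\mathbb Z$, $k=1,2$. Substitute moreover $Q_{B_k}=2^2R^2\Lambda_k$. Then, as $R\to0$ through the values allowed in (1) (which accumulate at $0$), $Z_X^{\rm inst}$ converges, coefficient by coefficient in $\Lambda_1,\Lambda_2$, to the instanton part of Nekrasov's partition function of four-dimensional $SU(2)\times SU(2)$ gauge theory with a bifundamental matter, $$\sum_{\mu^1_1,\mu^1_2,\mu^2_1,\mu^2_2}\ \prod_{k=1}^2\Lambda_k^{|\mu^k_1|+|\mu^k_2|}\prod_{l,n=1}^2\prod_{i,j\ge1}\frac{a^{(k)}_{ln}+\hbar(\mu^k_{l,i}-\mu^k_{n,j}+j-i)}{a^{(k)}_{ln}+\hbar(j-i)}\ \prod_{l,n=1}^2\prod_{i,j\ge1}\frac{a^{(1,2)}_{ln}+m+\hbar(j-i)}{a^{(1,2)}_{ln}+m+\hbar(\mu^1_{l,i}-\mu^2_{n,j}+j-i)} .$$ -/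

import Mathlib

open Filter Topology

noncomputable section

namespace ToricCY

/-! ### Partitions (as Young diagrams; rows are indexed from `0`) -/

theorem finite_le (lam : YoungDiagram) : {mu : YoungDiagram | mu ≤ lam}.Finite := by
  refine Set.Finite.of_finite_image (f := YoungDiagram.cells) ?_ ?_
  · refine (Finset.finite_toSet lam.cells.powerset).subset ?_
    rintro _ ⟨mu, hmu, rfl⟩
    simpa using YoungDiagram.cells_subset_iff.2 hmu
  · intro mu _ nu _ h
    exact YoungDiagram.ext h

theorem finite_card_eq (n : ℕ) : {mu : YoungDiagram | mu.card = n}.Finite := by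
  refine Set.Finite.of_finite_image (f := YoungDiagram.cells) ?_ ?_
  · refine (Finset.finite_toSet (Finset.range n ×ˢ Finset.range n).powerset).subset ?_
    rintro _ ⟨mu, hmu, rfl⟩
    have hmu' : mu.cells.card = n := hmu
    simp only [Finset.coe_powerset, Set.mem_preimage, Set.mem_powerset_iff]
    intro c hc
    obtain ⟨i, j⟩ := c
    have hc' : (i, j) ∈ mu := hc
    have h1 : mu.colLen j ≤ n := by
      rw [YoungDiagram.colLen_eq_card, ← hmu']
      exact Finset.card_le_card (Finset.filter_subset _ _)
    have h2 : mu.rowLen i ≤ n := by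
      rw [YoungDiagram.rowLen_eq_card, ← hmu']
      exact Finset.card_le_card (Finset.filter_subset _ _)
    have h3 := YoungDiagram.mem_iff_lt_colLen.1 hc'
    have h4 := YoungDiagram.mem_iff_lt_rowLen.1 hc'
    simp only [Finset.coe_product, Finset.coe_range, Set.mem_prod, Set.mem_Iio]
    exact ⟨by omega, by omega⟩
  · intro mu _ nu _ h
    exact YoungDiagram.ext h

/-- The partitions whose diagram is contained in that of `lam`. -/
def subPartitions (lam : YoungDiagram) : Finset YoungDiagram := (finite_le lam).toFinset

/-- The partitions of `n`. -/
def partitionsOf (n : ℕ) : Finset YoungDiagram := (finite_card_eq n).toFinset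

/-- The number of nonzero parts. -/
def len (mu : YoungDiagram) : ℕ := mu.colLen 0

/-- `κ(μ) = |μ| + ∑_j μ_j (μ_j - 2 j)`, the sum over the nonzero parts (`j = 1, …, l(μ)`). -/
def kappa (mu : YoungDiagram) : ℤ :=
  mu.card + ∑ j ∈ Finset.range (len mu),
    (mu.rowLen j : ℤ) * ((mu.rowLen j : ℤ) - 2 * ((j : ℤ) + 1))

/-! ### Skew Schur functions at `x_i = q^{ν_i - i + 1/2}`

Throughout `u` is the chosen square root `q^{1/2}`; `u` is a nonzero complex number such that
`q = u ^ 2` is not a root of unity. -/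

/-- The value of the variable `x_{i+1} = q^{ν_{i+1} - (i+1) + 1/2}`. -/
def specVar (u : ℂ) (nu : YoungDiagram) (i : ℕ) : ℂ :=
  u ^ (2 * (nu.rowLen i : ℤ) - 2 * (i : ℤ) - 1)

/-- The power sum `p_n(q^{ν+ρ}) = ∑_{i ≥ 1} q^{n (ν_i - i + 1/2)}`, as a rational function of
`q^{1/2}`: the first `l(ν)` terms are added, and the remaining terms form a geometric series,
which is summed in closed form. -/
def specPowerSum (u : ℂ) (nu : YoungDiagram) (n : ℕ) : ℂ :=
  ∑ i ∈ Finset.range (len nu), specVar u nu i ^ n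
    + (u ^ (-(2 * (len nu : ℤ) + 1))) ^ n / (1 - (u ^ (-2 : ℤ)) ^ n)

/-- For `|q| > 1` the power sum is the sum of the series of the `n`-th powers of the variables. -/
theorem hasSum_specPowerSum (u : ℂ) (hu : 1 < ‖u‖) (nu : YoungDiagram) (n : ℕ) (hn : n ≠ 0) :
    HasSum (fun i => specVar u nu i ^ n) (specPowerSum u nu n) := by
  have hu0 : u ≠ 0 := by
    rintro rfl
    simp at hu
    linarith
  have hr : ‖(u ^ (-2 : ℤ)) ^ n‖ < 1 := by
    rw [norm_pow, norm_zpow]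
    refine pow_lt_one₀ (by positivity) ?_ hn
    exact zpow_lt_one_of_neg₀ hu (by norm_num)
  have hg := (hasSum_geometric_of_norm_lt_one hr).mul_left ((u ^ (-(2 * (len nu : ℤ) + 1))) ^ n)
  rw [specPowerSum, add_comm, div_eq_mul_inv]
  refine (hasSum_nat_add_iff (len nu)).1 ?_
  suffices hs : (fun i => specVar u nu (i + len nu) ^ n)
      = fun i => (u ^ (-(2 * (len nu : ℤ) + 1))) ^ n * ((u ^ (-2 : ℤ)) ^ n) ^ i by
    rw [hs]
    exact hg
  funext i
  have h0 : nu.rowLen (i + len nu) = 0 := by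
    by_contra h
    have h1 : (i + len nu, 0) ∈ nu := YoungDiagram.mem_iff_lt_rowLen.2 (Nat.pos_of_ne_zero h)
    have h2 := YoungDiagram.mem_iff_lt_colLen.1 h1
    simp only [len] at h2
    omega
  rw [specVar, h0, ← pow_mul, mul_comm n i, pow_mul, ← mul_pow, ← zpow_natCast (u ^ (-2 : ℤ)) i,
    ← zpow_mul, ← zpow_add₀ hu0]
  congr 2
  push_cast
  ring

/-- The complete homogeneous symmetric functions `h_n(q^{ν+ρ})`, obtained from the power sums by
Newton's identities `n h_n = ∑_{r=1}^{n} p_r h_{n-r}`. -/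
def specH (u : ℂ) (nu : YoungDiagram) : ℕ → ℂ
  | 0 => 1
  | n + 1 => (∑ r : Fin (n + 1), specPowerSum u nu (n + 1 - r.1) * specH u nu r.1) / ((n : ℂ) + 1)
  decreasing_by exact r.2

/-- The same with an integer index: `h_n = 0` for `n < 0`. -/
def specHInt (u : ℂ) (nu : YoungDiagram) (n : ℤ) : ℂ := if 0 ≤ n then specH u nu n.toNat else 0

/-- The skew Schur function `s_{λ/μ}(q^{ν+ρ})`: zero unless `μ ⊆ λ`, and otherwise the determinant
`det (h_{λ_i - μ_j - i + j})` of size `l(λ)`. -/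
def skewSchur (u : ℂ) (lam mu nu : YoungDiagram) : ℂ :=
  open Classical in
  if mu ≤ lam then
    (Matrix.of fun i j : Fin (len lam) =>
      specHInt u nu ((lam.rowLen i : ℤ) - (mu.rowLen j : ℤ) - (i : ℤ) + (j : ℤ))).det
  else 0

/-- The topological vertex
`C_{λ₁,λ₂,λ₃}(q) = q^{κ(λ₃)/2} s_{λ₂}(q^ρ) ∑_μ s_{λ₁/μ}(q^{λ₂ᵗ+ρ}) s_{λ₃ᵗ/μ}(q^{λ₂+ρ})`.
Only the finitely many `μ ⊆ λ₁` contribute. -/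
def vertex (u : ℂ) (l1 l2 l3 : YoungDiagram) : ℂ :=
  u ^ kappa l3 * skewSchur u l2 ⊥ ⊥ *
    ∑ mu ∈ subPartitions l1,
      skewSchur u l1 mu l2.transpose * skewSchur u l3.transpose mu l2

/-! ### Toric graphs and their partition functions -/

/-- A toric graph with trivalent vertices `V` and compact edges `E`, directed and framed.
`halfEdge v 0, halfEdge v 1, halfEdge v 2` are the three edges at `v` in counterclockwise order:
`none` is a noncompact edge, `some (e, true)` is the compact edge `e` leaving `v`, and
`some (e, false)` is the compact edge `e` arriving at `v`. -/
structure ToricGraph (V E : Type) where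
  halfEdge : V → Fin 3 → Option (E × Bool)
  framing : E → ℤ
  existsUnique_end : ∀ (e : E) (b : Bool), ∃! p : V × Fin 3, halfEdge p.1 p.2 = some (e, b)

/-- The partition placed in the slot `i` of the vertex factor at `v`: `λ(e)` for an outgoing edge
`e`, its transpose for an incoming one, the empty partition for a noncompact edge. -/
def ToricGraph.label {V E : Type} (G : ToricGraph V E) (lam : E → YoungDiagram) (v : V)
    (i : Fin 3) : YoungDiagram :=
  match G.halfEdge v i with
  | none => ⊥
  | some (e, true) => lam e
  | some (e, false) => (lam e).transpose

/-- The partition function of a toric graph, a formal power series in variables `Q_e`, `e ∈ E`: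
the sum over `λ : E → 𝒫` of
`∏_e (-1)^{|λ(e)|(n(e)+1)} q^{κ(λ(e)) n(e)/2} Q_e^{|λ(e)|} · ∏_v C_{λ_v}(q)`. -/
def ToricGraph.partitionFunction {V E : Type} [Fintype V] [Fintype E] [DecidableEq E]
    (G : ToricGraph V E) (u : ℂ) : MvPowerSeries E ℂ := fun d =>
  ∑ lam ∈ Fintype.piFinset fun e => partitionsOf (d e),
    (∏ e, (-1 : ℂ) ^ (((lam e).card : ℤ) * (G.framing e + 1)) *
      u ^ (kappa (lam e) * G.framing e)) *
    ∏ v, vertex u (G.label lam v 0) (G.label lam v 1) (G.label lam v 2)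

/-- The fan of a smooth toric Calabi–Yau threefold, cut by the plane `z = 1`: `ray` lists the
lattice points that span the 1-cones, and `cone v` the three rays of the 3-cone `v`, in
counterclockwise order. `IsToricGraphOf ray cone G` says that `G` is its toric graph: slot `i` at
`v` is dual to the 2-cone spanned by the `i`-th and `(i+1)`-st ray of `v`; every 3-cone is smooth;
an edge `e` from `v` to `w` is the common 2-cone of `v` and `w`, noncompact edges are 2-cones on
the boundary, and, `C_e` being the curve of the edge, `D₁` and `D₂` the divisors of the rays on its
right and on its left, the framing is `n(e) = (D₁.C_e - D₂.C_e)/2`. The intersection numbers are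
read off from the linear relation `ω + ω' + (D₁.C_e) ω₁ + (D₂.C_e) ω₂ = 0` between the rays of
`v` and `w` (third coordinates included). -/
def IsToricGraphOf {V E r : Type} (ray : r → ℤ × ℤ) (cone : V → Fin 3 → r)
    (G : ToricGraph V E) : Prop :=
  (∀ v, ((ray (cone v 1)).1 - (ray (cone v 0)).1) * ((ray (cone v 2)).2 - (ray (cone v 0)).2)
      - ((ray (cone v 1)).2 - (ray (cone v 0)).2) * ((ray (cone v 2)).1 - (ray (cone v 0)).1) = 1) ∧
  (∀ e v w i j, G.halfEdge v i = some (e, true) → G.halfEdge w j = some (e, false) →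
    cone v i = cone w (j + 1) ∧ cone v (i + 1) = cone w j ∧
    ∃ b : Bool → ℤ,
      ray (cone v (i + 2)) + ray (cone w (j + 2)) + b true • ray (cone v i)
        + b false • ray (cone v (i + 1)) = 0 ∧
      1 + 1 + b true + b false = 0 ∧ 2 * G.framing e = b true - b false) ∧
  (∀ v i, G.halfEdge v i = none →
    ∀ w j, ¬ (cone v i = cone w (j + 1) ∧ cone v (i + 1) = cone w j))

/-! ### The threefold `X` -/

/-- The formal variables other than `Q_{B_1}, Q_{B_2}`: the fibre variables `Q_{F_1}, Q_{F_2}`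
(`F 0`, `F 1`) and the variable `Q_0` of the `(-1,-1)`-curve. -/
inductive FVar : Type
  | F (k : Fin 2)
  | Q0
  deriving DecidableEq, Fintype

/-- All formal variables: `Sum.inl k` is the base variable `Q_{B_{k+1}}`. -/
abbrev XVar : Type := Fin 2 ⊕ FVar

/-- The toric graph of `X`: two squares, joined by a diagonal edge. The vertices `0, 1, 2, 3` are
the top left, bottom left, bottom right and top right corner of the first square, and
`4, 5, 6, 7` the bottom left, top left, top right and bottom right corner of the second. The edges
`0, 1, 2, 3` are the top, right, bottom and left edge of the first square, directed clockwise,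
`5, 6, 7, 8` the same for the second, and `4` leads from the top right corner of the first square
to the bottom left corner of the second. -/
def graphX : ToricGraph (Fin 8) (Fin 9) where
  halfEdge := ![
    ![none, some (3, false), some (0, true)],
    ![none, some (2, false), some (3, true)],
    ![none, some (1, false), some (2, true)],
    ![some (4, true), some (0, false), some (1, true)],
    ![some (4, false), some (7, false), some (8, true)],
    ![none, some (8, false), some (5, true)],
    ![none, some (5, false), some (6, true)],
    ![none, some (6, false), some (7, true)]]
  framing := ![-1, -1, -1, -1, 0, -1, -1, -1, -1]
  existsUnique_end := by
    simp only [ExistsUnique]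
    decide

/-- The rays of the fan of `X` (section at `z = 1`). The points `(0,0)` and `(1,1)` are the two
compact divisors `ℙ¹ × ℙ¹`; the support is the lattice rectangle with corners
`(-1,0), (0,-1), (2,1), (1,2)`. -/
def rayX : Fin 8 → ℤ × ℤ :=
  ![(0, 0), (1, 0), (0, 1), (-1, 0), (0, -1), (1, 1), (2, 1), (1, 2)]

/-- The 3-cones of the fan of `X`. -/
def coneX : Fin 8 → Fin 3 → Fin 8 :=
  ![![2, 3, 0], ![3, 4, 0], ![4, 1, 0], ![1, 2, 0], ![2, 1, 5], ![7, 2, 5], ![6, 7, 5], ![1, 6, 5]]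

theorem isToricGraphOf_graphX : IsToricGraphOf rayX coneX graphX := by
  refine ⟨by decide, ?_, by decide⟩
  intro e v w i j h1 h2
  have key : ∀ (e : Fin 9) (v w : Fin 8) (i j : Fin 3), graphX.halfEdge v i = some (e, true) →
      graphX.halfEdge w j = some (e, false) →
      coneX v i = coneX w (j + 1) ∧ coneX v (i + 1) = coneX w j ∧
        rayX (coneX v (i + 2)) + rayX (coneX w (j + 2))
          + (graphX.framing e - 1) • rayX (coneX v i)
          + (-graphX.framing e - 1) • rayX (coneX v (i + 1)) = 0 := by
    decide
  obtain ⟨h3, h4, h5⟩ := key e v w i j h1 h2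
  refine ⟨h3, h4, fun b => if b then graphX.framing e - 1 else -graphX.framing e - 1, ?_, ?_, ?_⟩
  · simpa using h5
  · simp only [if_true, Bool.false_eq_true, if_false]
    ring
  · simp only [if_true, Bool.false_eq_true, if_false]
    ring

/-- The variable attached to each edge: horizontal edges carry `Q_{B_k}`, vertical ones
`Q_{F_k}`, the diagonal one `Q_0`. -/
def edgeVarX : Fin 9 → XVar :=
  ![.inl 0, .inr (.F 0), .inl 0, .inr (.F 0), .inr .Q0,
    .inl 1, .inr (.F 1), .inl 1, .inr (.F 1)]

/-- `Z_X`, a formal power series in `Q_{B_1}, Q_{B_2}, Q_{F_1}, Q_{F_2}, Q_0`. -/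
def ZX (u : ℂ) : MvPowerSeries XVar ℂ :=
  MvPowerSeries.rename edgeVarX (graphX.partitionFunction u)

/-- The result of setting `Q_{B_1} = Q_{B_2} = 0`. -/
def setBZero (f : MvPowerSeries XVar ℂ) : MvPowerSeries XVar ℂ := fun e =>
  if ∀ k : Fin 2, e (.inl k) = 0 then MvPowerSeries.coeff e f else 0

/-- `Z_X^inst = Z_X / Z_X|_{Q_{B_1} = Q_{B_2} = 0}`. -/
def ZXInst (u : ℂ) : MvPowerSeries XVar ℂ := ZX u * (setBZero (ZX u))⁻¹

/-- The coefficient of `Q_{B_1}^{d_1} Q_{B_2}^{d_2}` in a series in all variables, a formal power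
series in `Q_{F_1}, Q_{F_2}, Q_0`. -/
def coeffB (d : Fin 2 →₀ ℕ) (f : MvPowerSeries XVar ℂ) : MvPowerSeries FVar ℂ := fun e =>
  MvPowerSeries.coeff (Finsupp.sumElim d e) f

/-! ### Values of power series that are expansions of rational functions -/

/-- The formal power series `f` is the expansion of a rational function `P / D` with `D(z) ≠ 0`,
whose value at `z` is `c`. -/
def HasRationalValue {s : Type} (f : MvPowerSeries s ℂ) (z : s → ℂ) (c : ℂ) : Prop :=
  ∃ P D : MvPolynomial s ℂ, (D : MvPowerSeries s ℂ) * f = (P : MvPowerSeries s ℂ) ∧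
    MvPolynomial.eval z D ≠ 0 ∧ c = MvPolynomial.eval z P / MvPolynomial.eval z D

theorem HasRationalValue.unique {s : Type} {f : MvPowerSeries s ℂ} {z : s → ℂ} {c c' : ℂ}
    (h : HasRationalValue f z c) (h' : HasRationalValue f z c') : c = c' := by
  obtain ⟨P, D, h1, h2, rfl⟩ := h
  obtain ⟨P', D', h1', h2', rfl⟩ := h'
  have h3 : D' * P = D * P' := by
    apply MvPolynomial.coe_injective s ℂ
    rw [MvPolynomial.coe_mul, MvPolynomial.coe_mul, ← h1, ← h1']
    ring
  have h4 := congrArg (MvPolynomial.eval z) h3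
  rw [map_mul, map_mul] at h4
  rw [div_eq_div_iff h2 h2', mul_comm, h4, mul_comm]

/-- The value of `f` at `z`, for `f` the expansion of a rational function regular at `z`. -/
def rationalValue {s : Type} (f : MvPowerSeries s ℂ) (z : s → ℂ) : ℂ :=
  open Classical in if h : ∃ c, HasRationalValue f z c then h.choose else 0

theorem HasRationalValue.rationalValue_eq {s : Type} {f : MvPowerSeries s ℂ} {z : s → ℂ} {c : ℂ}
    (h : HasRationalValue f z c) : rationalValue f z = c := by
  have h' : ∃ c, HasRationalValue f z c := ⟨c, h⟩
  rw [rationalValue, dif_pos h']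
  exact h'.choose_spec.unique h

/-! ### Substitution of the parameters

`a 0`, `a 1` are `a_1`, `a_2`. -/

/-- `Q_{F_k} = e^{-4 R a_k}` and `Q_0 = e^{2 R (a_1 + a_2 - m)}`. -/
def paramPoint (R m : ℂ) (a : Fin 2 → ℂ) : FVar → ℂ
  | .F k => Complex.exp (-4 * R * a k)
  | .Q0 => Complex.exp (2 * R * (a 0 + a 1 - m))

/-- The coefficient of `Q_{B_1}^{d_1} Q_{B_2}^{d_2}` in `Z_X^inst` at `q^{1/2} = e^{-Rħ}`. -/
def instCoeff (R hb : ℂ) (d : Fin 2 →₀ ℕ) : MvPowerSeries FVar ℂ :=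
  coeffB d (ZXInst (Complex.exp (-R * hb)))

/-- `Z_X^inst` after the substitution, a formal power series in `Q_{B_1}, Q_{B_2}`. -/
def ZXInstAt (R hb m : ℂ) (a : Fin 2 → ℂ) : MvPowerSeries (Fin 2) ℂ := fun d =>
  rationalValue (instCoeff R hb d) (paramPoint R m a)

/-- Genericity of the parameters: `q` is not a root of unity, and `Q_{F_k}` is not an integral
power of `q`. -/
def Generic (R hb : ℂ) (a : Fin 2 → ℂ) : Prop :=
  (∀ n : ℤ, n ≠ 0 → Complex.sinh (R * (hb * n)) ≠ 0) ∧
  ∀ (k : Fin 2) (n : ℤ), Complex.sinh (R * (2 * a k + hb * n)) ≠ 0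

/-! ### The infinite products over `i, j ≥ 1`

In `∏_{i,j ≥ 1} φ(μ_i - ν_j + j - i) / φ(j - i)` every factor `φ(k)` occurs infinitely often in the
numerator and in the denominator. As usual, the product is read after cancellation: `φ(k)` gets
the multiplicity with which it occurs in the numerator minus that in the denominator. -/

/-- The number of pairs `1 ≤ i, j ≤ N` with `μ_i - ν_j + j - i = k` minus the number of those with
`j - i = k`. -/
def crossCount (mu nu : YoungDiagram) (N : ℕ) (k : ℤ) : ℤ :=
  ∑ i ∈ Finset.range N, ∑ j ∈ Finset.range N,
    ((if (mu.rowLen i : ℤ) - (nu.rowLen j : ℤ) + (j : ℤ) - (i : ℤ) = k then 1 else 0)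
      - (if (j : ℤ) - (i : ℤ) = k then 1 else 0))

/-- The net multiplicity of `φ(k)`: the value of `crossCount μ ν N k` for all large `N`. -/
def netMult (mu nu : YoungDiagram) (k : ℤ) : ℤ := crossCount mu nu (k.natAbs + len mu + len nu) k

theorem rowLen_eq_zero {mu : YoungDiagram} {i : ℕ} (h : len mu ≤ i) : mu.rowLen i = 0 := by
  by_contra h0
  have h1 : (i, 0) ∈ mu := YoungDiagram.mem_iff_lt_rowLen.2 (Nat.pos_of_ne_zero h0)
  have h2 := YoungDiagram.mem_iff_lt_colLen.1 h1
  simp only [len] at h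
  omega

theorem crossCount_eq_netMult (mu nu : YoungDiagram) (k : ℤ) (N : ℕ)
    (hN : k.natAbs + len mu + len nu ≤ N) : crossCount mu nu N k = netMult mu nu k := by
  induction N, hN using Nat.le_induction with
  | base => rfl
  | succ N hN ih =>
    rw [← ih]
    simp only [crossCount, Finset.sum_range_succ, Finset.sum_add_distrib]
    have hA : ∀ i ∈ Finset.range N,
        ((if (mu.rowLen i : ℤ) - (nu.rowLen N : ℤ) + (N : ℤ) - (i : ℤ) = k then (1 : ℤ) else 0)
          - (if (N : ℤ) - (i : ℤ) = k then 1 else 0)) = 0 := by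
      intro i hi
      have hi' := Finset.mem_range.1 hi
      rw [rowLen_eq_zero (mu := nu) (i := N) (by omega)]
      by_cases h : len mu ≤ i
      · rw [rowLen_eq_zero h]
        simp
      · rw [if_neg (by omega), if_neg (by omega)]
        rfl
    have hB : ∀ j ∈ Finset.range N,
        ((if (mu.rowLen N : ℤ) - (nu.rowLen j : ℤ) + (j : ℤ) - (N : ℤ) = k then (1 : ℤ) else 0)
          - (if (j : ℤ) - (N : ℤ) = k then 1 else 0)) = 0 := by
      intro j hj
      have hj' := Finset.mem_range.1 hj
      rw [rowLen_eq_zero (mu := mu) (i := N) (by omega)]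
      by_cases h : len nu ≤ j
      · rw [rowLen_eq_zero h]
        simp
      · rw [if_neg (by omega), if_neg (by omega)]
        rfl
    rw [Finset.sum_eq_zero hA, Finset.sum_eq_zero hB,
      rowLen_eq_zero (mu := mu) (i := N) (by omega), rowLen_eq_zero (mu := nu) (i := N) (by omega)]
    simp

theorem crossCount_swap (mu nu : YoungDiagram) (N : ℕ) (k : ℤ) :
    crossCount mu nu N k = crossCount nu mu N (-k) := by
  unfold crossCount
  rw [Finset.sum_comm]
  refine Finset.sum_congr rfl fun j _ => Finset.sum_congr rfl fun i _ => ?_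
  congr 1
  · exact if_congr (by omega) rfl rfl
  · exact if_congr (by omega) rfl rfl

theorem netMult_eq_zero_of_le (mu nu : YoungDiagram) (k : ℤ)
    (hk : (mu.rowLen 0 + len nu : ℤ) ≤ k) : netMult mu nu k = 0 := by
  unfold netMult crossCount
  set N := k.natAbs + len mu + len nu with hN
  refine Finset.sum_eq_zero fun i hi => ?_
  have hi' := Finset.mem_range.1 hi
  have hmono : mu.rowLen i ≤ mu.rowLen 0 := mu.rowLen_anti 0 i (Nat.zero_le i)
  have hnu : ∀ j, (mu.rowLen i : ℤ) - (nu.rowLen j : ℤ) + (j : ℤ) - (i : ℤ) = k →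
      nu.rowLen j = 0 := fun j hj => rowLen_eq_zero (by omega)
  rw [Finset.sum_sub_distrib, sub_eq_zero]
  by_cases h : len mu ≤ i
  · have h0 := rowLen_eq_zero h
    refine Finset.sum_congr rfl fun j _ => if_congr ⟨fun hj => ?_, fun hj => ?_⟩ rfl rfl
    · have := hnu j hj
      omega
    · have : nu.rowLen j = 0 := rowLen_eq_zero (by omega)
      omega
  · rw [Finset.sum_eq_single_of_mem (k + i - mu.rowLen i).toNat (Finset.mem_range.2 (by omega)),
      Finset.sum_eq_single_of_mem (k + i).toNat (Finset.mem_range.2 (by omega))]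
    · have : nu.rowLen (k + i - mu.rowLen i).toNat = 0 := rowLen_eq_zero (by omega)
      rw [if_pos (by omega), if_pos (by omega)]
    · intro j _ hj
      exact if_neg (by omega)
    · intro j _ hj
      refine if_neg fun hj' => hj ?_
      have := hnu j hj'
      omega

/-- Only finitely many `φ(k)` survive the cancellation. -/
theorem finite_support_netMult (mu nu : YoungDiagram) : (Function.support (netMult mu nu)).Finite := by
  refine (Set.finite_Icc (-(nu.rowLen 0 + len mu : ℤ)) (mu.rowLen 0 + len nu : ℤ)).subset ?_
  intro k hk
  rw [Function.mem_support] at hk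
  constructor
  · by_contra h
    apply hk
    have h1 := netMult_eq_zero_of_le nu mu (-k) (by omega)
    rw [netMult, crossCount_swap, ← h1, netMult, Int.natAbs_neg, add_right_comm]
  · by_contra h
    exact hk (netMult_eq_zero_of_le mu nu k (by omega))

/-- `∏_{i,j ≥ 1} φ(μ_i - ν_j + j - i) / φ(j - i)`. -/
def crossProd (mu nu : YoungDiagram) (phi : ℤ → ℂ) : ℂ := ∏ᶠ k : ℤ, phi k ^ netMult mu nu k

/-- `∏_{i,j ≥ 1} φ(j - i) / φ(μ_i - ν_j + j - i)`. -/
def crossProdInv (mu nu : YoungDiagram) (phi : ℤ → ℂ) : ℂ := ∏ᶠ k : ℤ, phi k ^ (-netMult mu nu k)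

/-! ### The two sums over quadruples of partitions

`mu k l` is `μ^{k+1}_{l+1}`. -/

/-- The quadruples with `|μ^k_1| + |μ^k_2| = d_k` for `k = 1, 2`. -/
def quadruples (d : Fin 2 →₀ ℕ) : Finset (Fin 2 → Fin 2 → YoungDiagram) :=
  open Classical in
  Fintype.piFinset fun k =>
    (Finset.HasAntidiagonal.antidiagonal (d k)).biUnion fun p =>
      Fintype.piFinset ![partitionsOf p.1, partitionsOf p.2]

theorem mem_quadruples {d : Fin 2 →₀ ℕ} {mu : Fin 2 → Fin 2 → YoungDiagram} :
    mu ∈ quadruples d ↔ ∀ k, (mu k 0).card + (mu k 1).card = d k := by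
  simp [quadruples, partitionsOf, Fintype.mem_piFinset, Fin.forall_fin_two]

/-- `a^{(k)}_{ln} = a^{(k)}_l - a^{(k)}_n` with `a^{(1)} = (a_1, -a_1)`, `a^{(2)} = (-a_2, a_2)`. -/
def aVec (a : Fin 2 → ℂ) : Fin 2 → Matrix (Fin 2) (Fin 2) ℂ :=
  ![!![0, 2 * a 0; -(2 * a 0), 0], !![0, -(2 * a 1); 2 * a 1, 0]]

/-- `a^{(1,2)}_{ln} = a^{(1)}_l - a^{(2)}_n`. -/
def aBif (a : Fin 2 → ℂ) : Matrix (Fin 2) (Fin 2) ℂ :=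
  !![a 0 + a 1, a 0 - a 1; -a 0 + a 1, -a 0 - a 1]

/-- The product formula in `sinh` factors, a formal power series in `Q_{B_1}, Q_{B_2}`. Here
`Q_{F_k}^{1/2} = e^{-2 R a_k}` and `q^{1/2} = e^{-R ħ}`. -/
def sinhSeries (R hb m : ℂ) (a : Fin 2 → ℂ) : MvPowerSeries (Fin 2) ℂ := fun d =>
  ∑ mu ∈ quadruples d,
    (∏ k : Fin 2,
      (1 / (2 ^ 4 * Complex.exp (-4 * R * a k))) ^ ((mu k 0).card + (mu k 1).card) *
      ∏ l : Fin 2, ∏ n : Fin 2,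
        crossProd (mu k l) (mu k n) fun s => Complex.sinh (R * (aVec a k l n + hb * s))) *
    Complex.exp (-R * hb) ^
      (kappa (mu 0 0) + kappa (mu 0 1) - kappa (mu 1 0) - kappa (mu 1 1)) *
    (2 ^ 2 * Complex.exp (2 * R * (a 0 + a 1 - m))) ^
      ((mu 0 0).card + (mu 0 1).card + (mu 1 0).card + (mu 1 1).card) *
    Complex.exp (-2 * R * a 0) ^ (2 * (mu 0 0).card + (mu 1 0).card + (mu 1 1).card) *
    Complex.exp (-2 * R * a 1) ^ ((mu 0 0).card + (mu 0 1).card + 2 * (mu 1 0).card) *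
    ∏ l : Fin 2, ∏ n : Fin 2,
      crossProdInv (mu 0 l) (mu 1 n) fun s => Complex.sinh (R * (aBif a l n + m + hb * s))

/-- The instanton part of Nekrasov's partition function of the four-dimensional `SU(2) × SU(2)`
gauge theory with a bifundamental matter of mass `m`, a formal power series in `Λ_1, Λ_2`. -/
def nekrasovSeries (hb m : ℂ) (a : Fin 2 → ℂ) : MvPowerSeries (Fin 2) ℂ := fun d =>
  ∑ mu ∈ quadruples d,
    (∏ k : Fin 2, ∏ l : Fin 2, ∏ n : Fin 2,
      crossProd (mu k l) (mu k n) fun s => aVec a k l n + hb * s) *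
    ∏ l : Fin 2, ∏ n : Fin 2,
      crossProdInv (mu 0 l) (mu 1 n) fun s => aBif a l n + m + hb * s

end ToricCY

end

/-! The partitions on the horizontal edges are kept fixed and all others are summed out. Within one
square the powers of q from the vertices cancel against the framings, and the symmetry s_μ(q^{ν+ρ})
s_ν(q^ρ) = s_ν(q^{μ+ρ}) s_μ(q^ρ) (`skewSchur_symm`) puts every horizontal partition into a
specialization, so that the vertical ones occur only as indices of Schur functions
(`squareWeight_eq`). The Cauchy identity (`cauchy`) performs the sums over the vertical edges; the
joining edge ν is then left with one Schur function in a union of two alphabets, the second scaled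
by Q_{F_k} (`sk_mixPow`). The two squares see ν and its conjugate, so the signed sum over ν is a
dual Cauchy sum (`dual_cauchy`), equal to four products of the form ∏ (1 - Q x_i y_j)
(`sum_neg_mul_sk`).

These infinite products are compared with the ones for empty partitions. The power sums are
p_n(q^{ν+ρ}) = 1/[n] + [n] ∑ q^{nc}, summed over the contents c of ν (`specPowerSum_eq`); hence a
product of two of them differs from its empty value by a Laurent polynomial in q^n whose
coefficients are, up to sign, the net multiplicities (`specPowerSum_mul`). The ratio of the infinite
products is therefore the finite product `crossPoly` of powers of 1 - q^k Q, a genuine polynomial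
because all net multiplicities are nonpositive (`netMult_nonpos`). The remaining constants
s_λ(q^ρ)^2 are products over the same multiplicities (`skewSchur_bot_sq`). Thus each quadruple
contributes the quotient of `quadNum` by `quadDen` after division by the empty quadruple, and the
identity 1 - q^k Q = 2 e^{-RA} q^{k/2} sinh R(A + ħk) for Q = e^{-2RA} turns this into part (1). In
part (2) all powers of 2 and of R cancel under the rescaling, and sinh(Rx)/R tends to x.

The symmetric functions are handled through their power sums: `newton p` is exp ∑ p_n X^n / n, and
`sk` is the Jacobi–Trudi determinant in its coefficients. Identities are proved for finitely many
variables by branching rules, adding one variable at a time. They extend to arbitrary power sums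
because only finitely many of these enter, and over an algebraically closed field finitely many
power sums are always realised by finitely many variables (`exists_listPow`). Identities special to
x_i = q^{ν_i - i + 1/2} are proved for the first N variables and continued as polynomial identities
in z = q^{-N} to z = 0 (`NotRoot.polynomial_ext`). -/

noncomputable section

namespace ToricCY

/-! ### Row lengths of Young diagrams -/

theorem ext_rowLen {lam mu : YoungDiagram} (h : ∀ i, lam.rowLen i = mu.rowLen i) : lam = mu := by
  ext ⟨i, j⟩
  simp only [YoungDiagram.mem_cells, YoungDiagram.mem_iff_lt_rowLen, h]

theorem le_iff_rowLen {lam mu : YoungDiagram} : mu ≤ lam ↔ ∀ i, mu.rowLen i ≤ lam.rowLen i := by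
  constructor
  · intro h i
    by_contra hlt
    have h1 : (i, lam.rowLen i) ∈ mu := YoungDiagram.mem_iff_lt_rowLen.2 (by omega)
    exact lt_irrefl _ (YoungDiagram.mem_iff_lt_rowLen.1 (h h1))
  · rintro h ⟨i, j⟩ hc
    exact YoungDiagram.mem_iff_lt_rowLen.2 ((YoungDiagram.mem_iff_lt_rowLen.1 hc).trans_le (h i))

theorem len_le_iff {mu : YoungDiagram} {N : ℕ} : len mu ≤ N ↔ ∀ i, N ≤ i → mu.rowLen i = 0 := by
  constructor
  · exact fun h i hi => rowLen_eq_zero (h.trans hi)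
  · intro h
    by_contra hlt
    have h1 : (N, 0) ∈ mu := YoungDiagram.mem_iff_lt_colLen.2 (by simp only [len] at hlt; omega)
    have h2 := YoungDiagram.mem_iff_lt_rowLen.1 h1
    rw [h N le_rfl] at h2
    exact lt_irrefl _ h2

theorem len_mono {lam mu : YoungDiagram} (h : mu ≤ lam) : len mu ≤ len lam :=
  len_le_iff.2 fun i hi => Nat.le_zero.1 (by
    rw [← rowLen_eq_zero hi]
    exact le_iff_rowLen.1 h i)

/-- A sum over the cells of a diagram, row by row. -/
theorem sum_cells {M : Type*} [AddCommMonoid M] (mu : YoungDiagram) {N : ℕ} (hN : len mu ≤ N)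
    (f : ℕ × ℕ → M) :
    ∑ c ∈ mu.cells, f c = ∑ i ∈ Finset.range N, ∑ j ∈ Finset.range (mu.rowLen i), f (i, j) := by
  rw [← Finset.sum_finset_product' mu.cells (Finset.range N) (fun i => Finset.range (mu.rowLen i))
    (f := fun i j => f (i, j))]
  rintro ⟨i, j⟩
  simp only [YoungDiagram.mem_cells, Finset.mem_range]
  constructor
  · intro h
    refine ⟨?_, YoungDiagram.mem_iff_lt_rowLen.1 h⟩
    by_contra hi
    have := YoungDiagram.mem_iff_lt_rowLen.1 h
    rw [rowLen_eq_zero (by omega)] at this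
    omega
  · exact fun h => YoungDiagram.mem_iff_lt_rowLen.2 h.2

theorem card_eq_sum (mu : YoungDiagram) {N : ℕ} (hN : len mu ≤ N) :
    mu.card = ∑ i ∈ Finset.range N, mu.rowLen i := by
  have h := sum_cells mu hN (fun _ => 1)
  simpa using h

theorem card_mono {lam mu : YoungDiagram} (h : mu ≤ lam) : mu.card ≤ lam.card :=
  Finset.card_le_card (YoungDiagram.cells_subset_iff.2 h)

theorem eq_of_le_of_card {lam mu : YoungDiagram} (h : mu ≤ lam) (hc : mu.card = lam.card) :
    mu = lam := by
  have := Finset.eq_of_subset_of_card_le (YoungDiagram.cells_subset_iff.2 h) hc.ge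
  exact YoungDiagram.ext this

theorem card_eq_zero {mu : YoungDiagram} : mu.card = 0 ↔ mu = ⊥ := by
  constructor
  · intro h
    exact (eq_of_le_of_card bot_le (by rw [h]; rfl)).symm
  · rintro rfl
    rfl

@[simp] theorem card_bot : (⊥ : YoungDiagram).card = 0 := rfl

@[simp] theorem rowLen_bot (i : ℕ) : (⊥ : YoungDiagram).rowLen i = 0 := by
  by_contra h
  exact YoungDiagram.notMem_bot (i, 0) (YoungDiagram.mem_iff_lt_rowLen.2 (Nat.pos_of_ne_zero h))

@[simp] theorem len_bot : len ⊥ = 0 := Nat.le_zero.1 (len_le_iff.2 fun i _ => rowLen_bot i)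

theorem card_transpose (mu : YoungDiagram) : mu.transpose.card = mu.card := by
  simp [YoungDiagram.card, YoungDiagram.transpose]

@[simp] theorem transpose_bot : (⊥ : YoungDiagram).transpose = ⊥ := by
  rw [← card_eq_zero, card_transpose, card_bot]

theorem rowLen_pos_of_lt_len {mu : YoungDiagram} {i : ℕ} (h : i < len mu) : 0 < mu.rowLen i :=
  YoungDiagram.mem_iff_lt_rowLen.1 (YoungDiagram.mem_iff_lt_colLen.2 h)

theorem len_le_card (mu : YoungDiagram) : len mu ≤ mu.card := by
  rw [card_eq_sum mu le_rfl]
  calc len mu = ∑ i ∈ Finset.range (len mu), 1 := by simp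
    _ ≤ _ := Finset.sum_le_sum fun i hi => rowLen_pos_of_lt_len (Finset.mem_range.1 hi)

theorem mem_subPartitions {lam mu : YoungDiagram} : mu ∈ subPartitions lam ↔ mu ≤ lam := by
  simp [subPartitions]

theorem mem_partitionsOf {n : ℕ} {mu : YoungDiagram} : mu ∈ partitionsOf n ↔ mu.card = n := by
  simp [partitionsOf]

/-- A diagram with prescribed (finitely supported, weakly decreasing) row lengths. -/
theorem exists_rowLen {N : ℕ} (c : ℕ → ℤ) (hc : ∀ i, i + 1 < N → c (i + 1) ≤ c i)
    (hlast : ∀ i, i + 1 = N → 0 ≤ c i) :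
    ∃ mu : YoungDiagram, len mu ≤ N ∧ ∀ i < N, (mu.rowLen i : ℤ) = c i := by
  have hanti : ∀ j, j < N → ∀ i ≤ j, c j ≤ c i := by
    intro j
    induction j with
    | zero =>
      intro _ i hi
      rw [Nat.le_zero.1 hi]
    | succ j ih =>
      intro hj i hi
      rcases Nat.lt_or_ge i (j + 1) with h | h
      · exact (hc j hj).trans (ih (by omega) i (by omega))
      · rw [le_antisymm hi h]
  have hnn : ∀ i < N, 0 ≤ c i := fun i hi =>
    (hlast (N - 1) (by omega)).trans (hanti (N - 1) (by omega) i (by omega))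
  let cells : Finset (ℕ × ℕ) :=
    (Finset.range N).biUnion fun i => (Finset.range (c i).toNat).map ⟨fun j => (i, j),
      fun _ _ h => (Prod.mk.inj h).2⟩
  have hmem : ∀ i j, (i, j) ∈ cells ↔ i < N ∧ (j : ℤ) < c i := by
    intro i j
    simp only [cells, Finset.mem_biUnion, Finset.mem_range, Finset.mem_map]
    constructor
    · rintro ⟨a, ha, b, hb, hab⟩
      obtain ⟨rfl, rfl⟩ := Prod.mk.inj hab
      exact ⟨ha, by omega⟩
    · rintro ⟨h1, h2⟩
      exact ⟨i, h1, j, by omega, rfl⟩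
  let mu : YoungDiagram := ⟨cells, by
    rintro ⟨i, j⟩ ⟨i', j'⟩ hle h
    obtain ⟨hi : i' ≤ i, hj : j' ≤ j⟩ := hle
    rw [Finset.mem_coe, hmem] at h ⊢
    have := hanti i h.1 i' hi
    omega⟩
  have hmu : ∀ i j, (i, j) ∈ mu ↔ i < N ∧ (j : ℤ) < c i := hmem
  refine ⟨mu, ?_, ?_⟩
  · refine len_le_iff.2 fun i hi => ?_
    by_contra h
    have := (hmu i 0).1 (YoungDiagram.mem_iff_lt_rowLen.2 (Nat.pos_of_ne_zero h))
    omega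
  · intro i hi
    have h1 : ∀ j : ℕ, j < mu.rowLen i ↔ (j : ℤ) < c i := fun j => by
      rw [← YoungDiagram.mem_iff_lt_rowLen, hmu]
      simp [hi]
    have h2 := h1 (c i).toNat
    have h3 := h1 (mu.rowLen i)
    have := hnn i hi
    omega

/-! ### Strips -/

/-- `lam / mu` has at most one cell in each row. -/
def VStrip (lam mu : YoungDiagram) : Prop := mu ≤ lam ∧ ∀ i j, (i, j + 1) ∈ lam → (i, j) ∈ mu

/-- `lam / mu` has at most one cell in each column. -/
def HStrip (lam mu : YoungDiagram) : Prop := mu ≤ lam ∧ ∀ i j, (i + 1, j) ∈ lam → (i, j) ∈ mu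

theorem hStrip_transpose {lam mu : YoungDiagram} :
    HStrip lam.transpose mu.transpose ↔ VStrip lam mu := by
  unfold HStrip VStrip
  rw [YoungDiagram.transpose_le_iff]
  simp only [YoungDiagram.mem_transpose, Prod.swap_prod_mk]
  exact and_congr_right fun _ => ⟨fun h i j => h j i, fun h i j => h j i⟩

theorem vStrip_iff {lam mu : YoungDiagram} :
    VStrip lam mu ↔ ∀ i, mu.rowLen i ≤ lam.rowLen i ∧ lam.rowLen i ≤ mu.rowLen i + 1 := by
  unfold VStrip
  rw [le_iff_rowLen, forall_and]
  refine and_congr_right fun _ => forall_congr' fun i => ?_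
  simp only [YoungDiagram.mem_iff_lt_rowLen]
  constructor
  · intro h
    by_contra hlt
    have := h (mu.rowLen i) (by omega)
    omega
  · intro h j hj
    omega

theorem hStrip_iff {lam mu : YoungDiagram} :
    HStrip lam mu ↔ ∀ i, mu.rowLen i ≤ lam.rowLen i ∧ lam.rowLen (i + 1) ≤ mu.rowLen i := by
  unfold HStrip
  rw [le_iff_rowLen, forall_and]
  refine and_congr_right fun _ => forall_congr' fun i => ?_
  simp only [YoungDiagram.mem_iff_lt_rowLen]
  constructor
  · intro h
    by_contra hlt
    have := h (mu.rowLen i) (by omega)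
    omega
  · intro h j hj
    omega

/-! ### Jacobi–Trudi determinants -/

section JacobiTrudi

variable {R : Type*} [CommRing R]

/-- The coefficient of a power series with an integer index. -/
def hz (H : PowerSeries R) (n : ℤ) : R := if 0 ≤ n then PowerSeries.coeff n.toNat H else 0

theorem hz_neg (H : PowerSeries R) {n : ℤ} (hn : n < 0) : hz H n = 0 := if_neg (by omega)

theorem hz_natCast (H : PowerSeries R) (n : ℕ) : hz H n = PowerSeries.coeff n H := by
  simp [hz]

theorem hz_zero (H : PowerSeries R) (h : PowerSeries.constantCoeff H = 1) : hz H 0 = 1 := by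
  simp [hz, h]

/-- `det (h_{a_i - b_j})`. -/
def jt (H : PowerSeries R) (N : ℕ) (a b : ℕ → ℤ) : R :=
  (Matrix.of fun i j : Fin N => hz H (a i - b j)).det

/-- `λ_i - i`. -/
def bead (lam : YoungDiagram) (i : ℕ) : ℤ := lam.rowLen i - i

theorem bead_strictAnti (lam : YoungDiagram) : StrictAnti (bead lam) := by
  refine strictAnti_nat_of_succ_lt fun i => ?_
  have := lam.rowLen_anti i (i + 1) (by omega)
  simp only [bead]
  push_cast
  omega

/-- Beyond the length of both partitions the new last row is (0, …, 0, h_0) with h_0 = 1, so the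
size of the determinant is immaterial. -/
theorem jt_succ (H : PowerSeries R) (hH : PowerSeries.constantCoeff H = 1) {lam mu : YoungDiagram}
    {N : ℕ} (hl : len lam ≤ N) (hm : len mu ≤ N) :
    jt H (N + 1) (bead lam) (bead mu) = jt H N (bead lam) (bead mu) := by
  unfold jt
  rw [Matrix.det_succ_row _ (Fin.last N), Finset.sum_eq_single (Fin.last N)]
  · have h1 : (bead lam N - bead mu N) = 0 := by
      simp [bead, rowLen_eq_zero hl, rowLen_eq_zero hm]
    simp only [Matrix.of_apply, Fin.val_last, h1, hz_zero H hH, mul_one, ← two_mul]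
    rw [pow_mul]
    simp only [even_two, Even.neg_pow, one_pow, one_mul]
    congr 1
    ext i j
    simp [Fin.succAbove_last]
  · intro j _ hj
    have hj' : (j : ℕ) < N := by
      have := j.2
      have : (j : ℕ) ≠ N := fun h => hj (Fin.ext h)
      omega
    rw [Matrix.of_apply, hz_neg, mul_zero, zero_mul]
    simp only [bead, Fin.val_last, rowLen_eq_zero hl]
    push_cast
    omega
  · simp

/-- The skew Schur function as a Jacobi–Trudi determinant. -/
def sk (H : PowerSeries R) (lam mu : YoungDiagram) : R :=
  jt H (max (len lam) (len mu)) (bead lam) (bead mu)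

theorem jt_eq_sk (H : PowerSeries R) (hH : PowerSeries.constantCoeff H = 1) {lam mu : YoungDiagram}
    {N : ℕ} (hl : len lam ≤ N) (hm : len mu ≤ N) : jt H N (bead lam) (bead mu) = sk H lam mu := by
  have h : max (len lam) (len mu) ≤ N := max_le hl hm
  induction N, h using Nat.le_induction with
  | base => rfl
  | succ N hN ih =>
    rw [jt_succ H hH ((le_max_left _ _).trans hN) ((le_max_right _ _).trans hN)]
    exact ih ((le_max_left _ _).trans hN) ((le_max_right _ _).trans hN)

/-- The zero block has N - k rows and k + 1 columns, N + 1 in total, so by the pigeonhole principle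
every permutation meets it. -/
theorem det_eq_zero_of_block {N : ℕ} (M : Matrix (Fin N) (Fin N) R) (k : Fin N)
    (h : ∀ i j, k ≤ i → j ≤ k → M i j = 0) : M.det = 0 := by
  rw [Matrix.det_apply]
  refine Finset.sum_eq_zero fun s _ => ?_
  suffices hex : ∃ j, j ≤ k ∧ k ≤ s j by
    obtain ⟨j, hj, hs⟩ := hex
    rw [Finset.prod_eq_zero (f := fun i => M (s i) i) (Finset.mem_univ j) (h _ _ hs hj), smul_zero]
  by_contra hcon
  push Not at hcon
  have h1 : (Finset.Iic k).card ≤ (Finset.Iio k).card :=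
    Finset.card_le_card_of_injOn s (fun j hj => Finset.mem_coe.2 (Finset.mem_Iio.2
      (hcon j (Finset.mem_Iic.1 hj)))) s.injective.injOn
  rw [Fin.card_Iic, Fin.card_Iio] at h1
  omega

theorem sk_eq_zero (H : PowerSeries R) {lam mu : YoungDiagram} (h : ¬ mu ≤ lam) :
    sk H lam mu = 0 := by
  rw [le_iff_rowLen] at h
  push Not at h
  obtain ⟨k, hk⟩ := h
  have hkl : k < len mu := by
    by_contra hlt
    rw [rowLen_eq_zero (by omega : len mu ≤ k)] at hk
    omega
  refine det_eq_zero_of_block _ ⟨k, hkl.trans_le (le_max_right _ _)⟩ fun i j hi hj => ?_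
  rw [Fin.le_def] at hi hj
  simp only at hi hj
  rw [Matrix.of_apply, hz_neg]
  have h1 := lam.rowLen_anti k i hi
  have h2 := mu.rowLen_anti j k hj
  simp only [bead]
  omega

/-- Only the coefficients up to `|λ|` matter. -/
theorem sk_congr {H H' : PowerSeries R} {lam mu : YoungDiagram}
    (h : ∀ n ≤ lam.card, PowerSeries.coeff n H = PowerSeries.coeff n H') :
    sk H lam mu = sk H' lam mu := by
  by_cases hle : mu ≤ lam
  swap
  · rw [sk_eq_zero H hle, sk_eq_zero H' hle]
  unfold sk jt
  congr 1
  ext i j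
  simp only [Matrix.of_apply]
  have hi := i.2
  have hj := j.2
  simp only [max_eq_left (len_mono hle)] at hi hj
  unfold hz
  split_ifs with h0
  · apply h
    suffices hs : lam.rowLen i + (j : ℕ) ≤ lam.card + i by
      simp only [bead] at h0 ⊢
      omega
    rw [card_eq_sum lam le_rfl]
    have h1 : (Finset.range (len lam)).sum (fun k => lam.rowLen k)
        = lam.rowLen i + ∑ k ∈ (Finset.range (len lam)).erase i, lam.rowLen k := by
      rw [Finset.add_sum_erase _ (fun k => lam.rowLen k) (Finset.mem_range.2 hi)]
    -- Each of the other rows has at least one cell; these cells make up for the column offset j in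
    -- the index λ_i - i + j.
    have h2 : ((Finset.range (len lam)).erase i).card
        ≤ ∑ k ∈ (Finset.range (len lam)).erase i, lam.rowLen k := by
      rw [Finset.card_eq_sum_ones]
      refine Finset.sum_le_sum fun k hk => ?_
      exact rowLen_pos_of_lt_len (Finset.mem_range.1 (Finset.mem_of_mem_erase hk))
    rw [Finset.card_erase_of_mem (Finset.mem_range.2 hi), Finset.card_range] at h2
    omega
  · rfl

theorem sk_map {S : Type*} [CommRing S] (f : R →+* S) (H : PowerSeries R) (lam mu : YoungDiagram) :
    sk (PowerSeries.map f H) lam mu = f (sk H lam mu) := by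
  unfold sk jt
  rw [RingHom.map_det]
  congr 1
  ext i j
  simp only [Matrix.of_apply, RingHom.mapMatrix_apply, Matrix.map_apply, hz]
  split_ifs <;> simp

theorem sk_self (H : PowerSeries R) (hH : PowerSeries.constantCoeff H = 1) (lam : YoungDiagram) :
    sk H lam lam = 1 := by
  unfold sk jt
  rw [Matrix.det_of_isUpperTriangular]
  · exact Finset.prod_eq_one fun i _ => by simp [hz_zero H hH]
  · intro i j hij
    rw [Matrix.of_apply, hz_neg]
    have := bead_strictAnti lam (show (j : ℕ) < i from hij)
    omega

theorem sk_bot_bot (H : PowerSeries R) (hH : PowerSeries.constantCoeff H = 1) : sk H ⊥ ⊥ = 1 :=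
  sk_self H hH ⊥

/-- For H = 1 an entry is nonzero only where λ_i - i = μ_j - j. In the first row in which λ exceeds
μ this never happens: earlier j have the larger values λ_j - j, later ones at most μ_i - i. -/
theorem sk_one_of_ne {lam mu : YoungDiagram} (hne : lam ≠ mu) :
    sk (1 : PowerSeries R) lam mu = 0 := by
  by_cases hle : mu ≤ lam
  swap
  · exact sk_eq_zero _ hle
  have hex : ∃ i, lam.rowLen i ≠ mu.rowLen i := by
    by_contra h
    push Not at h
    exact hne (ext_rowLen h)
  classical
  have h1 := Nat.find_spec hex
  have h2 : ∀ k < Nat.find hex, lam.rowLen k = mu.rowLen k := fun k hk => by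
    simpa using Nat.find_min hex hk
  set i := Nat.find hex with hi
  have h3 : mu.rowLen i < lam.rowLen i := lt_of_le_of_ne (le_iff_rowLen.1 hle i) (Ne.symm h1)
  have hil : i < len lam := by
    by_contra hlt
    rw [rowLen_eq_zero (by omega : len lam ≤ i)] at h3
    omega
  refine Matrix.det_eq_zero_of_row_eq_zero ⟨i, hil.trans_le (le_max_left _ _)⟩ fun j => ?_
  simp only [Matrix.of_apply]
  have hne0 : bead lam i - bead mu j ≠ 0 := by
    rcases Nat.lt_or_ge j i with hj | hj
    · have h4 := bead_strictAnti lam hj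
      have h5 := h2 j hj
      simp only [bead] at h4 ⊢
      omega
    · have h4 := (bead_strictAnti mu).antitone hj
      simp only [bead] at h4 ⊢
      omega
  unfold hz
  split_ifs with h0
  · rw [PowerSeries.coeff_one, if_neg (by omega)]
  · rfl

end JacobiTrudi

/-! ### Branching rules: the effect of adding one variable. -/

section Strips

variable {R : Type*} [CommRing R]

open Classical in
/-- The diagrams obtained from `lam` by removing a vertical strip. -/
def vDown (lam : YoungDiagram) : Finset YoungDiagram := (subPartitions lam).filter (VStrip lam)

open Classical in
/-- The diagrams obtained from `lam` by removing a horizontal strip. -/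
def hDown (lam : YoungDiagram) : Finset YoungDiagram := (subPartitions lam).filter (HStrip lam)

theorem mem_vDown {lam mu : YoungDiagram} : mu ∈ vDown lam ↔ VStrip lam mu := by
  simp only [vDown, Finset.mem_filter, mem_subPartitions, and_iff_right_iff_imp]
  exact fun h => h.1

theorem mem_hDown {lam mu : YoungDiagram} : mu ∈ hDown lam ↔ HStrip lam mu := by
  simp only [hDown, Finset.mem_filter, mem_subPartitions, and_iff_right_iff_imp]
  exact fun h => h.1

theorem finite_vUp (mu : YoungDiagram) (k : ℕ) :
    {lam : YoungDiagram | VStrip lam mu ∧ lam.card = mu.card + k}.Finite :=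
  (finite_card_eq (mu.card + k)).subset fun _ h => h.2

/-- The diagrams obtained from `mu` by adding a vertical strip with `k` cells. -/
def vUp (mu : YoungDiagram) (k : ℕ) : Finset YoungDiagram := (finite_vUp mu k).toFinset

theorem mem_vUp {lam mu : YoungDiagram} {k : ℕ} :
    lam ∈ vUp mu k ↔ VStrip lam mu ∧ lam.card = mu.card + k := by
  simp [vUp]

/-- Expansion of a determinant in two families of rows. -/
theorem det_add_smul_rows {N : ℕ} (w : R) (r r' : Fin N → Fin N → R) :
    (Matrix.of fun i j => r i j + w * r' i j).det
      = ∑ s : Finset (Fin N), w ^ s.card *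
        (Matrix.of fun i j => if i ∈ s then r' i j else r i j).det := by
  have h := (Matrix.detRowAlternating (R := R) (n := Fin N)).toMultilinearMap.map_add_univ
    (fun i => w • r' i) r
  have e : (fun i => w • r' i) + r = (Matrix.of fun i j => r i j + w * r' i j) := by
    ext i j
    simp [add_comm]
  rw [e] at h
  refine h.trans (Finset.sum_congr rfl fun s _ => ?_)
  have h2 : s.piecewise (fun i => w • r' i) r
      = s.piecewise (fun i => w • (s.piecewise r' r) i) (s.piecewise r' r) := by
    ext i j
    by_cases hi : i ∈ s <;> simp [hi]
  rw [h2, MultilinearMap.map_piecewise_smul, Finset.prod_const, smul_eq_mul]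
  refine congrArg (fun M : Matrix (Fin N) (Fin N) R => w ^ s.card * M.det)
    (?_ : s.piecewise r' r = _)
  ext i j
  by_cases hi : i ∈ s <;> simp [hi]

theorem hz_mul_one_add (H : PowerSeries R) (w : R) (n : ℤ) :
    hz (H * (1 + PowerSeries.C w * PowerSeries.X)) n = hz H n + w * hz H (n - 1) := by
  rcases lt_trichotomy n 0 with h | rfl | h
  · rw [hz_neg _ h, hz_neg _ h, hz_neg _ (by omega)]
    simp
  · rw [hz_neg H (by omega : (0 : ℤ) - 1 < 0)]
    simp [hz]
  · obtain ⟨m, rfl⟩ : ∃ m : ℕ, n = (m + 1 : ℕ) := ⟨(n - 1).toNat, by omega⟩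
    rw [show ((m + 1 : ℕ) : ℤ) - 1 = (m : ℕ) by push_cast; ring, hz_natCast, hz_natCast, hz_natCast,
      mul_add, mul_one, map_add, mul_comm (PowerSeries.C w), ← mul_assoc, PowerSeries.coeff_mul_C,
      PowerSeries.coeff_succ_mul_X]
    ring

/-- Branching rule for a vertical strip. -/
theorem sk_mul_one_add (H : PowerSeries R) (hH : PowerSeries.constantCoeff H = 1) (w : R)
    (lam nu : YoungDiagram) :
    sk (H * (1 + PowerSeries.C w * PowerSeries.X)) lam nu
      = ∑ mu ∈ vDown lam, w ^ (lam.card - mu.card) * sk H mu nu := by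
  set N := max (len lam) (len nu) with hN
  have hlN : len lam ≤ N := le_max_left _ _
  have hnN : len nu ≤ N := le_max_right _ _
  rw [← jt_eq_sk _ (by simp [hH]) hlN hnN]
  unfold jt
  simp only [hz_mul_one_add]
  rw [det_add_smul_rows w (fun i j => hz H (bead lam i - bead nu j))
    (fun i j => hz H (bead lam i - bead nu j - 1))]
  symm
  refine Finset.sum_of_injOn
    (fun mu => Finset.univ.filter fun i : Fin N => mu.rowLen i < lam.rowLen i) ?_
    (fun _ _ => Finset.mem_coe.2 (Finset.mem_univ _)) ?_ ?_
  · intro mu hmu mu' hmu' heq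
    rw [Finset.mem_coe, mem_vDown, vStrip_iff] at hmu hmu'
    refine ext_rowLen fun i => ?_
    by_cases hi : i < N
    · have h3 := Finset.ext_iff.1 heq ⟨i, hi⟩
      simp only [Finset.mem_filter, Finset.mem_univ, true_and] at h3
      have h1 := hmu i
      have h2 := hmu' i
      omega
    · have h0 := rowLen_eq_zero (mu := lam) (i := i) (by omega)
      have h1 := hmu i
      have h2 := hmu' i
      omega
  · intro s _ hs
    by_contra hne
    apply hs
    have hdet : (Matrix.of fun i j : Fin N => if i ∈ s then hz H (bead lam i - bead nu j - 1)
        else hz H (bead lam i - bead nu j)).det ≠ 0 := fun h => hne (by rw [h, mul_zero])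
    have hc : ∀ i : Fin N, ∃ c : ℤ, c = lam.rowLen i - (if i ∈ s then 1 else 0) := fun i => ⟨_, rfl⟩
    -- If removing a cell from each row in `s` does not leave a partition, the determinant vanishes:
    -- either two consecutive rows coincide, or the last row was empty and all its indices become
    -- negative. So the surviving subsets are the vertical strips.
    obtain ⟨mu, hmu1, hmu2⟩ := exists_rowLen (N := N)
      (fun i => (lam.rowLen i : ℤ) - (if ∃ h : i < N, (⟨i, h⟩ : Fin N) ∈ s then 1 else 0))
      (by
        intro i hi
        by_contra hlt
        push Not at hlt
        have hanti := lam.rowLen_anti i (i + 1) (by omega)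
        have hi' : i < N := by omega
        simp only [hi, hi', exists_true_left] at hlt
        have h1 : (⟨i, hi'⟩ : Fin N) ∈ s := by
          by_contra h1
          rw [if_neg h1] at hlt
          split_ifs at hlt <;> omega
        have h2 : (⟨i + 1, hi⟩ : Fin N) ∉ s := by
          intro h2
          rw [if_pos h1, if_pos h2] at hlt
          omega
        rw [if_pos h1, if_neg h2] at hlt
        refine hdet (Matrix.det_zero_of_row_eq (i := ⟨i, hi'⟩) (j := ⟨i + 1, hi⟩)
          (by simp) ?_)
        ext j
        simp only [Matrix.of_apply, if_pos h1, if_neg h2]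
        congr 1
        simp only [bead]
        push_cast
        omega)
      (by
        intro i hi
        by_contra hlt
        have hi' : i < N := by omega
        simp only [hi', exists_true_left] at hlt
        have h1 : (⟨i, hi'⟩ : Fin N) ∈ s := by
          by_contra h1
          rw [if_neg h1] at hlt
          omega
        rw [if_pos h1] at hlt
        refine hdet (Matrix.det_eq_zero_of_row_eq_zero ⟨i, hi'⟩ fun j => ?_)
        rw [Matrix.of_apply, if_pos h1, hz_neg]
        have := j.2
        simp only [bead]
        omega)
    refine ⟨mu, ?_, ?_⟩
    · rw [Finset.mem_coe, mem_vDown, vStrip_iff]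
      intro i
      by_cases hi : i < N
      · have := hmu2 i hi
        split_ifs at this <;> omega
      · rw [rowLen_eq_zero (by omega : len mu ≤ i), rowLen_eq_zero (by omega : len lam ≤ i)]
        omega
    · ext i
      have := hmu2 i i.2
      simp only [Finset.mem_filter, Finset.mem_univ, true_and]
      simp only [i.2, exists_true_left, Fin.eta] at this
      split_ifs at this with h <;> simp only [h] <;> constructor <;> intro <;> first | omega | trivial
  · intro mu hmu
    rw [mem_vDown] at hmu
    have hmN : len mu ≤ N := (len_mono hmu.1).trans hlN
    rw [vStrip_iff] at hmu
    rw [← jt_eq_sk H hH hmN hnN]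
    congr 1
    · congr 1
      rw [card_eq_sum lam hlN, card_eq_sum mu hmN, Finset.sum_range, Finset.sum_range,
        Finset.card_filter]
      have : ∑ i : Fin N, lam.rowLen i
          = ∑ i : Fin N, mu.rowLen i + ∑ i : Fin N, if mu.rowLen i < lam.rowLen i then 1 else 0 := by
        rw [← Finset.sum_add_distrib]
        refine Finset.sum_congr rfl fun i _ => ?_
        have := hmu i
        split_ifs <;> omega
      omega
    · unfold jt
      congr 1
      ext i j
      have := hmu i
      simp only [Matrix.of_apply, Finset.mem_filter, Finset.mem_univ, true_and]
      split_ifs with h <;> congr 1 <;> simp only [bead] <;> omega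

/-- Adding vertical strips to a diagram, in a determinant with `N` rows. -/
theorem sum_shift_rows (H : PowerSeries R) (w : R) (mu : YoungDiagram) {N : ℕ} (hmN : len mu ≤ N)
    (b : ℕ → ℤ) :
    ∃ S : Finset YoungDiagram, (∀ lam, lam ∈ S ↔ VStrip lam mu ∧ len lam ≤ N) ∧
    (Matrix.of fun i j : Fin N => hz H (bead mu i - b j) + w * hz H (bead mu i + 1 - b j)).det
      = ∑ lam ∈ S, w ^ (lam.card - mu.card) * jt H N (bead lam) b := by
  have hfin : {lam : YoungDiagram | VStrip lam mu ∧ len lam ≤ N}.Finite := by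
    refine ((Finset.range (mu.card + N + 1)).finite_toSet.biUnion fun n _ =>
      finite_card_eq n).subset ?_
    rintro lam ⟨h1, h2⟩
    rw [vStrip_iff] at h1
    simp only [Finset.coe_range, Set.mem_Iio, Set.mem_iUnion, Set.mem_ofPred_eq, exists_prop,
      exists_eq_right']
    rw [card_eq_sum lam h2, card_eq_sum mu hmN]
    have : ∑ i ∈ Finset.range N, lam.rowLen i ≤ ∑ i ∈ Finset.range N, (mu.rowLen i + 1) :=
      Finset.sum_le_sum fun i _ => (h1 i).2
    rw [Finset.sum_add_distrib, Finset.sum_const, Finset.card_range, smul_eq_mul, mul_one] at this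
    omega
  refine ⟨hfin.toFinset, by simp, ?_⟩
  rw [det_add_smul_rows w (fun i j => hz H (bead mu i - b j))
    (fun i j => hz H (bead mu i + 1 - b j))]
  symm
  refine Finset.sum_of_injOn
    (fun lam => Finset.univ.filter fun i : Fin N => mu.rowLen i < lam.rowLen i) ?_
    (fun _ _ => Finset.mem_coe.2 (Finset.mem_univ _)) ?_ ?_
  · intro lam hlam lam' hlam' heq
    simp only [Set.Finite.coe_toFinset, Set.mem_ofPred_eq, vStrip_iff] at hlam hlam'
    refine ext_rowLen fun i => ?_
    by_cases hi : i < N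
    · have h3 := Finset.ext_iff.1 heq ⟨i, hi⟩
      simp only [Finset.mem_filter, Finset.mem_univ, true_and] at h3
      have h1 := hlam.1 i
      have h2 := hlam'.1 i
      omega
    · rw [rowLen_eq_zero (hlam.2.trans (by omega)), rowLen_eq_zero (hlam'.2.trans (by omega))]
  · intro s _ hs
    by_contra hne
    apply hs
    have hdet : (Matrix.of fun i j : Fin N => if i ∈ s then hz H (bead mu i + 1 - b j)
        else hz H (bead mu i - b j)).det ≠ 0 := fun h => hne (by rw [h, mul_zero])
    -- When cells are added the only obstruction is a row outgrowing the equally long row above it,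
    -- and then two rows of the determinant coincide.
    obtain ⟨lam, hlam1, hlam2⟩ := exists_rowLen (N := N)
      (fun i => (mu.rowLen i : ℤ) + (if ∃ h : i < N, (⟨i, h⟩ : Fin N) ∈ s then 1 else 0))
      (by
        intro i hi
        by_contra hlt
        push Not at hlt
        have hanti := mu.rowLen_anti i (i + 1) (by omega)
        have hi' : i < N := by omega
        simp only [hi, hi', exists_true_left] at hlt
        have h1 : (⟨i, hi'⟩ : Fin N) ∉ s := by
          intro h1
          rw [if_pos h1] at hlt
          split_ifs at hlt <;> omega
        have h2 : (⟨i + 1, hi⟩ : Fin N) ∈ s := by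
          by_contra h2
          rw [if_neg h1, if_neg h2] at hlt
          omega
        rw [if_neg h1, if_pos h2] at hlt
        refine hdet (Matrix.det_zero_of_row_eq (i := ⟨i, hi'⟩) (j := ⟨i + 1, hi⟩)
          (by simp) ?_)
        ext j
        simp only [Matrix.of_apply, if_neg h1, if_pos h2]
        congr 1
        simp only [bead]
        push_cast
        omega)
      (by
        intro i hi
        split_ifs <;> omega)
    refine ⟨lam, ?_, ?_⟩
    · simp only [Set.Finite.coe_toFinset, Set.mem_ofPred_eq, vStrip_iff]
      refine ⟨fun i => ?_, hlam1⟩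
      by_cases hi : i < N
      · have := hlam2 i hi
        split_ifs at this <;> omega
      · rw [rowLen_eq_zero (by omega : len mu ≤ i), rowLen_eq_zero (by omega : len lam ≤ i)]
        omega
    · ext i
      have := hlam2 i i.2
      simp only [Finset.mem_filter, Finset.mem_univ, true_and]
      simp only [i.2, exists_true_left, Fin.eta] at this
      split_ifs at this with h <;> simp only [h] <;> constructor <;> intro <;> first | omega | trivial
  · intro lam hlam
    simp only [Set.Finite.mem_toFinset, Set.mem_ofPred_eq, vStrip_iff] at hlam
    obtain ⟨hlam, hlN⟩ := hlam
    congr 1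
    · congr 1
      rw [card_eq_sum lam hlN, card_eq_sum mu hmN, Finset.sum_range, Finset.sum_range,
        Finset.card_filter]
      have : ∑ i : Fin N, lam.rowLen i
          = ∑ i : Fin N, mu.rowLen i + ∑ i : Fin N, if mu.rowLen i < lam.rowLen i then 1 else 0 := by
        rw [← Finset.sum_add_distrib]
        refine Finset.sum_congr rfl fun i _ => ?_
        have := hlam i
        split_ifs <;> omega
      omega
    · unfold jt
      congr 1
      ext i j
      have := hlam i
      simp only [Matrix.of_apply, Finset.mem_filter, Finset.mem_univ, true_and]
      split_ifs with h <;> congr 1 <;> simp only [bead] <;> omega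

/-- The relation h'_n - w h'_{n-1} = h_n telescopes. Stopping after finitely many terms is what
bounds the number of cells removed from a row of a horizontal strip. -/
theorem hz_telescope {H H' : PowerSeries R} {w : R}
    (h : H' * (1 + PowerSeries.C (-w) * PowerSeries.X) = H) (n : ℤ) (m : ℕ) :
    hz H' n - w ^ m * hz H' (n - m) = ∑ k ∈ Finset.range m, w ^ k * hz H (n - k) := by
  induction m with
  | zero => simp
  | succ m ih =>
    rw [Finset.sum_range_succ, ← ih, ← h, hz_mul_one_add]
    push_cast
    rw [show n - ((m : ℤ) + 1) = n - m - 1 by ring]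
    ring

/-- Branching rule for a horizontal strip. -/
theorem sk_of_mul_one_sub {H H' : PowerSeries R} (hH : PowerSeries.constantCoeff H = 1) {w : R}
    (h : H' * (1 + PowerSeries.C (-w) * PowerSeries.X) = H) (lam nu : YoungDiagram) :
    sk H' lam nu = ∑ mu ∈ hDown lam, w ^ (lam.card - mu.card) * sk H mu nu := by
  set N := max (len lam) (len nu) with hN
  have hlN : len lam ≤ N := le_max_left _ _
  have hnN : len nu ≤ N := le_max_right _ _
  have hH' : PowerSeries.constantCoeff H' = 1 := by
    have := congrArg PowerSeries.constantCoeff h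
    simpa [hH] using this
  rw [← jt_eq_sk _ hH' hlN hnN]
  -- With this choice the remainder in `hz_telescope` is w^{d i} times the next row, so the
  -- unitriangular matrix `U` removes it. The sum that is left removes at most λ_i - λ_{i+1} cells
  -- from row i, which is the condition for a horizontal strip.
  set d : ℕ → ℕ := fun i => lam.rowLen i - lam.rowLen (i + 1) + 1 with hd
  let U : Matrix (Fin N) (Fin N) R := Matrix.of fun i k =>
    (if k = i then 1 else 0) - (if (k : ℕ) = i + 1 then w ^ d i else 0)
  have hU : U.det = 1 := by
    rw [Matrix.det_of_isUpperTriangular]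
    · exact Finset.prod_eq_one fun i _ => by simp [U]
    · intro i j hij
      have hij' : (j : ℕ) < i := hij
      simp only [U, Matrix.of_apply]
      rw [if_neg (by rintro rfl; omega), if_neg (by omega), sub_zero]
  have hUA : U * (Matrix.of fun i j : Fin N => hz H' (bead lam i - bead nu j))
      = Matrix.of fun i j : Fin N => ∑ k ∈ Finset.range (d i),
        w ^ k * hz H (bead lam i - k - bead nu j) := by
    ext i j
    rw [Matrix.mul_apply, Matrix.of_apply]
    have h1 := hz_telescope h (bead lam i - bead nu j) (d i)
    have hanti := lam.rowLen_anti i (i + 1) (by omega)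
    have h2 : bead lam i - bead nu j - (d i : ℕ) = bead lam (i + 1) - bead nu j := by
      simp only [bead, hd]
      push_cast
      omega
    rw [h2] at h1
    have h3 : ∀ k : ℕ, bead lam i - k - bead nu j = bead lam i - bead nu j - k := fun k => by ring
    simp only [h3]
    rw [← h1]
    simp only [U, Matrix.of_apply, sub_mul, ite_mul, one_mul, zero_mul, Finset.sum_sub_distrib,
      Finset.sum_ite_eq', Finset.mem_univ, if_true]
    congr 1
    by_cases hi : (i : ℕ) + 1 < N
    · rw [Finset.sum_eq_single ⟨i + 1, hi⟩]
      · simp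
      · intro k _ hk
        rw [if_neg]
        intro hk'
        exact hk (Fin.ext hk')
      · simp
    -- The last row has no successor to subtract; the remainder vanishes anyway, its indices being
    -- negative.
    · rw [Finset.sum_eq_zero, hz_neg, mul_zero]
      · have := i.2
        have := j.2
        have h0 := rowLen_eq_zero (mu := lam) (i := i + 1) (by omega)
        simp only [bead, h0]
        push_cast
        omega
      · intro k _
        have := k.2
        rw [if_neg (by omega)]
  have hdet := congrArg Matrix.det hUA
  rw [Matrix.det_mul, hU, one_mul] at hdet
  refine hdet.trans ?_
  have hms := (Matrix.detRowAlternating (R := R) (n := Fin N)).toMultilinearMap.map_sum_finset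
    (fun i (k : ℕ) => w ^ k • fun j : Fin N => hz H (bead lam i - k - bead nu j))
    (fun i => Finset.range (d i))
  have e : (fun i : Fin N => ∑ k ∈ Finset.range (d i),
        w ^ k • fun j : Fin N => hz H (bead lam i - k - bead nu j))
      = Matrix.of fun i j : Fin N => ∑ k ∈ Finset.range (d i),
        w ^ k * hz H (bead lam i - k - bead nu j) := by
    ext i j
    simp [Finset.sum_apply]
  rw [e] at hms
  refine hms.trans ?_
  symm
  refine Finset.sum_of_injOn (fun mu (i : Fin N) => lam.rowLen i - mu.rowLen i) ?_ ?_ ?_ ?_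
  · intro mu hmu mu' hmu' heq
    rw [Finset.mem_coe, mem_hDown, hStrip_iff] at hmu hmu'
    refine ext_rowLen fun i => ?_
    have h1 := hmu i
    have h2 := hmu' i
    by_cases hi : i < N
    · have h3 := congrFun heq ⟨i, hi⟩
      simp only at h3
      omega
    · have h0 := rowLen_eq_zero (mu := lam) (i := i) (by omega)
      omega
  · intro mu hmu
    rw [Finset.mem_coe, mem_hDown, hStrip_iff] at hmu
    rw [Finset.mem_coe, Fintype.mem_piFinset]
    intro i
    have := hmu i
    simp only [hd, Finset.mem_range]
    omega
  · intro r hr hnot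
    exfalso
    apply hnot
    rw [Fintype.mem_piFinset] at hr
    have hr' : ∀ i (hi : i < N), (r ⟨i, hi⟩ : ℤ) ≤ lam.rowLen i - lam.rowLen (i + 1) := by
      intro i hi
      have h1 := Finset.mem_range.1 (hr ⟨i, hi⟩)
      have h2 := lam.rowLen_anti i (i + 1) (by omega)
      simp only [hd] at h1
      omega
    obtain ⟨mu, hmu1, hmu2⟩ := exists_rowLen (N := N)
      (fun i => (lam.rowLen i : ℤ) - (if h : i < N then (r ⟨i, h⟩ : ℤ) else 0))
      (by
        intro i hi
        have hi' : i < N := by omega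
        have := hr' i hi'
        simp only [hi, hi', dif_pos]
        omega)
      (by
        intro i hi
        have hi' : i < N := by omega
        have := hr' i hi'
        simp only [hi', dif_pos]
        omega)
    refine ⟨mu, ?_, ?_⟩
    · rw [Finset.mem_coe, mem_hDown, hStrip_iff]
      intro i
      by_cases hi : i < N
      · have h1 := hmu2 i hi
        have h2 := hr' i hi
        simp only [hi, dif_pos] at h1
        omega
      · rw [rowLen_eq_zero (by omega : len mu ≤ i), rowLen_eq_zero (by omega : len lam ≤ i),
          rowLen_eq_zero (by omega : len lam ≤ i + 1)]
        omega
    · ext i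
      have h1 := hmu2 i i.2
      have h2 := hr' i i.2
      simp only [i.2, dif_pos, Fin.eta] at h1 h2
      simp only
      omega
  · intro mu hmu
    rw [mem_hDown] at hmu
    have hmN : len mu ≤ N := (len_mono hmu.1).trans hlN
    rw [hStrip_iff] at hmu
    rw [← jt_eq_sk H hH hmN hnN, MultilinearMap.map_smul_univ, smul_eq_mul]
    congr 1
    · rw [Finset.prod_pow_eq_pow_sum]
      congr 1
      rw [card_eq_sum lam hlN, card_eq_sum mu hmN, Finset.sum_range, Finset.sum_range]
      have : ∑ i : Fin N, lam.rowLen i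
          = ∑ i : Fin N, mu.rowLen i + ∑ i : Fin N, (lam.rowLen i - mu.rowLen i) := by
        rw [← Finset.sum_add_distrib]
        refine Finset.sum_congr rfl fun i _ => ?_
        have := hmu i
        omega
      omega
    · unfold jt
      refine congrArg Matrix.det ?_
      ext i j
      have := hmu i
      simp only [Matrix.of_apply]
      congr 1
      simp only [bead]
      omega

end Strips

/-! ### Power sums, Newton's identities and the involution ω. -/

section PowerSums

variable {R : Type*} [CommRing R]

/-- The series `∑ p_{n+1} X^n`. -/
def powerSumSeries (p : ℕ → R) : PowerSeries R := PowerSeries.mk fun n => p (n + 1)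

theorem sum_fin_eq_coeff (p : ℕ → R) (F : PowerSeries R) (n : ℕ) :
    ∑ r : Fin (n + 1), p (n + 1 - r.1) * PowerSeries.coeff r.1 F
      = PowerSeries.coeff n (powerSumSeries p * F) := by
  rw [PowerSeries.coeff_mul, Finset.Nat.sum_antidiagonal_eq_sum_range_succ_mk,
    ← Finset.sum_range_reflect, Finset.sum_range]
  refine Finset.sum_congr rfl fun r _ => ?_
  have := r.2
  rw [powerSumSeries, PowerSeries.coeff_mk]
  congr 2
  · omega
  · congr 1
    omega

/-- The power sums of the finite set of variables `ws`. -/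
def listPow (ws : List R) (n : ℕ) : R := (ws.map fun w => w ^ n).sum

/-- The involution `p_n ↦ (-1)^{n-1} p_n`. -/
def omegaPow (p : ℕ → R) (n : ℕ) : R := -((-1) ^ n * p n)

theorem omegaPow_omegaPow (p : ℕ → R) : omegaPow (omegaPow p) = p := by
  ext n
  simp only [omegaPow, mul_neg, neg_neg, ← mul_assoc, ← mul_pow]
  simp

theorem listPow_cons (w : R) (ws : List R) : listPow (w :: ws) = listPow ws + fun n => w ^ n := by
  ext n
  simp [listPow, add_comm]

theorem omegaPow_listPow_cons (w : R) (ws : List R) :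
    omegaPow (listPow (w :: ws)) = omegaPow (listPow ws) + fun n => -(-w) ^ n := by
  ext n
  simp only [omegaPow, listPow_cons, Pi.add_apply, neg_pow w]
  ring

@[simp] theorem omegaPow_listPow_nil : omegaPow (listPow ([] : List R)) = 0 := by
  ext n
  simp [omegaPow, listPow]

end PowerSums

section Newton

variable {R : Type*} [CommRing R] [Algebra ℚ R]

/-- The complete homogeneous functions determined by power sums through Newton's identities. -/
def newtonCoeff (p : ℕ → R) : ℕ → R
  | 0 => 1
  | n + 1 => (1 / ((n : ℚ) + 1)) • ∑ r : Fin (n + 1), p (n + 1 - r.1) * newtonCoeff p r.1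
  decreasing_by exact r.2

/-- The series `exp (∑ p_n X^n / n)`. -/
def newton (p : ℕ → R) : PowerSeries R := PowerSeries.mk (newtonCoeff p)

@[simp] theorem constantCoeff_newton (p : ℕ → R) : PowerSeries.constantCoeff (newton p) = 1 := by
  rw [← PowerSeries.coeff_zero_eq_constantCoeff_apply, newton, PowerSeries.coeff_mk, newtonCoeff]

theorem smul_succ_cancel (n : ℕ) (x : R) : (1 / ((n : ℚ) + 1)) • (x * ((n : R) + 1)) = x := by
  have h : x * ((n : R) + 1) = ((n : ℚ) + 1) • x := by
    rw [Algebra.smul_def]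
    simp [mul_comm]
  rw [h, smul_smul, one_div, inv_mul_cancel₀ (by positivity), one_smul]

theorem coeff_succ_of_derivative {p : ℕ → R} {F : PowerSeries R} {n : ℕ}
    (h : PowerSeries.coeff n (PowerSeries.derivative R F)
      = PowerSeries.coeff n (powerSumSeries p * F)) :
    PowerSeries.coeff (n + 1) F
      = (1 / ((n : ℚ) + 1)) • ∑ r : Fin (n + 1), p (n + 1 - r.1) * PowerSeries.coeff r.1 F := by
  rw [sum_fin_eq_coeff, ← h, PowerSeries.coeff_derivative, smul_succ_cancel]

theorem derivative_newton (p : ℕ → R) :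
    PowerSeries.derivative R (newton p) = powerSumSeries p * newton p := by
  ext n
  rw [PowerSeries.coeff_derivative, ← sum_fin_eq_coeff]
  simp only [newton, PowerSeries.coeff_mk]
  rw [newtonCoeff, Algebra.smul_mul_assoc, smul_succ_cancel]

/-- In characteristic zero the differential equation is a recursion for the coefficients. The
multiplicativity, scaling and naturality of `newton` are all checked by this characterisation. -/
theorem newton_unique {p : ℕ → R} {F : PowerSeries R} (h0 : PowerSeries.constantCoeff F = 1)
    (h : PowerSeries.derivative R F = powerSumSeries p * F) : F = newton p := by
  ext n
  induction n using Nat.strong_induction_on with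
  | _ n ih =>
    cases n with
    | zero => simp [h0]
    | succ n =>
      rw [coeff_succ_of_derivative (congrArg _ h), coeff_succ_of_derivative
        (congrArg _ (derivative_newton p))]
      congr 1
      exact Finset.sum_congr rfl fun r _ => by rw [ih r.1 r.2]

theorem coeff_newton_congr {p p' : ℕ → R} {n : ℕ} (h : ∀ k, 1 ≤ k → k ≤ n → p k = p' k) :
    PowerSeries.coeff n (newton p) = PowerSeries.coeff n (newton p') := by
  induction n using Nat.strong_induction_on with
  | _ n ih =>
    cases n with
    | zero => simp
    | succ n =>
      rw [coeff_succ_of_derivative (congrArg _ (derivative_newton p)), coeff_succ_of_derivative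
        (congrArg _ (derivative_newton p'))]
      congr 1
      refine Finset.sum_congr rfl fun r _ => ?_
      have hr := r.2
      rw [ih r.1 r.2 fun k h1 h2 => h k h1 (by omega), h _ (by omega) (by omega)]

/-- In degree k - 1 of Newton's equation p_k occurs with the coefficient h_0 = 1, so it can be
solved for. -/
theorem eq_of_coeff_newton {p p' : ℕ → R} {n : ℕ}
    (h : ∀ k ≤ n, PowerSeries.coeff k (newton p) = PowerSeries.coeff k (newton p')) :
    ∀ k, 1 ≤ k → k ≤ n → p k = p' k := by
  intro k
  induction k using Nat.strong_induction_on with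
  | _ k ih =>
    intro h1 h2
    obtain ⟨m, rfl⟩ : ∃ m, k = m + 1 := ⟨k - 1, by omega⟩
    have e1 := congrArg (PowerSeries.coeff m) (derivative_newton p)
    have e2 := congrArg (PowerSeries.coeff m) (derivative_newton p')
    rw [PowerSeries.coeff_derivative, ← sum_fin_eq_coeff, Fin.sum_univ_succ] at e1 e2
    rw [h _ h2, e2] at e1
    have e3 : ∑ i : Fin m, p' (m + 1 - i.succ.1) * PowerSeries.coeff i.succ.1 (newton p')
        = ∑ i : Fin m, p (m + 1 - i.succ.1) * PowerSeries.coeff i.succ.1 (newton p) := by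
      refine Finset.sum_congr rfl fun i _ => ?_
      have hi := i.2
      rw [Fin.val_succ, h _ (by omega), ih _ (by omega) (by omega) (by omega)]
    rw [e3] at e1
    simpa using (add_right_cancel e1).symm

theorem newton_add (p p' : ℕ → R) : newton (p + p') = newton p * newton p' := by
  refine (newton_unique (by simp) ?_).symm
  have : powerSumSeries (p + p') = powerSumSeries p + powerSumSeries p' := by
    ext n
    simp [powerSumSeries]
  rw [Derivation.leibniz, derivative_newton, derivative_newton, this]
  simp only [smul_eq_mul]
  ring

@[simp] theorem newton_zero : newton (0 : ℕ → R) = 1 := by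
  refine (newton_unique (by simp) ?_).symm
  have : powerSumSeries (0 : ℕ → R) = 0 := by
    ext n
    simp [powerSumSeries]
  rw [this]
  simp

theorem newton_mul_newton_neg (p : ℕ → R) : newton p * newton (-p) = 1 := by
  rw [← newton_add, add_neg_cancel, newton_zero]

theorem newton_neg_pow (w : R) :
    newton (fun n => -w ^ n) = 1 + PowerSeries.C (-w) * PowerSeries.X := by
  refine (newton_unique (by simp) ?_).symm
  have h1 : PowerSeries.derivative R (1 + PowerSeries.C (-w) * PowerSeries.X)
      = PowerSeries.C (-w) := by
    rw [map_add, Derivation.leibniz]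
    simp
  rw [h1]
  ext n
  have h2 := hz_mul_one_add (powerSumSeries fun n => -w ^ n) (-w) n
  rw [hz_natCast] at h2
  rw [h2, hz_natCast, PowerSeries.coeff_C]
  cases n with
  | zero => simp [hz, powerSumSeries]
  | succ n =>
    rw [show ((n + 1 : ℕ) : ℤ) - 1 = (n : ℕ) by push_cast; ring, hz_natCast]
    simp only [powerSumSeries, PowerSeries.coeff_mk]
    simp
    ring

theorem newton_neg_neg_pow (w : R) :
    newton (fun n => -(-w) ^ n) = 1 + PowerSeries.C w * PowerSeries.X := by
  rw [newton_neg_pow, neg_neg]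

theorem newton_pow_mul (p : ℕ → R) (w : R) :
    newton (p + fun n => w ^ n) * (1 + PowerSeries.C (-w) * PowerSeries.X) = newton p := by
  rw [← newton_neg_pow, ← newton_add]
  congr 1
  ext n
  simp

theorem newton_rescale (p : ℕ → R) (c : R) :
    newton (fun n => c ^ n * p n) = PowerSeries.rescale c (newton p) := by
  refine (newton_unique (by
    rw [← PowerSeries.coeff_zero_eq_constantCoeff_apply, PowerSeries.coeff_rescale]
    simp) ?_).symm
  ext n
  rw [PowerSeries.coeff_derivative, PowerSeries.coeff_rescale, ← sum_fin_eq_coeff]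
  have h := congrArg (PowerSeries.coeff n) (derivative_newton p)
  rw [PowerSeries.coeff_derivative, ← sum_fin_eq_coeff] at h
  rw [mul_assoc, h, Finset.mul_sum]
  refine Finset.sum_congr rfl fun r _ => ?_
  rw [PowerSeries.coeff_rescale]
  have hr := r.2
  have hp : c ^ (n + 1) = c ^ (n + 1 - r.1) * c ^ r.1 := by
    rw [← pow_add]
    congr 1
    omega
  rw [hp]
  ring

theorem newton_map {S : Type*} [CommRing S] [Algebra ℚ S] (f : R →+* S) (p : ℕ → R) :
    PowerSeries.map f (newton p) = newton fun n => f (p n) := by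
  refine newton_unique (by
    rw [← PowerSeries.coeff_zero_eq_constantCoeff_apply, PowerSeries.coeff_map,
      PowerSeries.coeff_zero_eq_constantCoeff_apply, constantCoeff_newton, map_one]) ?_
  ext n
  have h := congrArg (fun x => f (PowerSeries.coeff n x)) (derivative_newton p)
  simp only [PowerSeries.coeff_derivative, ← sum_fin_eq_coeff, map_mul, map_sum] at h
  rw [PowerSeries.coeff_derivative, ← sum_fin_eq_coeff]
  simpa using h

theorem exists_newton (F : PowerSeries R) (h : PowerSeries.constantCoeff F = 1) :
    ∃ p : ℕ → R, newton p = F := by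
  set G := PowerSeries.invOfUnit F 1
  have hG : F * G = 1 := PowerSeries.mul_invOfUnit F 1 (by simpa using h)
  refine ⟨fun n => PowerSeries.coeff (n - 1) (PowerSeries.derivative R F * G),
    (newton_unique h ?_).symm⟩
  have : powerSumSeries (fun n => PowerSeries.coeff (n - 1) (PowerSeries.derivative R F * G))
      = PowerSeries.derivative R F * G := by
    ext n
    simp [powerSumSeries]
  rw [this, mul_assoc, mul_comm G, hG, mul_one]

theorem sk_newton_congr {p p' : ℕ → R} {lam mu : YoungDiagram}
    (h : ∀ k, 1 ≤ k → k ≤ lam.card → p k = p' k) :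
    sk (newton p) lam mu = sk (newton p') lam mu :=
  sk_congr fun _ hn => coeff_newton_congr fun k h1 h2 => h k h1 (h2.trans hn)

theorem newton_omegaPow_cons (w : R) (ws : List R) : newton (omegaPow (listPow (w :: ws)))
    = newton (omegaPow (listPow ws)) * (1 + PowerSeries.C w * PowerSeries.X) := by
  rw [omegaPow_listPow_cons, newton_add, newton_neg_neg_pow]

/-- Adding a variable removes a vertical strip on one side and a horizontal strip on the other, and
conjugation exchanges the two kinds of strips. -/
theorem sk_omega_list (ws : List R) (lam : YoungDiagram) :
    sk (newton (omegaPow (listPow ws))) lam ⊥ = sk (newton (listPow ws)) lam.transpose ⊥ := by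
  induction ws generalizing lam with
  | nil =>
    have h0 : listPow ([] : List R) = 0 := by
      ext n
      simp [listPow]
    rw [omegaPow_listPow_nil, h0, newton_zero]
    by_cases h : lam = ⊥
    · subst h
      rw [transpose_bot]
    · rw [sk_one_of_ne h, sk_one_of_ne]
      rwa [Ne, YoungDiagram.transpose_eq_iff_eq_transpose, transpose_bot]
  | cons w ws ih =>
    rw [newton_omegaPow_cons, sk_mul_one_add _ (by simp),
      sk_of_mul_one_sub (H := newton (listPow ws)) (by simp) (w := w)
        (by rw [listPow_cons, newton_pow_mul])]
    refine Finset.sum_bij' (fun mu _ => mu.transpose) (fun mu _ => mu.transpose) ?_ ?_ ?_ ?_ ?_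
    · intro mu hmu
      rwa [mem_hDown, hStrip_transpose, ← mem_vDown]
    · intro mu hmu
      rw [mem_vDown, ← hStrip_transpose]
      simpa [← mem_hDown] using hmu
    · simp
    · simp
    · intro mu _
      rw [ih, card_transpose, card_transpose]

/-- Both sides obey the same vertical strip branching rule in λ when a variable joins the first
alphabet, so induction on its size reduces to the empty alphabet. -/
theorem sk_add_list (ws : List R) (p : ℕ → R) (lam nu : YoungDiagram) :
    sk (newton (omegaPow (listPow ws) + p)) lam nu
      = ∑ mu ∈ subPartitions lam,
        sk (newton (omegaPow (listPow ws))) lam mu * sk (newton p) mu nu := by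
  induction ws generalizing lam with
  | nil =>
    classical
    rw [omegaPow_listPow_nil, zero_add, newton_zero, Finset.sum_eq_single lam, sk_self _ (by simp),
      one_mul]
    · intro mu _ hmu
      rw [sk_one_of_ne (Ne.symm hmu), zero_mul]
    · simp [mem_subPartitions]
  | cons w ws ih =>
    have e : newton (omegaPow (listPow (w :: ws)) + p)
        = newton (omegaPow (listPow ws) + p) * (1 + PowerSeries.C w * PowerSeries.X) := by
      rw [newton_add, newton_omegaPow_cons, newton_add]
      ring
    rw [e, newton_omegaPow_cons, sk_mul_one_add _ (by simp)]
    simp only [sk_mul_one_add _ (constantCoeff_newton (omegaPow (listPow ws))), Finset.sum_mul]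
    rw [Finset.sum_comm]
    refine Finset.sum_congr rfl fun kap hkap => ?_
    rw [ih, Finset.mul_sum]
    rw [mem_vDown] at hkap
    classical
    -- Enlarging the range from subdiagrams of `kap` to those of `lam` adds only vanishing skew
    -- Schur functions.
    refine Finset.sum_subset_zero_on_sdiff ?_ ?_ ?_
    · intro mu hmu
      rw [mem_subPartitions] at hmu ⊢
      exact hmu.trans hkap.1
    · intro mu hmu
      rw [Finset.mem_sdiff, mem_subPartitions, mem_subPartitions] at hmu
      rw [sk_eq_zero _ hmu.2]
      ring
    · intro mu _
      ring

end Newton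

/-! ### From finitely many variables to arbitrary power sums. -/

section AlgClosed

variable {K : Type*} [Field K] [Algebra ℚ K] [IsAlgClosed K]

/-- The polynomial splits into factors 1 - wX, where w runs over the inverses of its roots; these
are nonzero because P(0) = 1. -/
theorem exists_list_of_polynomial (P : Polynomial K) (h0 : P.coeff 0 = 1) :
    ∃ ws : List K, (P : PowerSeries K) = newton (-listPow ws) := by
  induction hn : P.natDegree using Nat.strong_induction_on generalizing P with
  | _ n ih =>
    by_cases hd : P.natDegree = 0
    · refine ⟨[], ?_⟩
      have h1 : -listPow ([] : List K) = 0 := by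
        ext n
        simp [listPow]
      rw [Polynomial.eq_C_of_natDegree_eq_zero hd, h0, h1]
      simp
    · have hP : P ≠ 0 := by
        rintro rfl
        simp at h0
      obtain ⟨r, hr⟩ := IsAlgClosed.exists_root P (by
        rw [Polynomial.degree_eq_natDegree hP]
        exact_mod_cast hd)
      have hr0 : r ≠ 0 := by
        rintro rfl
        rw [Polynomial.IsRoot, ← Polynomial.coeff_zero_eq_eval_zero, h0] at hr
        exact one_ne_zero hr
      obtain ⟨Q, hQ⟩ := Polynomial.dvd_iff_isRoot.2 hr
      have hQ' : P = (1 + Polynomial.C (-r⁻¹) * Polynomial.X) * (Polynomial.C (-r) * Q) := by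
        rw [hQ, ← mul_assoc]
        congr 1
        have : Polynomial.C (-r⁻¹) * Polynomial.C (-r) = (1 : Polynomial K) := by
          rw [← Polynomial.C_mul]
          simp [hr0]
        simp only [Polynomial.C_neg] at this ⊢
        linear_combination -Polynomial.X * this
      have hQ0 : (Polynomial.C (-r) * Q).coeff 0 = 1 := by
        have := congrArg (fun p => Polynomial.coeff p 0) hQ'
        simp only [Polynomial.mul_coeff_zero, h0] at this
        simpa [Polynomial.mul_coeff_zero] using this.symm
      have hdeg : (Polynomial.C (-r) * Q).natDegree < n := by
        rw [Polynomial.natDegree_C_mul (neg_ne_zero.2 hr0), ← hn, hQ, Polynomial.natDegree_mul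
          (Polynomial.X_sub_C_ne_zero r) (by rintro rfl; simp at hQ0), Polynomial.natDegree_X_sub_C]
        omega
      obtain ⟨ws, hws⟩ := ih _ hdeg _ hQ0 rfl
      refine ⟨r⁻¹ :: ws, ?_⟩
      rw [hQ', Polynomial.coe_mul, hws]
      have : -listPow (r⁻¹ :: ws) = (fun n => -(r⁻¹) ^ n) + -listPow ws := by
        rw [listPow_cons]
        ext n
        simp
      rw [this, newton_add, newton_neg_pow]
      simp

/-- Any finite number of power sums is realised by finitely many variables. -/
theorem exists_listPow (p : ℕ → K) (n : ℕ) : ∃ ws : List K, ∀ k, 1 ≤ k → k ≤ n →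
    p k = listPow ws k := by
  -- For variables w, the series of the negated power sums is the polynomial ∏ (1 - wX). The
  -- truncation of `newton (-p)` is such a product, and truncation does not affect the first n power
  -- sums.
  obtain ⟨ws, hws⟩ := exists_list_of_polynomial (PowerSeries.trunc (n + 1) (newton (-p)))
    (by simp [PowerSeries.coeff_trunc])
  refine ⟨ws, fun k h1 h2 => ?_⟩
  have := eq_of_coeff_newton (p := -p) (p' := -listPow ws) (n := n) (fun k hk => by
    rw [← hws, Polynomial.coeff_coe, PowerSeries.coeff_trunc, if_pos (by omega)]) k h1 h2
  simpa using this

/-- Only the power sums up to |λ| enter on either side, and those may be taken from finitely many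
variables. -/
theorem sk_omega (p : ℕ → K) (lam : YoungDiagram) :
    sk (newton (omegaPow p)) lam ⊥ = sk (newton p) lam.transpose ⊥ := by
  obtain ⟨ws, hws⟩ := exists_listPow p lam.card
  rw [sk_newton_congr (p := p) (p' := listPow ws) (by rwa [card_transpose]), ← sk_omega_list]
  exact sk_newton_congr fun k h1 h2 => by rw [omegaPow, omegaPow, hws k h1 h2]

theorem exists_omegaPow_listPow (p : ℕ → K) (n : ℕ) : ∃ ws : List K, ∀ k, 1 ≤ k → k ≤ n →
    p k = omegaPow (listPow ws) k := by
  obtain ⟨ws, hws⟩ := exists_listPow (omegaPow p) n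
  refine ⟨ws, fun k h1 h2 => ?_⟩
  rw [omegaPow, ← hws k h1 h2, ← omegaPow, omegaPow_omegaPow]

theorem sk_add (p p' : ℕ → K) (lam nu : YoungDiagram) :
    sk (newton (p + p')) lam nu
      = ∑ mu ∈ subPartitions lam, sk (newton p) lam mu * sk (newton p') mu nu := by
  obtain ⟨ws, hws⟩ := exists_omegaPow_listPow p lam.card
  rw [sk_newton_congr (p := p + p') (p' := omegaPow (listPow ws) + p')
    (fun k h1 h2 => by simp [hws k h1 h2]), sk_add_list]
  exact Finset.sum_congr rfl fun mu _ => by rw [sk_newton_congr hws]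

end AlgClosed

/-! ### Pieri's rule and the Cauchy identity. -/

section Pieri

/-- If `1 / H` is a polynomial of degree at most `N`, then shifting the row indices of a
Jacobi–Trudi determinant with `N` rows is right multiplication by a companion matrix. -/
theorem det_shift_rows {R : Type*} [CommRing R] {G H : PowerSeries R} (hGH : G * H = 1)
    (hG : PowerSeries.constantCoeff G = 1) {N : ℕ} (hN : ∀ k, N < k → PowerSeries.coeff k G = 0)
    (w : R) : ∃ c : R, ∀ a : ℕ → ℤ, (∀ i < N, -(N : ℤ) < a i) →
      (Matrix.of fun i j : Fin N => hz H (a i - -(j : ℕ)) + w * hz H (a i + 1 - -(j : ℕ))).det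
        = jt H N a (fun j : ℕ => -(j : ℤ)) * c := by
  -- Shifting the row index is moving to the next column, so `C` only has to express the column
  -- after the last one; the recurrence ∑ g_k h_{n-k} = 0 of length N does this.
  let C : Matrix (Fin N) (Fin N) R := Matrix.of fun k j =>
    if (j : ℕ) + 1 < N then (if (k : ℕ) = j + 1 then 1 else 0) else -PowerSeries.coeff (N - k) G
  refine ⟨(1 + w • C).det, fun a ha => ?_⟩
  unfold jt
  rw [← Matrix.det_mul]
  congr 1
  ext i j
  rw [Matrix.mul_add, Matrix.mul_one, Matrix.mul_smul, Matrix.add_apply, Matrix.smul_apply,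
    Matrix.mul_apply, smul_eq_mul]
  simp only [Matrix.of_apply, C]
  congr 2
  by_cases hj : (j : ℕ) + 1 < N
  · simp only [hj, if_true]
    rw [Finset.sum_eq_single ⟨j + 1, hj⟩]
    · simp only [if_true, mul_one]
      congr 1
      push_cast
      ring
    · intro k _ hk
      rw [if_neg (fun h => hk (Fin.ext h)), mul_zero]
    · simp
  · simp only [hj, if_false]
    have hjN : (j : ℕ) + 1 = N := by
      have := j.2
      omega
    have hpos := ha i i.2
    -- The recurrence is used in degree a_i + N, which must be positive: in degree 0 the coefficient
    -- of G H is 1 instead of 0. Hence the strict bound on `a`.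
    obtain ⟨m, hm⟩ : ∃ m : ℕ, a i + N = m + 1 := ⟨(a i + N - 1).toNat, by omega⟩
    have h1 := congrArg (PowerSeries.coeff (m + 1)) hGH
    rw [PowerSeries.coeff_mul, PowerSeries.coeff_one, if_neg (by omega),
      Finset.Nat.sum_antidiagonal_eq_sum_range_succ_mk] at h1
    have h2 : ∑ k ∈ Finset.range (m + 1).succ,
        PowerSeries.coeff k G * PowerSeries.coeff (m + 1 - k) H
        = ∑ k ∈ Finset.range (N + 1), PowerSeries.coeff k G * hz H ((m : ℤ) + 1 - k) := by
      have h4 : ∀ k ∈ Finset.range (m + 1).succ,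
          PowerSeries.coeff k G * PowerSeries.coeff (m + 1 - k) H
            = PowerSeries.coeff k G * hz H ((m : ℤ) + 1 - k) := fun k hk => by
        rw [Finset.mem_range] at hk
        rw [← hz_natCast H, show ((m + 1 - k : ℕ) : ℤ) = (m : ℤ) + 1 - k by omega]
      rw [Finset.sum_congr rfl h4,
        Finset.sum_subset (Finset.range_mono (le_max_left (m + 1).succ (N + 1))),
        ← Finset.sum_subset (Finset.range_mono (le_max_right (m + 1).succ (N + 1)))]
      · intro k _ hk
        rw [Finset.mem_range] at hk
        rw [hN k (by omega), zero_mul]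
      · intro k _ hk
        rw [Finset.mem_range] at hk
        rw [hz_neg _ (by omega), mul_zero]
    rw [h2, Finset.sum_range_succ', PowerSeries.coeff_zero_eq_constantCoeff_apply, hG, one_mul] at h1
    have h3 : a i + 1 - -((j : ℕ) : ℤ) = (m : ℤ) + 1 - (0 : ℕ) := by
      push_cast
      omega
    rw [h3, eq_neg_of_add_eq_zero_right h1, ← Finset.sum_range_reflect, Finset.sum_range,
      ← Finset.sum_neg_distrib]
    refine Finset.sum_congr rfl fun k _ => ?_
    have hk := k.2
    rw [mul_neg, mul_comm]
    congr 2
    · congr 1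
      push_cast
      omega
    · congr 2
      omega

theorem neg_lt_bead {mu : YoungDiagram} {N : ℕ} : ∀ i < N, -(N : ℤ) < bead mu i := by
  intro i hi
  simp only [bead]
  omega

theorem bead_bot : bead ⊥ = fun j : ℕ => -(j : ℤ) := by
  ext j
  simp [bead]

/-- A diagram with |μ| + k ≤ N cells has at most N rows, so the row bound loses no strip with k
cells and the k-th coefficient sees all of them. -/
theorem vUp_of_strips {mu : YoungDiagram} {N k : ℕ} (hN : mu.card + k ≤ N)
    {S : Finset YoungDiagram} (hS : ∀ lam, lam ∈ S ↔ VStrip lam mu ∧ len lam ≤ N)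
    {R : Type*} [CommRing R] (f : YoungDiagram → R) :
    (∑ lam ∈ S, Polynomial.X ^ (lam.card - mu.card) * Polynomial.C (f lam)).coeff k
      = ∑ lam ∈ vUp mu k, f lam := by
  classical
  rw [Polynomial.finsetSum_coeff]
  simp only [Polynomial.coeff_X_pow_mul']
  symm
  refine Finset.sum_subset_zero_on_sdiff ?_ ?_ ?_
  · intro lam hlam
    rw [mem_vUp] at hlam
    rw [hS]
    exact ⟨hlam.1, (len_le_card lam).trans (by omega)⟩
  · intro lam hlam
    rw [Finset.mem_sdiff, hS, mem_vUp] at hlam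
    have := card_mono hlam.1.1.1
    split_ifs with h
    · rw [Polynomial.coeff_C, if_neg]
      intro h0
      exact hlam.2 ⟨hlam.1.1, by omega⟩
    · rfl
  · intro lam hlam
    rw [mem_vUp] at hlam
    rw [if_pos (by omega), show k - (lam.card - mu.card) = 0 by omega, Polynomial.coeff_C_zero]

theorem jt_map {R S : Type*} [CommRing R] [CommRing S] (f : R →+* S) (H : PowerSeries R) (N : ℕ)
    (a b : ℕ → ℤ) : jt (PowerSeries.map f H) N a b = f (jt H N a b) := by
  unfold jt
  rw [RingHom.map_det]
  congr 1
  ext i j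
  simp only [Matrix.of_apply, RingHom.mapMatrix_apply, Matrix.map_apply, hz]
  split_ifs <;> simp

/-- The factor `c` from `det_shift_rows` does not depend on the partition. Taking the weight per
added cell as a polynomial variable, the case of the empty partition identifies `c`, and the k-th
coefficient gives the claim. -/
theorem sum_vUp_of_polynomial {R : Type*} [CommRing R] {G H : PowerSeries R} (hGH : G * H = 1)
    (hG : PowerSeries.constantCoeff G = 1) {N : ℕ} (hN : ∀ k, N < k → PowerSeries.coeff k G = 0)
    (mu : YoungDiagram) (k : ℕ) (hk : mu.card + k ≤ N) :
    ∑ lam ∈ vUp mu k, sk H lam ⊥ = sk H mu ⊥ * ∑ lam ∈ vUp ⊥ k, sk H lam ⊥ := by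
  have hH : PowerSeries.constantCoeff H = 1 := by
    have := congrArg PowerSeries.constantCoeff hGH
    simpa [hG] using this
  set H' := PowerSeries.map (Polynomial.C (R := R)) H with hH'
  obtain ⟨c, hc⟩ := det_shift_rows (G := PowerSeries.map (Polynomial.C (R := R)) G)
    (H := H') (by rw [hH', ← map_mul, hGH, map_one])
    (by rw [← PowerSeries.coeff_zero_eq_constantCoeff_apply, PowerSeries.coeff_map,
      PowerSeries.coeff_zero_eq_constantCoeff_apply, hG, map_one])
    (N := N) (fun k hk => by rw [PowerSeries.coeff_map, hN k hk, map_zero]) Polynomial.X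
  have key : ∀ mu : YoungDiagram, len mu ≤ N → ∃ S : Finset YoungDiagram,
      (∀ lam, lam ∈ S ↔ VStrip lam mu ∧ len lam ≤ N) ∧
      ∑ lam ∈ S, Polynomial.X ^ (lam.card - mu.card) * Polynomial.C (sk H lam ⊥)
        = Polynomial.C (sk H mu ⊥) * c := by
    intro mu hmu
    obtain ⟨S, hS, hsum⟩ := sum_shift_rows H' Polynomial.X mu hmu (fun j : ℕ => -(j : ℤ))
    refine ⟨S, hS, ?_⟩
    rw [hc (bead mu) neg_lt_bead, hH', jt_map, ← bead_bot, jt_eq_sk H hH hmu (by simp)] at hsum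
    rw [hsum]
    refine Finset.sum_congr rfl fun lam hlam => ?_
    rw [jt_map, jt_eq_sk H hH ((hS lam).1 hlam).2 (by simp)]
  obtain ⟨S, hS, hsum⟩ := key mu ((len_le_card mu).trans (by omega))
  obtain ⟨S0, hS0, hsum0⟩ := key ⊥ (by simp)
  rw [sk_bot_bot H hH, map_one, one_mul] at hsum0
  rw [← vUp_of_strips hk hS, hsum, ← hsum0, Polynomial.coeff_C_mul,
    vUp_of_strips (by rw [card_bot]; omega) hS0]

theorem sk_single_row {K : Type*} [Field K] (H : PowerSeries K) (hH : PowerSeries.constantCoeff H = 1)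
    {lam : YoungDiagram} (h : len lam ≤ 1) : sk H lam ⊥ = PowerSeries.coeff lam.card H := by
  rw [← jt_eq_sk H hH h (by simp), card_eq_sum lam h]
  simp [jt, bead, hz_natCast]

variable {K : Type*} [Field K] [Algebra ℚ K] [IsAlgClosed K]

/-- The only vertical strip with k cells over the empty partition is a column; ω makes it a row,
whose Schur function is the k-th complete function. -/
theorem sum_vUp_bot (p : ℕ → K) (k : ℕ) :
    ∑ lam ∈ vUp ⊥ k, sk (newton p) lam ⊥ = PowerSeries.coeff k (newton (omegaPow p)) := by
  obtain ⟨nu, hnu1, hnu2⟩ := exists_rowLen (N := 1) (fun _ => (k : ℤ)) (by omega) (by simp)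
  have hcard : nu.card = k := by
    rw [card_eq_sum nu hnu1]
    have := hnu2 0 (by omega)
    simp only [Finset.range_one, Finset.sum_singleton]
    omega
  rw [Finset.sum_eq_single nu.transpose]
  · have h := sk_omega (omegaPow p) nu.transpose
    rw [omegaPow_omegaPow, YoungDiagram.transpose_transpose] at h
    rw [h, sk_single_row _ (by simp) hnu1, hcard]
  · intro lam hlam hne
    exfalso
    apply hne
    rw [mem_vUp, card_bot, zero_add] at hlam
    have h1 : len lam.transpose ≤ 1 := by
      rw [len_le_iff]
      intro i hi
      have := (hStrip_transpose.2 hlam.1)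
      rw [hStrip_iff, transpose_bot] at this
      have := (this (i - 1)).2
      rw [rowLen_bot, Nat.sub_add_cancel hi] at this
      omega
    rw [← YoungDiagram.transpose_transpose lam, YoungDiagram.transpose_eq_iff]
    refine ext_rowLen fun i => ?_
    rcases Nat.lt_or_ge i 1 with hi | hi
    · obtain rfl : i = 0 := by omega
      have h2 := card_eq_sum _ h1
      rw [card_transpose, hlam.2, Finset.range_one, Finset.sum_singleton] at h2
      have := hnu2 0 (by omega)
      omega
    · rw [rowLen_eq_zero (h1.trans hi), rowLen_eq_zero (hnu1.trans hi)]
  · intro hnot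
    exfalso
    apply hnot
    rw [mem_vUp, card_transpose, hcard, card_bot, zero_add, ← hStrip_transpose,
      YoungDiagram.transpose_transpose, transpose_bot, hStrip_iff]
    refine ⟨fun i => ⟨by simp, ?_⟩, rfl⟩
    rw [rowLen_eq_zero (hnu1.trans (by omega)), rowLen_bot]

/-- Pieri's rule for vertical strips. -/
theorem sum_vUp (p : ℕ → K) (mu : YoungDiagram) (k : ℕ) :
    ∑ lam ∈ vUp mu k, sk (newton p) lam ⊥
      = sk (newton p) mu ⊥ * PowerSeries.coeff k (newton (omegaPow p)) := by
  set N := mu.card + k with hN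
  -- Cutting 1/H off after degree N makes it a polynomial and leaves the power sums up to N
  -- unchanged.
  set G : PowerSeries K := ((PowerSeries.trunc (N + 1) (newton (-p)) : Polynomial K) :
    PowerSeries K) with hG
  have hGc : ∀ j, PowerSeries.coeff j G = if j ≤ N then PowerSeries.coeff j (newton (-p)) else 0 := by
    intro j
    rw [hG, Polynomial.coeff_coe, PowerSeries.coeff_trunc]
    exact if_congr (by omega) rfl rfl
  have hG0 : PowerSeries.constantCoeff G = 1 := by
    rw [← PowerSeries.coeff_zero_eq_constantCoeff_apply, hGc, if_pos (Nat.zero_le _)]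
    simp
  obtain ⟨g, hg⟩ := exists_newton G hG0
  have hp : ∀ j, 1 ≤ j → j ≤ N → p j = (-g) j := by
    intro j h1 h2
    have := eq_of_coeff_newton (p := -p) (p' := g) (n := N)
      (fun i hi => by rw [hg, hGc, if_pos hi]) j h1 h2
    simp [← this]
  have h := sum_vUp_of_polynomial (G := G) (H := newton (-g))
    (by rw [← hg, newton_mul_newton_neg]) hG0 (N := N)
    (fun j hj => by rw [hGc, if_neg (by omega)]) mu k le_rfl
  rw [sum_vUp_bot] at h
  rw [sk_newton_congr (p' := -g) (fun j h1 h2 => hp j h1 (by omega)),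
    coeff_newton_congr (p' := omegaPow (-g)) (fun j h1 h2 => by
      rw [omegaPow, omegaPow, hp j h1 (by omega)]), ← h]
  refine Finset.sum_congr rfl fun lam hlam => ?_
  rw [mem_vUp] at hlam
  exact sk_newton_congr fun j h1 h2 => hp j h1 (by omega)

/-- Induction on the variables: the branching rule takes a vertical strip off λ, and the sum over
all λ above what is left is Pieri's rule. The resulting convolution is multiplication of the
generating series by the factor of the new variable. -/
theorem cauchy_list (ws : List K) (p : ℕ → K) (mu : YoungDiagram) (n : ℕ) :
    ∑ lam ∈ partitionsOf n, sk (newton (omegaPow (listPow ws))) lam mu * sk (newton p) lam ⊥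
      = (if mu.card ≤ n then
          PowerSeries.coeff (n - mu.card) (newton (omegaPow (listPow ws) * p)) else 0)
        * sk (newton p) mu ⊥ := by
  classical
  induction ws generalizing n with
  | nil =>
    rw [omegaPow_listPow_nil, zero_mul, newton_zero]
    by_cases h : mu.card = n
    · subst h
      rw [Finset.sum_eq_single mu, if_pos le_rfl, Nat.sub_self]
      · rw [← newton_zero, sk_self _ (by simp)]
        simp
      · intro lam _ hne
        rw [sk_one_of_ne hne, zero_mul]
      · simp [mem_partitionsOf]
    · rw [Finset.sum_eq_zero]
      · split_ifs with hle
        · rw [PowerSeries.coeff_one, if_neg (by omega), zero_mul]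
        · rw [zero_mul]
      · intro lam hlam
        rw [mem_partitionsOf] at hlam
        rw [sk_one_of_ne (by rintro rfl; exact h hlam), zero_mul]
  | cons w ws ih =>
    have e : omegaPow (listPow (w :: ws)) * p
        = omegaPow (listPow ws) * p + fun n => w ^ n * omegaPow p n := by
      ext n
      simp only [omegaPow_listPow_cons, Pi.mul_apply, Pi.add_apply, omegaPow, neg_pow w]
      ring
    rw [e, newton_add, newton_rescale]
    simp only [newton_omegaPow_cons, sk_mul_one_add _ (constantCoeff_newton _), Finset.sum_mul]
    rw [Finset.sum_comm' (t' := (Finset.range (n + 1)).biUnion partitionsOf)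
      (s' := fun kap => vUp kap (n - kap.card))]
    swap
    · intro lam kap
      simp only [mem_partitionsOf, mem_vDown, mem_vUp, Finset.mem_biUnion, Finset.mem_range,
        exists_eq_right']
      constructor
      · rintro ⟨rfl, h2⟩
        have := card_mono h2.1
        exact ⟨⟨h2, by omega⟩, by omega⟩
      · rintro ⟨⟨h1, h2⟩, h3⟩
        exact ⟨by omega, h1⟩
    rw [Finset.sum_biUnion]
    swap
    · intro a _ b _ hab
      refine Finset.disjoint_left.2 fun lam h1 h2 => hab ?_
      rw [mem_partitionsOf] at h1 h2
      omega
    have hstep : ∀ m ∈ Finset.range (n + 1), ∑ kap ∈ partitionsOf m, ∑ lam ∈ vUp kap (n - kap.card),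
        w ^ (lam.card - kap.card) * sk (newton (omegaPow (listPow ws))) kap mu
          * sk (newton p) lam ⊥
        = PowerSeries.coeff (n - m) (PowerSeries.rescale w (newton (omegaPow p))) *
          ((if mu.card ≤ m then
            PowerSeries.coeff (m - mu.card) (newton (omegaPow (listPow ws) * p)) else 0)
              * sk (newton p) mu ⊥) := by
      intro m _
      rw [← ih, Finset.mul_sum]
      refine Finset.sum_congr rfl fun kap hkap => ?_
      rw [mem_partitionsOf] at hkap
      subst hkap
      rw [PowerSeries.coeff_rescale, mul_assoc (w ^ _), mul_left_comm (PowerSeries.coeff _ _),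
        mul_comm (PowerSeries.coeff _ _), ← sum_vUp, Finset.mul_sum, Finset.mul_sum]
      refine Finset.sum_congr rfl fun lam hlam => ?_
      rw [mem_vUp] at hlam
      rw [hlam.2, Nat.add_sub_cancel_left]
      ring
    rw [Finset.sum_congr rfl hstep]
    simp only [← mul_assoc]
    rw [← Finset.sum_mul]
    congr 1
    split_ifs with hle
    · rw [PowerSeries.coeff_mul, Finset.Nat.sum_antidiagonal_eq_sum_range_succ_mk,
        Finset.range_eq_Ico, ← Finset.sum_Ico_consecutive _ (Nat.zero_le mu.card)
          (by omega : mu.card ≤ n + 1), Finset.sum_eq_zero, zero_add,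
        Finset.sum_Ico_eq_sum_range, show n + 1 - mu.card
          = (n - mu.card).succ by omega]
      · refine Finset.sum_congr rfl fun j _ => ?_
        rw [if_pos (by omega), mul_comm]
        congr 2
        · congr 1
          omega
        · congr 1
          omega
      · intro j hj
        rw [Finset.mem_Ico] at hj
        rw [if_neg (by omega), mul_zero]
    · refine Finset.sum_eq_zero fun j hj => ?_
      rw [Finset.mem_range] at hj
      rw [if_neg (by omega), mul_zero]

/-- The Cauchy identity with one skew factor. -/
theorem cauchy (p p' : ℕ → K) (mu : YoungDiagram) (n : ℕ) :
    ∑ lam ∈ partitionsOf n, sk (newton p) lam mu * sk (newton p') lam ⊥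
      = (if mu.card ≤ n then PowerSeries.coeff (n - mu.card) (newton (p * p')) else 0)
        * sk (newton p') mu ⊥ := by
  obtain ⟨ws, hws⟩ := exists_omegaPow_listPow p n
  rw [coeff_newton_congr (p' := omegaPow (listPow ws) * p') (fun k h1 h2 => by
    rw [Pi.mul_apply, Pi.mul_apply, hws k h1 (by omega)]), ← cauchy_list]
  refine Finset.sum_congr rfl fun lam hlam => ?_
  rw [mem_partitionsOf] at hlam
  rw [sk_newton_congr (fun k h1 h2 => hws k h1 (by omega))]

end Pieri

/-! ### Transfer to domains of characteristic zero, such as power series rings. -/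

section Domain

variable {S : Type} [CommRing S] [IsDomain S] [Algebra ℚ S]

variable (S) in
/-- A domain of characteristic zero embeds into an algebraically closed field. -/
theorem exists_embedding : ∃ (K : Type) (_ : Field K) (_ : Algebra ℚ K) (_ : IsAlgClosed K)
    (f : S →+* K), Function.Injective f := by
  have : CharZero S := algebraRat.charZero S
  have : CharZero (FractionRing S) :=
    charZero_of_injective_algebraMap (IsFractionRing.injective S (FractionRing S))
  have : CharZero (AlgebraicClosure (FractionRing S)) :=
    charZero_of_injective_algebraMap (algebraMap (FractionRing S) _).injective
  exact ⟨AlgebraicClosure (FractionRing S), inferInstance, DivisionRing.toRatAlgebra, inferInstance,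
    (algebraMap (FractionRing S) (AlgebraicClosure (FractionRing S))).comp
      (algebraMap S (FractionRing S)),
    (algebraMap (FractionRing S) _).injective.comp (IsFractionRing.injective S (FractionRing S))⟩

theorem sk_add_of_isDomain (p p' : ℕ → S) (lam nu : YoungDiagram) :
    sk (newton (p + p')) lam nu
      = ∑ mu ∈ subPartitions lam, sk (newton p) lam mu * sk (newton p') mu nu := by
  obtain ⟨K, _, _, _, f, hf⟩ := exists_embedding S
  apply hf
  simp only [map_sum, map_mul, ← sk_map, newton_map]
  rw [← sk_add (fun n => f (p n)) (fun n => f (p' n)) lam nu]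
  congr 2
  ext n
  simp

/-- By `sk_omega` the conjugate in the second factor amounts to applying ω to its alphabet, which
reduces to `cauchy` without skewing. -/
theorem dual_cauchy (p p' : ℕ → S) (n : ℕ) :
    ∑ lam ∈ partitionsOf n, sk (newton p) lam ⊥ * sk (newton p') lam.transpose ⊥
      = PowerSeries.coeff n (newton (p * omegaPow p')) := by
  obtain ⟨K, _, _, _, f, hf⟩ := exists_embedding S
  apply hf
  rw [← PowerSeries.coeff_map]
  simp only [map_sum, map_mul, ← sk_map, newton_map, ← sk_omega]
  have h := cauchy (fun n => f (p n)) (omegaPow fun n => f (p' n)) ⊥ n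
  rw [sk_bot_bot _ (by simp), mul_one, card_bot, if_pos (Nat.zero_le _), Nat.sub_zero] at h
  rw [h]
  congr 2
  ext k
  simp [omegaPow]

end Domain

/-! ### Net multiplicities as sums over contents. -/

section Contents

/-- The content of a cell. -/
def content (c : ℕ × ℕ) : ℤ := (c.2 : ℤ) - c.1

variable {M : Type*} [AddCommGroup M]

/-- Row i moves its bead from -i to μ_i - i, and the difference of f telescopes along the cells of
the row. -/
theorem sum_bead (f : ℤ → M) (mu : YoungDiagram) {N : ℕ} (hN : len mu ≤ N) :
    ∑ i ∈ Finset.range N, (f (bead mu i) - f (-(i : ℤ)))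
      = ∑ c ∈ mu.cells, (f (content c + 1) - f (content c)) := by
  rw [sum_cells mu hN]
  refine Finset.sum_congr rfl fun i _ => ?_
  have h := Finset.sum_range_sub (fun j : ℕ => f ((j : ℤ) - i)) (mu.rowLen i)
  simp only [Nat.cast_zero, zero_sub] at h
  simp only [bead, content, ← h]
  refine Finset.sum_congr rfl fun j _ => ?_
  congr 2
  push_cast
  ring

theorem sum_neg_bead (f : ℤ → M) (mu : YoungDiagram) {N : ℕ} (hN : len mu ≤ N) :
    ∑ i ∈ Finset.range N, (f (-bead mu i) - f i)
      = ∑ c ∈ mu.cells, (f (-content c - 1) - f (-content c)) := by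
  have h := sum_bead (fun x => f (-x)) mu hN
  simp only [neg_neg, neg_add, ← sub_eq_add_neg] at h
  exact h

/-- The additive functional `∑_k netMult μ ν k • f k` in terms of contents. -/
def netSum (mu nu : YoungDiagram) (f : ℤ → M) : M :=
  -(∑ c ∈ mu.cells, f (content c)) - ∑ c ∈ nu.cells, f (-content c)
    - ∑ c ∈ mu.cells, ∑ c' ∈ nu.cells, (f (content c - content c' + 1)
      - (2 : ℤ) • f (content c - content c') + f (content c - content c' - 1))

/-- The beads of μ are moved first, then those of ν, each time telescoping over cells. The last two
sums are boundary effects of the cutoff at N; they move off to infinity with N. -/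
theorem sum_cross (f : ℤ → M) (mu nu : YoungDiagram) {N : ℕ} (hm : len mu ≤ N)
    (hn : len nu ≤ N) :
    ∑ i ∈ Finset.range N, ∑ j ∈ Finset.range N,
        (f (bead mu i - bead nu j) - f ((j : ℤ) - i))
      = netSum mu nu f + ∑ c ∈ mu.cells, f (N + content c)
        + ∑ c ∈ nu.cells, f (-N - content c) := by
  have h1 : ∀ i j : ℕ, f (bead mu i - bead nu j) - f ((j : ℤ) - i)
      = (f (bead mu i - bead nu j) - f (-(i : ℤ) - bead nu j))
        + (f (-bead nu j + -(i : ℤ)) - f (j + -(i : ℤ))) := fun i j => by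
    rw [show (-bead nu j + -(i : ℤ)) = -(i : ℤ) - bead nu j by ring,
      show (j + -(i : ℤ)) = (j : ℤ) - i by ring]
    abel
  have h2 : ∑ i ∈ Finset.range N, ∑ j ∈ Finset.range N,
      (f (bead mu i - bead nu j) - f (-(i : ℤ) - bead nu j))
      = ∑ c ∈ mu.cells, (f (content c + N) - f (content c)) +
        ∑ c ∈ mu.cells, ∑ c' ∈ nu.cells,
          ((f (-content c' - 1 + (content c + 1)) - f (-content c' - 1 + content c))
          - (f (-content c' + (content c + 1)) - f (-content c' + content c))) := by
    rw [Finset.sum_comm]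
    have h3 : ∀ j : ℕ, ∑ i ∈ Finset.range N,
        (f (bead mu i - bead nu j) - f (-(i : ℤ) - bead nu j))
        = ∑ c ∈ mu.cells, (f (-bead nu j + (content c + 1)) - f (-bead nu j + content c)) :=
      fun j => by
        rw [sum_bead (fun x => f (x - bead nu j)) mu hm]
        refine Finset.sum_congr rfl fun c _ => ?_
        congr 2 <;> ring
    simp only [h3]
    rw [Finset.sum_comm, ← Finset.sum_add_distrib]
    refine Finset.sum_congr rfl fun c _ => ?_
    have h4 := sum_neg_bead (fun x => f (x + (content c + 1)) - f (x + content c)) nu hn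
    rw [Finset.sum_sub_distrib, sub_eq_iff_eq_add] at h4
    rw [h4, add_comm]
    congr 1
    have h5 := Finset.sum_range_sub (fun j : ℕ => f ((j : ℤ) + content c)) N
    simp only [Nat.cast_zero, zero_add] at h5
    rw [add_comm (content c) (N : ℤ), ← h5]
    refine Finset.sum_congr rfl fun j _ => ?_
    congr 2
    push_cast
    ring
  have h6 : ∑ i ∈ Finset.range N, ∑ j ∈ Finset.range N,
      (f (-bead nu j + -(i : ℤ)) - f (j + -(i : ℤ)))
      = ∑ c ∈ nu.cells, (f (-N - content c) - f (-content c)) := by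
    have h7 : ∀ i : ℕ, ∑ j ∈ Finset.range N, (f (-bead nu j + -(i : ℤ)) - f (j + -(i : ℤ)))
        = ∑ c ∈ nu.cells, (f (-content c - 1 + -(i : ℤ)) - f (-content c + -(i : ℤ))) :=
      fun i => sum_neg_bead (fun x => f (x + -(i : ℤ))) nu hn
    simp only [h7]
    rw [Finset.sum_comm]
    refine Finset.sum_congr rfl fun c _ => ?_
    have h5 := Finset.sum_range_sub (fun j : ℕ => f (-(j : ℤ) - content c)) N
    simp only [Nat.cast_zero, neg_zero, zero_sub] at h5
    rw [← h5]
    refine Finset.sum_congr rfl fun j _ => ?_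
    congr 2
    · push_cast
      ring
    · ring
  simp only [h1, Finset.sum_add_distrib]
  rw [h2, h6, netSum]
  simp only [Finset.sum_sub_distrib, Finset.sum_add_distrib]
  have e1 : ∀ c c' : ℕ × ℕ, -content c' - 1 + (content c + 1) = content c - content c' :=
    fun _ _ => by ring
  have e2 : ∀ c c' : ℕ × ℕ, -content c' - 1 + content c = content c - content c' - 1 :=
    fun _ _ => by ring
  have e3 : ∀ c c' : ℕ × ℕ, -content c' + (content c + 1) = content c - content c' + 1 :=
    fun _ _ => by ring
  have e4 : ∀ c c' : ℕ × ℕ, -content c' + content c = content c - content c' :=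
    fun _ _ => by ring
  have e5 : ∀ c : ℕ × ℕ, content c + N = N + content c := fun _ => by ring
  simp only [e1, e2, e3, e4, e5, two_smul, Finset.sum_add_distrib]
  abel

theorem neg_len_lt_content {mu : YoungDiagram} {c : ℕ × ℕ} (hc : c ∈ mu.cells) :
    -(len mu : ℤ) < content c := by
  obtain ⟨i, j⟩ := c
  have h1 : (i, 0) ∈ mu := mu.up_left_mem le_rfl (Nat.zero_le j) hc
  have h2 : i < len mu := YoungDiagram.mem_iff_lt_colLen.1 h1
  simp only [content]
  omega

/-- The net multiplicities as a finitely supported function. -/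
def netFinsupp (mu nu : YoungDiagram) : ℤ →₀ ℤ := netSum mu nu fun k => Finsupp.single k 1

theorem netSum_hom {M' : Type*} [AddCommGroup M'] (F : M →+ M') (mu nu : YoungDiagram)
    (f : ℤ → M) : F (netSum mu nu f) = netSum mu nu fun k => F (f k) := by
  simp [netSum]

/-- At the cutoff N in `netMult` the boundary terms of `sum_cross` lie at distance more than |k|
from 0, since contents exceed minus the length. -/
theorem netFinsupp_apply (mu nu : YoungDiagram) (k : ℤ) : netFinsupp mu nu k = netMult mu nu k := by
  have h := sum_cross (fun x : ℤ => if x = k then (1 : ℤ) else 0) mu nu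
    (N := k.natAbs + len mu + len nu) (by omega) (by omega)
  rw [Finset.sum_eq_zero (s := mu.cells), Finset.sum_eq_zero (s := nu.cells), add_zero, add_zero] at h
  · rw [netFinsupp, ← Finsupp.applyAddHom_apply, netSum_hom, netMult, crossCount]
    have e : (fun x : ℤ => (Finsupp.applyAddHom k) (Finsupp.single x (1 : ℤ)))
        = fun x => if x = k then (1 : ℤ) else 0 := by
      ext x
      simp [Finsupp.single_apply]
    rw [e, ← h]
    refine Finset.sum_congr rfl fun i _ => Finset.sum_congr rfl fun j _ => ?_
    congr 1
    refine if_congr ?_ rfl rfl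
    simp only [bead]
    constructor <;> intro <;> omega
  · intro c hc
    have := neg_len_lt_content hc
    rw [if_neg]
    omega
  · intro c hc
    have := neg_len_lt_content hc
    rw [if_neg]
    omega

/-- As `netSum` commutes with homomorphisms, it is determined by the universal case k ↦ `single k
1`. This converts sums and products over net multiplicities into sums over cells. -/
theorem sum_netMult_smul (mu nu : YoungDiagram) (f : ℤ → M) :
    (netFinsupp mu nu).sum (fun k n => n • f k) = netSum mu nu f := by
  have h := netSum_hom (Finsupp.liftAddHom fun k : ℤ => (AddMonoidHom.flip (smulAddHom ℤ M)) (f k))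
    mu nu (fun k => Finsupp.single k (1 : ℤ))
  have e : (fun k : ℤ => (Finsupp.liftAddHom fun k : ℤ => (AddMonoidHom.flip (smulAddHom ℤ M)) (f k))
      (Finsupp.single k (1 : ℤ))) = f := by
    ext k
    simp
  rw [e] at h
  rw [← h]
  rfl

/-- The product of `φ(k) ^ netMult` over a finite set. -/
theorem crossProd_eq (mu nu : YoungDiagram) (phi : ℤ → ℂ) :
    crossProd mu nu phi = (netFinsupp mu nu).prod fun k n => phi k ^ n := by
  rw [crossProd, finprod_eq_prod_of_mulSupport_subset (s := (netFinsupp mu nu).support)]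
  · exact Finset.prod_congr rfl fun k _ => by rw [netFinsupp_apply]
  · intro k hk
    rw [Finset.mem_coe, Finsupp.mem_support_iff, netFinsupp_apply]
    intro h0
    exact hk (by simp [h0])

theorem crossProdInv_eq (mu nu : YoungDiagram) (phi : ℤ → ℂ) :
    crossProdInv mu nu phi = (netFinsupp mu nu).prod fun k n => phi k ^ (-n) := by
  rw [crossProdInv, finprod_eq_prod_of_mulSupport_subset (s := (netFinsupp mu nu).support)]
  · exact Finset.prod_congr rfl fun k _ => by rw [netFinsupp_apply]
  · intro k hk
    rw [Finset.mem_coe, Finsupp.mem_support_iff, netFinsupp_apply]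
    intro h0
    exact hk (by simp [h0])

/-- Row by row: since ν_j - j is strictly decreasing, at most one j solves μ_i - ν_j + j - i = k.
The reference equation has the solution j = i + k unless this is cut off, and then μ_i = 0 and the
first equation has no solution below N either. -/
theorem netMult_nonpos_of_nonneg (mu nu : YoungDiagram) {k : ℤ} (hk : 0 ≤ k) :
    netMult mu nu k ≤ 0 := by
  rw [netMult, crossCount]
  set N := k.natAbs + len mu + len nu with hN
  refine Finset.sum_nonpos fun i hi => ?_
  rw [Finset.mem_range] at hi
  rw [Finset.sum_sub_distrib, sub_nonpos]
  by_cases h : i + k.natAbs < N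
  · rw [Finset.sum_eq_single_of_mem (f := fun j : ℕ => if (j : ℤ) - i = k then (1 : ℤ) else 0)
      (i + k.natAbs) (Finset.mem_range.2 h) (fun j _ hj => if_neg (by omega)), if_pos (by omega)]
    rw [Finset.sum_boole]
    have : ((Finset.range N).filter fun j : ℕ =>
        (mu.rowLen i : ℤ) - nu.rowLen j + j - i = k).card ≤ 1 := by
      rw [Finset.card_le_one]
      intro a ha b hb
      rw [Finset.mem_filter] at ha hb
      apply (bead_strictAnti nu).injective
      simp only [bead]
      omega
    exact_mod_cast this
  · rw [Finset.sum_eq_zero]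
    · exact Finset.sum_nonneg fun j _ => by split_ifs <;> norm_num
    · intro j hj
      rw [Finset.mem_range] at hj
      rw [if_neg]
      rw [rowLen_eq_zero (by omega : len mu ≤ i)]
      omega

theorem netMult_swap (mu nu : YoungDiagram) (k : ℤ) : netMult mu nu k = netMult nu mu (-k) := by
  rw [netMult, crossCount_swap, netMult, Int.natAbs_neg, add_right_comm]

theorem netMult_nonpos (mu nu : YoungDiagram) (k : ℤ) : netMult mu nu k ≤ 0 := by
  rcases le_total 0 k with h | h
  · exact netMult_nonpos_of_nonneg mu nu h
  · rw [netMult_swap]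
    exact netMult_nonpos_of_nonneg nu mu (by omega)

/-- Both equations mean i = j, because μ_i - i is injective in i. This keeps the factor sinh 0 out
of the diagonal products. -/
theorem netMult_self_zero (mu : YoungDiagram) : netMult mu mu 0 = 0 := by
  rw [netMult, crossCount]
  refine Finset.sum_eq_zero fun i _ => Finset.sum_eq_zero fun j _ => ?_
  rw [sub_eq_zero]
  refine if_congr ⟨fun h => ?_, fun h => ?_⟩ rfl rfl
  · have : i = j := (bead_strictAnti mu).injective (by simp only [bead]; omega)
    omega
  · obtain rfl : i = j := by omega
    omega

theorem sum_content_eq_kappa (mu : YoungDiagram) : 2 * ∑ c ∈ mu.cells, content c = kappa mu := by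
  rw [sum_cells mu le_rfl, kappa, card_eq_sum mu le_rfl, Finset.mul_sum]
  push_cast
  rw [← Finset.sum_add_distrib]
  refine Finset.sum_congr rfl fun i _ => ?_
  simp only [content]
  generalize mu.rowLen i = n
  induction n with
  | zero => simp
  | succ n ih =>
    rw [Finset.sum_range_succ, mul_add, ih]
    push_cast
    ring

theorem sum_cells_transpose (mu : YoungDiagram) (f : ℤ → M) :
    ∑ c ∈ mu.transpose.cells, f (content c) = ∑ c ∈ mu.cells, f (-content c) := by
  refine Finset.sum_bij' (fun c _ => c.swap) (fun c _ => c.swap) ?_ ?_ ?_ ?_ ?_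
  · intro c hc
    simpa [YoungDiagram.mem_transpose] using hc
  · intro c hc
    simpa [YoungDiagram.mem_transpose] using hc
  · simp
  · simp
  · intro c _
    simp [content]

theorem kappa_transpose (mu : YoungDiagram) : kappa mu.transpose = -kappa mu := by
  rw [← sum_content_eq_kappa, ← sum_content_eq_kappa, sum_cells_transpose mu (fun x => x)]
  simp

end Contents

/-! ### Schur functions of finitely many variables as ratios of alternants. -/

section Bialternant

variable {R : Type*} [CommRing R] [Algebra ℚ R]

theorem coeff_newton_neg_sum {ι : Type*} (s : Finset ι) (y : ι → R) {k : ℕ} (hk : s.card < k) :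
    PowerSeries.coeff k (newton fun n => -∑ i ∈ s, y i ^ n) = 0 := by
  classical
  induction s using Finset.induction_on generalizing k with
  | empty =>
    have : (fun n : ℕ => -∑ i ∈ (∅ : Finset ι), y i ^ n) = 0 := by
      ext n
      simp
    rw [this, newton_zero, PowerSeries.coeff_one, if_neg]
    rintro rfl
    simp at hk
  | insert a s ha ih =>
    have : (fun n : ℕ => -∑ i ∈ insert a s, y i ^ n)
        = (fun n => -∑ i ∈ s, y i ^ n) + fun n => -(y a) ^ n := by
      ext n
      simp [Finset.sum_insert ha, add_comm]
    rw [Finset.card_insert_of_notMem ha] at hk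
    obtain ⟨m, rfl⟩ : ∃ m, k = m + 1 := ⟨k - 1, by omega⟩
    have h := hz_mul_one_add (newton fun n => -∑ i ∈ s, y i ^ n) (-y a) (m + 1 : ℕ)
    rw [show ((m + 1 : ℕ) : ℤ) - 1 = (m : ℕ) by push_cast; ring, hz_natCast, hz_natCast, hz_natCast,
      ih (by omega), ih (by omega), mul_zero, add_zero] at h
    rw [this, newton_add, newton_neg_pow, h]

theorem newton_pow (w : R) : newton (fun n => w ^ n) = PowerSeries.mk fun n => w ^ n := by
  have h1 : newton (fun n => w ^ n) * newton (fun n => -w ^ n) = 1 := by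
    rw [← newton_add, ← newton_zero]
    congr 1
    ext n
    simp
  have h2 : (PowerSeries.mk fun n => w ^ n) * newton (fun n => -w ^ n) = 1 := by
    rw [newton_neg_pow]
    ext n
    have h := hz_mul_one_add (PowerSeries.mk fun n => w ^ n) (-w) n
    rw [hz_natCast] at h
    rw [h, hz_natCast]
    cases n with
    | zero => simp [hz]
    | succ n =>
      rw [show ((n + 1 : ℕ) : ℤ) - 1 = (n : ℕ) by push_cast; ring, hz_natCast]
      simp
      ring
  exact left_inv_eq_right_inv h1 (by rw [mul_comm, h2])

/-- The ratio of alternants formula for the Schur functions of finitely many variables. -/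
theorem bialternant {N : ℕ} (y : Fin N → R) (mu : YoungDiagram) (hmu : len mu ≤ N) :
    (Matrix.of fun i j : Fin N => y i ^ (mu.rowLen j + (N - 1 - j))).det
      = sk (newton fun n => ∑ i, y i ^ n) mu ⊥
        * (Matrix.of fun i j : Fin N => y i ^ (N - 1 - (j : ℕ))).det := by
  classical
  set H := newton fun n => ∑ i, y i ^ n with hH
  -- This is the product of 1 - y_k X over k ≠ i, so `E i * H` is the geometric series of y_i. Hence
  -- powers of y_i are combinations of the h_n with coefficients that do not depend on the
  -- partition.
  let E : Fin N → PowerSeries R := fun i => newton fun n => -∑ k ∈ Finset.univ.erase i, y k ^ n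
  have hEH : ∀ i, E i * H = PowerSeries.mk fun n => y i ^ n := fun i => by
    rw [← newton_pow, hH, ← newton_add]
    congr 1
    ext n
    rw [Pi.add_apply, ← Finset.add_sum_erase _ (fun k => y k ^ n) (Finset.mem_univ i)]
    ring
  have hE : ∀ i k, N ≤ k → PowerSeries.coeff k (E i) = 0 := fun i k hk => by
    refine coeff_newton_neg_sum _ _ ?_
    have := i.2
    rw [Finset.card_erase_of_mem (Finset.mem_univ i), Finset.card_univ, Fintype.card_fin]
    omega
  let EM : Matrix (Fin N) (Fin N) R := Matrix.of fun i j => PowerSeries.coeff (N - 1 - j) (E i)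
  have key : ∀ mu : YoungDiagram, len mu ≤ N →
      (Matrix.of fun i j : Fin N => y i ^ (mu.rowLen j + (N - 1 - j))).det
        = EM.det * sk H mu ⊥ := by
    intro mu hmu
    rw [← jt_eq_sk H (by simp [hH]) hmu (by simp : len ⊥ ≤ N), jt, ← Matrix.det_transpose
      (Matrix.of fun i j : Fin N => hz H (bead mu i - bead ⊥ j)), ← Matrix.det_mul]
    congr 1
    ext i l
    rw [Matrix.mul_apply]
    simp only [Matrix.of_apply, Matrix.transpose_apply, EM]
    have h1 := congrArg (PowerSeries.coeff (mu.rowLen l + (N - 1 - l))) (hEH i)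
    rw [PowerSeries.coeff_mk, PowerSeries.coeff_mul,
      Finset.Nat.sum_antidiagonal_eq_sum_range_succ_mk] at h1
    rw [← h1]
    set m := mu.rowLen l + (N - 1 - l) with hm
    have h4 : ∀ k ∈ Finset.range m.succ,
        PowerSeries.coeff k (E i) * PowerSeries.coeff (m - k) H
          = PowerSeries.coeff k (E i) * hz H ((m : ℤ) - k) := fun k hk => by
      rw [Finset.mem_range] at hk
      rw [← hz_natCast H, show ((m - k : ℕ) : ℤ) = (m : ℤ) - k by omega]
    rw [Finset.sum_congr rfl h4,
      Finset.sum_subset (Finset.range_mono (le_max_left m.succ N)),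
      ← Finset.sum_subset (Finset.range_mono (le_max_right m.succ N)),
      ← Finset.sum_range_reflect, Finset.sum_range]
    · refine Finset.sum_congr rfl fun j _ => ?_
      congr 2
      have := j.2
      have := l.2
      simp only [bead, rowLen_bot]
      omega
    · intro k _ hk
      rw [Finset.mem_range] at hk
      rw [hE i k (by omega), zero_mul]
    · intro k _ hk
      rw [Finset.mem_range] at hk
      rw [hz_neg _ (by omega), mul_zero]
  -- The empty partition identifies `EM.det` with the denominator alternant.
  have h0 := key ⊥ (by simp)
  rw [sk_bot_bot _ (by simp [hH]), mul_one] at h0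
  rw [key mu hmu, ← h0]
  simp only [rowLen_bot, zero_add]
  rw [mul_comm]

end Bialternant

/-! ### The specializations at q^{ν+ρ} and their symmetry. -/

section Specialization

/-- `[n] = q^{n/2} - q^{-n/2}`. -/
def br (u : ℂ) (n : ℤ) : ℂ := u ^ n - u ^ (-n)

/-- `q = u ^ 2` is not zero and not a root of unity. -/
def NotRoot (u : ℂ) : Prop := u ≠ 0 ∧ ∀ n : ℤ, n ≠ 0 → br u n ≠ 0

theorem specH_eq (u : ℂ) (nu : YoungDiagram) (n : ℕ) :
    specH u nu n = newtonCoeff (specPowerSum u nu) n := by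
  induction n using Nat.strong_induction_on with
  | _ n ih =>
    cases n with
    | zero => rw [specH, newtonCoeff]
    | succ n =>
      rw [specH, newtonCoeff, Finset.sum_congr rfl fun r _ => by rw [ih r.1 r.2], Algebra.smul_def,
        div_eq_mul_inv, mul_comm]
      simp

theorem skewSchur_eq (u : ℂ) (lam mu nu : YoungDiagram) :
    skewSchur u lam mu nu = sk (newton (specPowerSum u nu)) lam mu := by
  unfold skewSchur
  split_ifs with h
  · rw [← jt_eq_sk _ (by simp) le_rfl (len_mono h), jt]
    congr 1
    ext i j
    simp only [Matrix.of_apply]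
    rw [show (lam.rowLen i : ℤ) - mu.rowLen j - (i : ℕ) + (j : ℕ) = bead lam i - bead mu j by
      simp only [bead]; ring, specHInt, hz]
    split_ifs
    · rw [specH_eq, newton, PowerSeries.coeff_mk]
    · rfl
  · exact (sk_eq_zero _ h).symm

variable {u : ℂ}

theorem NotRoot.pow_ne_one (hu : NotRoot u) {n : ℕ} (hn : n ≠ 0) : (u ^ (-2 : ℤ)) ^ n ≠ 1 := by
  intro h
  apply hu.2 n (by exact_mod_cast hn)
  rw [← zpow_natCast, ← zpow_mul] at h
  have h1 : u ^ (-(n : ℤ)) = u ^ (n : ℤ) * u ^ (-2 * (n : ℤ)) := by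
    rw [← zpow_add₀ hu.1]
    congr 1
    ring
  rw [br, h1, h, mul_one, sub_self]

theorem NotRoot.zpow_injective (hu : NotRoot u) : Function.Injective fun N : ℕ => (u ^ (-2 : ℤ)) ^ N := by
  have hne : u ^ (-2 : ℤ) ≠ 0 := zpow_ne_zero _ hu.1
  have key : ∀ a b : ℕ, a < b → (u ^ (-2 : ℤ)) ^ a ≠ (u ^ (-2 : ℤ)) ^ b := by
    intro a b hab h
    refine hu.pow_ne_one (n := b - a) (by omega) ?_
    have h2 : (u ^ (-2 : ℤ)) ^ b = (u ^ (-2 : ℤ)) ^ a * (u ^ (-2 : ℤ)) ^ (b - a) := by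
      rw [← pow_add]
      congr 1
      omega
    rw [h2] at h
    exact (mul_left_cancel₀ (pow_ne_zero a hne) (by rw [mul_one]; exact h)).symm
  intro a b h
  rcases lt_trichotomy a b with hab | hab | hab
  · exact absurd h (key a b hab)
  · exact hab
  · exact absurd h.symm (key b a hab)

/-- A polynomial identity in `z` may be checked at `z = q^{-N}` for large `N`. -/
theorem NotRoot.polynomial_ext (hu : NotRoot u) {F G : Polynomial ℂ} (N0 : ℕ)
    (h : ∀ N, N0 ≤ N → F.eval ((u ^ (-2 : ℤ)) ^ N) = G.eval ((u ^ (-2 : ℤ)) ^ N)) : F = G := by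
  refine Polynomial.eq_of_infinite_eval_eq F G (Set.Infinite.mono ?_
    ((Set.Ici_infinite N0).image hu.zpow_injective.injOn))
  rintro _ ⟨N, hN, rfl⟩
  exact h N hN

/-- The power sums with a formal truncation parameter. -/
def truncPowerSum (u : ℂ) (nu : YoungDiagram) (n : ℕ) : Polynomial ℂ :=
  Polynomial.C (specPowerSum u nu n)
    - Polynomial.X ^ n * Polynomial.C ((u ^ (-1 : ℤ)) ^ n / (1 - (u ^ (-2 : ℤ)) ^ n))

theorem eval_sk_trunc (u z : ℂ) (nu lam : YoungDiagram) :
    (sk (newton (truncPowerSum u nu)) lam ⊥).eval z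
      = sk (newton fun n => specPowerSum u nu n
          - z ^ n * ((u ^ (-1 : ℤ)) ^ n / (1 - (u ^ (-2 : ℤ)) ^ n))) lam ⊥ := by
  rw [← Polynomial.coe_evalRingHom, ← sk_map, newton_map]
  congr 2
  ext n
  simp only [truncPowerSum, Polynomial.coe_evalRingHom, Polynomial.eval_sub, Polynomial.eval_mul,
    Polynomial.eval_pow, Polynomial.eval_X, Polynomial.eval_C]

theorem eval_sk_trunc_zero (u : ℂ) (nu lam : YoungDiagram) :
    (sk (newton (truncPowerSum u nu)) lam ⊥).eval 0 = skewSchur u lam ⊥ nu := by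
  rw [eval_sk_trunc, skewSchur_eq]
  refine sk_newton_congr fun k h1 _ => ?_
  rw [zero_pow (by omega), zero_mul, sub_zero]

/-- The tail of the geometric series beyond the first N variables is q^{-nN} q^{-n/2} / (1 -
q^{-n}), exactly what is subtracted at z = q^{-N}. -/
theorem eval_sk_trunc_pow (hu : NotRoot u) (nu lam : YoungDiagram) {N : ℕ} (hN : len nu ≤ N) :
    (sk (newton (truncPowerSum u nu)) lam ⊥).eval ((u ^ (-2 : ℤ)) ^ N)
      = sk (newton fun n => ∑ i : Fin N, specVar u nu i ^ n) lam ⊥ := by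
  rw [eval_sk_trunc]
  refine sk_newton_congr fun n h1 _ => ?_
  rw [specPowerSum, ← Finset.sum_range (fun i => specVar u nu i ^ n)]
  obtain ⟨d, rfl⟩ := Nat.exists_eq_add_of_le hN
  rw [Finset.sum_range_add]
  have h2 : ∀ i, specVar u nu (len nu + i) ^ n
      = (u ^ (-(2 * (len nu : ℤ) + 1))) ^ n * ((u ^ (-2 : ℤ)) ^ n) ^ i := by
    intro i
    rw [specVar, rowLen_eq_zero (by omega : len nu ≤ len nu + i), ← pow_mul, mul_comm n i, pow_mul,
      ← mul_pow, ← zpow_natCast (u ^ (-2 : ℤ)) i, ← zpow_mul, ← zpow_add₀ hu.1]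
    congr 2
    push_cast
    ring
  simp only [h2]
  rw [← Finset.mul_sum, add_sub_assoc]
  congr 1
  have hne := hu.pow_ne_one (n := n) (by omega)
  have h3 : (1 - (u ^ (-2 : ℤ)) ^ n) ≠ 0 := sub_ne_zero.2 (Ne.symm hne)
  have h4 : u ^ (-(2 * (len nu : ℤ) + 1)) = (u ^ (-2 : ℤ)) ^ len nu * u ^ (-1 : ℤ) := by
    rw [← zpow_natCast, ← zpow_mul, ← zpow_add₀ hu.1]
    congr 1
    ring
  rw [geom_sum_eq hne, h4]
  set r := u ^ (-2 : ℤ)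
  set v := u ^ (-1 : ℤ)
  have h5 : r ^ n - 1 ≠ 0 := sub_ne_zero.2 hne
  have h6 : (r ^ n - 1) = -(1 - r ^ n) := by ring
  rw [h6, mul_pow, mul_div_assoc', ← sub_div, mul_div_assoc', div_neg, ← neg_div]
  congr 1
  ring

/-- The variables are `c r^{l_i}` with `l_i = ν_i + N - 1 - i`. -/
theorem specVar_eq (hu0 : u ≠ 0) (nu : YoungDiagram) {N i : ℕ} (hi : i < N) :
    specVar u nu i = u ^ (1 - 2 * (N : ℤ)) * (u ^ 2) ^ (nu.rowLen i + (N - 1 - i)) := by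
  rw [specVar, ← pow_mul, ← zpow_natCast, ← zpow_add₀ hu0]
  congr 1
  push_cast [Nat.sub_sub, Nat.cast_sub (by omega : 1 + i ≤ N)]
  ring

/-- `det (r^{l_i m_j})` for the shifted row lengths `l`, `m`. -/
def powDet (r : ℂ) (N : ℕ) (lam mu : YoungDiagram) : ℂ :=
  (Matrix.of fun i j : Fin N =>
    r ^ ((lam.rowLen i + (N - 1 - i)) * (mu.rowLen j + (N - 1 - j)))).det

theorem powDet_comm (r : ℂ) (N : ℕ) (lam mu : YoungDiagram) :
    powDet r N lam mu = powDet r N mu lam := by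
  rw [powDet, ← Matrix.det_transpose, powDet]
  congr 1
  ext i j
  simp [mul_comm]

theorem det_specVar (hu0 : u ≠ 0) (nu mu : YoungDiagram) (N : ℕ) :
    (Matrix.of fun i j : Fin N => specVar u nu i ^ (mu.rowLen j + (N - 1 - j))).det
      = (∏ j : Fin N, (u ^ (1 - 2 * (N : ℤ))) ^ (mu.rowLen j + (N - 1 - j)))
        * powDet (u ^ 2) N nu mu := by
  rw [powDet, ← Matrix.det_mul_row]
  congr 1
  ext i j
  rw [Matrix.of_apply, Matrix.of_apply, specVar_eq hu0 nu i.2, mul_pow, ← pow_mul, Matrix.of_apply]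

/-- The variables are a constant times powers of q, so the alternants of `bialternant` are multiples
of `powDet`; the surplus degree of the numerator over the denominator is |μ|. -/
theorem sk_mul_powDet (hu0 : u ≠ 0) (nu mu : YoungDiagram) {N : ℕ} (hN : len mu ≤ N) :
    sk (newton fun n => ∑ i : Fin N, specVar u nu i ^ n) mu ⊥ * powDet (u ^ 2) N nu ⊥
      = (u ^ (1 - 2 * (N : ℤ))) ^ mu.card * powDet (u ^ 2) N nu mu := by
  have h := bialternant (fun i : Fin N => specVar u nu i) mu hN
  have h0 := det_specVar hu0 nu ⊥ N
  simp only [rowLen_bot, zero_add] at h0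
  rw [det_specVar hu0, h0] at h
  have hc : (u ^ (1 - 2 * (N : ℤ))) ≠ 0 := zpow_ne_zero _ hu0
  have h1 : (∏ j : Fin N, (u ^ (1 - 2 * (N : ℤ))) ^ (mu.rowLen j + (N - 1 - j)))
      = (u ^ (1 - 2 * (N : ℤ))) ^ mu.card
        * ∏ j : Fin N, (u ^ (1 - 2 * (N : ℤ))) ^ (N - 1 - (j : ℕ)) := by
    rw [card_eq_sum mu hN, Finset.sum_range, ← Finset.prod_pow_eq_pow_sum, ← Finset.prod_mul_distrib]
    exact Finset.prod_congr rfl fun j _ => pow_add _ _ _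
  rw [h1] at h
  have h2 : (∏ j : Fin N, (u ^ (1 - 2 * (N : ℤ))) ^ (N - 1 - (j : ℕ))) ≠ 0 :=
    Finset.prod_ne_zero_iff.2 fun j _ => pow_ne_zero _ hc
  refine mul_left_cancel₀ h2 ?_
  linear_combination -h

/-- This is a Vandermonde determinant with reversed columns; squaring removes the sign of the
reversal. -/
theorem powDet_bot_sq (r : ℂ) (N : ℕ) (lam : YoungDiagram) :
    powDet r N lam ⊥ ^ 2 = (∏ i : Fin N, ∏ j ∈ Finset.Ioi i,
      (r ^ (lam.rowLen j + (N - 1 - j)) - r ^ (lam.rowLen i + (N - 1 - i)))) ^ 2 := by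
  have h : powDet r N lam ⊥ = Equiv.Perm.sign (Fin.revPerm (n := N)) *
      (Matrix.vandermonde fun i : Fin N => r ^ (lam.rowLen i + (N - 1 - i))).det := by
    rw [← Matrix.det_permute', powDet]
    congr 1
    ext i j
    rw [Matrix.submatrix_apply, Matrix.vandermonde_apply, ← pow_mul, Matrix.of_apply]
    congr 2
    rw [rowLen_bot, Fin.revPerm_apply, Fin.val_rev, zero_add]
    omega
  rw [h, mul_pow, Matrix.det_vandermonde]
  have hs : ((Equiv.Perm.sign (Fin.revPerm (n := N)) : ℤ) : ℂ) ^ 2 = 1 := by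
    rcases Int.units_eq_one_or (Equiv.Perm.sign (Fin.revPerm (n := N))) with h | h <;> simp [h]
  rw [hs, one_mul]

theorem pow_sub_pow_eq_br (hu0 : u ≠ 0) (a b : ℕ) :
    (u ^ 2) ^ a - (u ^ 2) ^ b = u ^ ((a : ℤ) + b) * br u ((a : ℤ) - b) := by
  rw [br, mul_sub, ← zpow_add₀ hu0, ← zpow_add₀ hu0, ← pow_mul, ← pow_mul, ← zpow_natCast u (2 * a),
    ← zpow_natCast u (2 * b)]
  congr 2 <;> push_cast <;> ring

theorem powDet_bot_ne_zero (hu : NotRoot u) (N : ℕ) : powDet (u ^ 2) N ⊥ ⊥ ≠ 0 := by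
  intro h
  have h1 := powDet_bot_sq (u ^ 2) N ⊥
  rw [h, zero_pow two_ne_zero, eq_comm, sq_eq_zero_iff, Finset.prod_eq_zero_iff] at h1
  obtain ⟨i, _, hi⟩ := h1
  rw [Finset.prod_eq_zero_iff] at hi
  obtain ⟨j, hj, hj'⟩ := hi
  have hij : i < j := Finset.mem_Ioi.1 hj
  rw [Fin.lt_def] at hij
  have := j.2
  rw [pow_sub_pow_eq_br hu.1, mul_eq_zero] at hj'
  refine hj'.elim (zpow_ne_zero _ hu.1) (hu.2 _ ?_)
  simp only [rowLen_bot]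
  omega

/-- The symmetry `s_μ(q^{ν+ρ}) s_ν(q^ρ) = s_ν(q^{μ+ρ}) s_μ(q^ρ)`. -/
theorem skewSchur_symm (hu : NotRoot u) (mu nu : YoungDiagram) :
    skewSchur u mu ⊥ nu * skewSchur u nu ⊥ ⊥ = skewSchur u nu ⊥ mu * skewSchur u mu ⊥ ⊥ := by
  simp only [← eval_sk_trunc_zero, ← Polynomial.eval_mul]
  congr 1
  -- With N variables the symmetry becomes that of the matrix q^{l_i m_j} under transposition
  -- (`powDet_comm`).
  refine hu.polynomial_ext (len mu + len nu) fun N hN => ?_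
  simp only [Polynomial.eval_mul]
  rw [eval_sk_trunc_pow hu _ _ (by omega), eval_sk_trunc_pow hu _ _ (by simp),
    eval_sk_trunc_pow hu _ _ (by omega), eval_sk_trunc_pow hu _ _ (by simp)]
  have h1 := sk_mul_powDet hu.1 nu mu (N := N) (by omega)
  have h2 := sk_mul_powDet hu.1 ⊥ nu (N := N) (by omega)
  have h3 := sk_mul_powDet hu.1 mu nu (N := N) (by omega)
  have h4 := sk_mul_powDet hu.1 ⊥ mu (N := N) (by omega)
  rw [powDet_comm _ N ⊥ nu] at h2
  rw [powDet_comm _ N ⊥ mu] at h4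
  rw [powDet_comm _ N mu nu] at h3
  refine mul_right_cancel₀ (powDet_bot_ne_zero hu N) ?_
  linear_combination (sk (newton fun n => ∑ i : Fin N, specVar u nu i ^ n) mu ⊥) * h2
    + (u ^ (1 - 2 * (N : ℤ))) ^ nu.card * h1
    - (sk (newton fun n => ∑ i : Fin N, specVar u mu i ^ n) nu ⊥) * h4
    - (u ^ (1 - 2 * (N : ℤ))) ^ mu.card * h3

end Specialization

/-! ### Products over net multiplicities in multiplicative form. -/

section CrossProducts

/-- A nowhere vanishing function as a function to the additive group of units. -/
def addUnits (phi : ℤ → ℂ) (h : ∀ k, phi k ≠ 0) (k : ℤ) : Additive ℂˣ :=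
  Additive.ofMul (Units.mk0 (phi k) (h k))

theorem toMul_netSum (mu nu : YoungDiagram) {phi : ℤ → ℂ} (h : ∀ k, phi k ≠ 0) :
    ((Additive.toMul (netSum mu nu (addUnits phi h)) : ℂˣ) : ℂ) = crossProd mu nu phi := by
  rw [← sum_netMult_smul, crossProd_eq, Finsupp.sum, Finsupp.prod, toMul_sum, Units.coe_prod]
  refine Finset.prod_congr rfl fun k _ => ?_
  rw [toMul_zsmul, Units.val_zpow_eq_zpow_val]
  rfl

/-- This is `sum_cross` in the unit group of ℂ, whence the nonvanishing. -/
theorem prod_cross (mu nu : YoungDiagram) {phi : ℤ → ℂ} (h : ∀ k, phi k ≠ 0) {N : ℕ}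
    (hm : len mu ≤ N) (hn : len nu ≤ N) :
    ∏ i ∈ Finset.range N, ∏ j ∈ Finset.range N, phi (bead mu i - bead nu j)
      = (∏ i ∈ Finset.range N, ∏ j ∈ Finset.range N, phi ((j : ℤ) - i))
        * crossProd mu nu phi * (∏ c ∈ mu.cells, phi (N + content c))
        * ∏ c ∈ nu.cells, phi (-N - content c) := by
  have h1 := sum_cross (addUnits phi h) mu nu hm hn
  simp only [Finset.sum_sub_distrib] at h1
  rw [sub_eq_iff_eq_add'] at h1
  have h2 := congrArg (fun x => ((Additive.toMul x : ℂˣ) : ℂ)) h1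
  simp only [toMul_add, toMul_sum, Units.val_mul, Units.coe_prod, toMul_netSum] at h2
  refine h2.trans ?_
  simp only [mul_assoc]
  rfl

theorem crossProd_congr (mu nu : YoungDiagram) {phi psi : ℤ → ℂ}
    (h : ∀ k, netMult mu nu k ≠ 0 → phi k = psi k) : crossProd mu nu phi = crossProd mu nu psi := by
  unfold crossProd
  refine finprod_congr fun k => ?_
  by_cases hk : netMult mu nu k = 0
  · simp [hk]
  · rw [h k hk]

end CrossProducts

/-! ### The square of s_λ(q^ρ). -/

section PrincipalSpecialization

variable {u : ℂ}

/-- `[n]` with the value at `0` replaced by `1`. -/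
def br' (u : ℂ) (n : ℤ) : ℂ := if n = 0 then 1 else br u n

theorem NotRoot.br'_ne_zero (hu : NotRoot u) (n : ℤ) : br' u n ≠ 0 := by
  unfold br'
  split_ifs with h
  · exact one_ne_zero
  · exact hu.2 n h

theorem br_neg (u : ℂ) (n : ℤ) : br u (-n) = -br u n := by
  simp [br]

/-- Squaring the Vandermonde product lets each pair stand, up to sign, for both of its orderings, so
the product runs over all ordered pairs as `prod_cross` requires. The powers of u come from q^a -
q^b = q^{(a+b)/2} [a - b]. -/
theorem powDet_bot_sq_eq (hu0 : u ≠ 0) (N : ℕ) (lam : YoungDiagram) :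
    powDet (u ^ 2) N lam ⊥ ^ 2
      = (∏ i : Fin N, ∏ _j ∈ Finset.Ioi i, (-1 : ℂ))
        * ((∏ i : Fin N, u ^ (lam.rowLen i + (N - 1 - i))) ^ (N - 1)) ^ 2
        * ∏ i ∈ Finset.range N, ∏ j ∈ Finset.range N, br' u (bead lam i - bead lam j) := by
  have hl : ∀ i j : Fin N, ((lam.rowLen i + (N - 1 - i) : ℕ) : ℤ) - (lam.rowLen j + (N - 1 - j) : ℕ)
      = bead lam i - bead lam j := by
    intro i j
    have := i.2
    have := j.2
    simp only [bead]
    omega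
  have h1 : ∏ i : Fin N, ∏ j ∈ Finset.Ioi i,
      (u ^ (lam.rowLen i + (N - 1 - (i : ℕ))) * u ^ (lam.rowLen j + (N - 1 - (j : ℕ))))
      = (∏ i : Fin N, u ^ (lam.rowLen i + (N - 1 - i))) ^ (N - 1) := by
    rw [Finset.prod_prod_Ioi_mul_eq_prod_prod_off_diag
      (fun _ i : Fin N => u ^ (lam.rowLen i + (N - 1 - (i : ℕ)))), ← Finset.prod_pow]
    refine Finset.prod_congr rfl fun i _ => ?_
    rw [Finset.prod_const, Finset.card_compl, Finset.card_singleton, Fintype.card_fin]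
  have h2 : ∏ i : Fin N, ∏ j ∈ Finset.Ioi i,
      (br u (bead lam j - bead lam i) * br u (bead lam i - bead lam j))
      = ∏ i ∈ Finset.range N, ∏ j ∈ Finset.range N, br' u (bead lam i - bead lam j) := by
    rw [Finset.prod_prod_Ioi_mul_eq_prod_prod_off_diag
      (fun j i : Fin N => br u (bead lam j - bead lam i)), Finset.prod_range, Finset.prod_comm']
    swap
    · exact fun x y => (by
        simp only [Finset.mem_univ, true_and, Finset.mem_compl, Finset.mem_singleton, and_true]
        exact ne_comm : (x ∈ Finset.univ ∧ y ∈ ({x} : Finset (Fin N))ᶜ)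
          ↔ (x ∈ ({y} : Finset (Fin N))ᶜ ∧ y ∈ Finset.univ))
    refine Finset.prod_congr rfl fun i _ => ?_
    rw [Finset.prod_range, ← Finset.mul_prod_erase _ _ (Finset.mem_univ i), br', if_pos (sub_self _),
      one_mul, Finset.compl_singleton]
    refine Finset.prod_congr rfl fun j hj => ?_
    rw [br', if_neg]
    intro h0
    have : (i : ℕ) = j := (bead_strictAnti lam).injective (by omega)
    exact (Finset.mem_erase.1 hj).1 (Fin.ext this.symm)
  rw [powDet_bot_sq, ← h1, ← h2]
  simp only [← Finset.prod_pow, ← Finset.prod_mul_distrib]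
  refine Finset.prod_congr rfl fun i _ => Finset.prod_congr rfl fun j _ => ?_
  rw [pow_sub_pow_eq_br hu0, hl j i, ← neg_sub (bead lam j) (bead lam i), br_neg, zpow_add₀ hu0,
    zpow_natCast, zpow_natCast]
  ring

/-- The square of the principal specialization of a Schur function. -/
theorem skewSchur_bot_sq (hu : NotRoot u) (lam : YoungDiagram) :
    skewSchur u lam ⊥ ⊥ ^ 2 = (-1) ^ lam.card * u ^ kappa lam * crossProd lam lam (br u) := by
  -- The zero of the bracket at 0 may be removed because 0 has net multiplicity 0; `prod_cross` then
  -- applies.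
  have hcong : crossProd lam lam (br u) = crossProd lam lam (br' u) := by
    refine crossProd_congr _ _ fun k hk => ?_
    rw [br', if_neg]
    rintro rfl
    exact hk (netMult_self_zero lam)
  -- At X = q^{-N} the cell factors are, up to powers of u, the boundary factors [N + c] [-N - c] of
  -- `prod_cross`; written this way they are polynomial in X.
  have key : (sk (newton (truncPowerSum u ⊥)) lam ⊥) ^ 2
      = Polynomial.C (crossProd lam lam (br' u)) * ∏ c ∈ lam.cells,
        -(Polynomial.C (u ^ content c) - Polynomial.X * Polynomial.C (u ^ (-content c))) ^ 2 := by
    refine hu.polynomial_ext (len lam) fun N hN => ?_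
    rw [Polynomial.eval_pow, eval_sk_trunc_pow hu _ _ (by simp), Polynomial.eval_mul,
      Polynomial.eval_C, Polynomial.eval_prod]
    set s := sk (newton fun n => ∑ i : Fin N, specVar u ⊥ i ^ n) lam ⊥
    have h1 := sk_mul_powDet hu.1 ⊥ lam (N := N) hN
    rw [powDet_comm _ N ⊥ lam] at h1
    have h2 := congrArg (· ^ 2) h1
    simp only [mul_pow] at h2
    rw [powDet_bot_sq_eq hu.1, powDet_bot_sq_eq hu.1, prod_cross lam lam hu.br'_ne_zero hN hN] at h2
    have h3 : ∏ i ∈ Finset.range N, ∏ j ∈ Finset.range N, br' u (bead ⊥ i - bead ⊥ j)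
        = ∏ i ∈ Finset.range N, ∏ j ∈ Finset.range N, br' u ((j : ℤ) - i) := by
      refine Finset.prod_congr rfl fun i _ => Finset.prod_congr rfl fun j _ => ?_
      congr 1
      simp only [bead, rowLen_bot]
      push_cast
      ring
    rw [h3] at h2
    have h4 : ∏ i : Fin N, u ^ (lam.rowLen i + (N - 1 - (i : ℕ)))
        = u ^ lam.card * ∏ i : Fin N, u ^ ((⊥ : YoungDiagram).rowLen i + (N - 1 - (i : ℕ))) := by
      rw [card_eq_sum lam hN, Finset.sum_range, ← Finset.prod_pow_eq_pow_sum,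
        ← Finset.prod_mul_distrib]
      exact Finset.prod_congr rfl fun i _ => by rw [rowLen_bot, zero_add, pow_add]
    rw [h4] at h2
    set A := ∏ i : Fin N, u ^ ((⊥ : YoungDiagram).rowLen i + (N - 1 - (i : ℕ))) with hA
    set Phi := ∏ i ∈ Finset.range N, ∏ j ∈ Finset.range N, br' u ((j : ℤ) - i) with hPhi
    set sgn := ∏ i : Fin N, ∏ _j ∈ Finset.Ioi i, (-1 : ℂ) with hsgn
    have hA0 : A ≠ 0 := Finset.prod_ne_zero_iff.2 fun i _ => pow_ne_zero _ hu.1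
    have hPhi0 : Phi ≠ 0 := Finset.prod_ne_zero_iff.2 fun i _ =>
      Finset.prod_ne_zero_iff.2 fun j _ => hu.br'_ne_zero _
    have hsgn0 : sgn ≠ 0 := Finset.prod_ne_zero_iff.2 fun i _ =>
      Finset.prod_ne_zero_iff.2 fun j _ => by norm_num
    have h5 : ∏ c ∈ lam.cells, Polynomial.eval ((u ^ (-2 : ℤ)) ^ N)
        (-(Polynomial.C (u ^ content c) - Polynomial.X * Polynomial.C (u ^ (-content c))) ^ 2)
        = ((u ^ (1 - 2 * (N : ℤ))) ^ lam.card) ^ 2 * ((u ^ lam.card) ^ (N - 1)) ^ 2 *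
          ((∏ c ∈ lam.cells, br' u (N + content c)) * ∏ c ∈ lam.cells, br' u (-N - content c)) := by
      rw [← Finset.prod_mul_distrib]
      have h6 : ((u ^ (1 - 2 * (N : ℤ))) ^ lam.card) ^ 2 * ((u ^ lam.card) ^ (N - 1)) ^ 2
          = ∏ c ∈ lam.cells, (u ^ (-(N : ℤ))) ^ 2 := by
        rw [Finset.prod_const]
        change _ = _ ^ lam.card
        rcases Nat.eq_zero_or_pos N with rfl | hpos
        · have : lam.card = 0 := by
            rw [card_eq_sum lam hN]
            simp
          rw [this]
          simp
        · simp only [← zpow_natCast, ← zpow_mul]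
          rw [← zpow_add₀ hu.1]
          congr 1
          push_cast [Nat.cast_sub hpos]
          ring
      rw [h6, ← Finset.prod_mul_distrib]
      refine Finset.prod_congr rfl fun c hc => ?_
      have hpos := neg_len_lt_content hc
      rw [br', if_neg (by omega), br', if_neg (by omega),
        show (-(N : ℤ) - content c) = -(N + content c) by ring, br_neg]
      have h7 : u ^ (-(N : ℤ)) * br u (N + content c)
          = u ^ content c - (u ^ (-2 : ℤ)) ^ N * u ^ (-content c) := by
        rw [br, mul_sub, ← zpow_natCast, ← zpow_mul, ← zpow_add₀ hu.1, ← zpow_add₀ hu.1,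
          ← zpow_add₀ hu.1]
        congr 2 <;> ring
      simp only [Polynomial.eval_neg, Polynomial.eval_pow, Polynomial.eval_sub, Polynomial.eval_mul,
        Polynomial.eval_X, Polynomial.eval_C, ← h7]
      ring
    rw [h5]
    refine mul_right_cancel₀ (mul_ne_zero (mul_ne_zero hsgn0 (pow_ne_zero 2
      (pow_ne_zero (N - 1) hA0))) hPhi0) (h2.trans ?_)
    rw [mul_pow (u ^ lam.card) A]
    ring
  -- Putting X = 0 removes the cutoff and restores all infinitely many variables.
  have h := congrArg (Polynomial.eval 0) key
  rw [Polynomial.eval_pow, eval_sk_trunc_zero, Polynomial.eval_mul, Polynomial.eval_C,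
    Polynomial.eval_prod] at h
  rw [h, hcong, mul_comm]
  congr 1
  rw [← sum_content_eq_kappa]
  simp only [Polynomial.eval_neg, Polynomial.eval_pow, Polynomial.eval_sub, Polynomial.eval_mul,
    Polynomial.eval_X, Polynomial.eval_C, zero_mul, sub_zero]
  rw [Finset.prod_neg, Finset.prod_pow, mul_comm 2, zpow_mul]
  congr 2
  have hz : ∀ s : Finset (ℕ × ℕ), ∏ c ∈ s, u ^ content c = u ^ ∑ c ∈ s, content c := by
    intro s
    induction s using Finset.induction_on with
    | empty => simp
    | insert a s ha ih => rw [Finset.prod_insert ha, Finset.sum_insert ha, zpow_add₀ hu.1, ih]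
  exact hz _

end PrincipalSpecialization

/-! ### Cauchy products of two specializations relative to the empty partitions. -/

section PowerSumProducts

variable {u : ℂ}

/-- A cell of content c changes the power sum by q^{n(c+1/2)} - q^{n(c-1/2)} = [n] q^{nc}, and the
empty partition gives the geometric series 1/[n]. -/
theorem specPowerSum_eq (hu : NotRoot u) (nu : YoungDiagram) {n : ℕ} (hn : n ≠ 0) :
    specPowerSum u nu n
      = 1 / br u n + br u n * ∑ c ∈ nu.cells, u ^ (2 * (n : ℤ) * content c) := by
  have h1 := sum_bead (fun x : ℤ => u ^ ((2 * x - 1) * (n : ℤ))) nu le_rfl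
  rw [Finset.sum_sub_distrib, sub_eq_iff_eq_add] at h1
  have h2 : ∑ i ∈ Finset.range (len nu), specVar u nu i ^ n
      = ∑ i ∈ Finset.range (len nu), u ^ ((2 * bead nu i - 1) * (n : ℤ)) := by
    refine Finset.sum_congr rfl fun i _ => ?_
    rw [specVar, ← zpow_natCast, ← zpow_mul]
    congr 1
    simp only [bead]
    ring
  rw [specPowerSum, h2, h1, add_assoc, add_comm]
  congr 1
  · have h3 : ∀ i : ℕ, u ^ ((2 * -(i : ℤ) - 1) * (n : ℤ))
        = u ^ (-(n : ℤ)) * ((u ^ (-2 : ℤ)) ^ n) ^ i := by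
      intro i
      rw [← pow_mul, ← zpow_natCast (u ^ (-2 : ℤ)), ← zpow_mul, ← zpow_add₀ hu.1]
      congr 1
      push_cast
      ring
    have h4 : (u ^ (-(2 * (len nu : ℤ) + 1))) ^ n
        = u ^ (-(n : ℤ)) * ((u ^ (-2 : ℤ)) ^ n) ^ len nu := by
      rw [← pow_mul, ← zpow_natCast (u ^ (-2 : ℤ)), ← zpow_mul, ← zpow_natCast, ← zpow_mul,
        ← zpow_add₀ hu.1]
      congr 1
      push_cast
      ring
    have hne := hu.pow_ne_one hn
    simp only [h3]
    rw [← Finset.mul_sum, h4, geom_sum_eq hne]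
    have h5 : u ^ (-(n : ℤ)) * br u n = 1 - (u ^ (-2 : ℤ)) ^ n := by
      rw [br, mul_sub, ← zpow_add₀ hu.1, ← zpow_add₀ hu.1, ← zpow_natCast, ← zpow_mul,
        neg_add_cancel, zpow_zero]
      congr 2
      ring
    have h6 : (1 - (u ^ (-2 : ℤ)) ^ n) ≠ 0 := sub_ne_zero.2 (Ne.symm hne)
    have h8 := hu.2 n (by exact_mod_cast hn)
    have h9 : 1 / br u n = u ^ (-(n : ℤ)) / (1 - (u ^ (-2 : ℤ)) ^ n) := by
      rw [div_eq_div_iff h8 h6, h5, one_mul]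
    rw [h9, ← neg_sub 1 ((u ^ (-2 : ℤ)) ^ n), div_neg]
    ring
  · rw [Finset.mul_sum]
    refine Finset.sum_congr rfl fun c _ => ?_
    rw [br, sub_mul _ _ (u ^ _), ← zpow_add₀ hu.1, ← zpow_add₀ hu.1]
    congr 2 <;> ring

/-- In the product, [n]^2 = q^n - 2 + q^{-n} produces the second difference in `netSum` and the
mixed terms its single sums; the conjugate accounts for the sign of the contents of `be`. -/
theorem specPowerSum_mul (hu : NotRoot u) (al be : YoungDiagram) {n : ℕ} (hn : n ≠ 0) :
    specPowerSum u al n * specPowerSum u be n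
      = specPowerSum u ⊥ n * specPowerSum u ⊥ n
        - netSum al be.transpose fun k => u ^ (2 * (n : ℤ) * k) := by
  have h8 := hu.2 n (by exact_mod_cast hn)
  simp only [specPowerSum_eq hu _ hn, YoungDiagram.cells_bot, Finset.sum_empty, mul_zero, add_zero]
  rw [netSum, sum_cells_transpose be (fun k => u ^ (2 * (n : ℤ) * -k))]
  have h1 : ∀ c : ℕ × ℕ, ∑ c' ∈ be.transpose.cells, (u ^ (2 * (n : ℤ) * (content c - content c' + 1))
      - (2 : ℤ) • u ^ (2 * (n : ℤ) * (content c - content c'))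
      + u ^ (2 * (n : ℤ) * (content c - content c' - 1)))
      = ∑ c' ∈ be.cells, br u n ^ 2 * (u ^ (2 * (n : ℤ) * content c) * u ^ (2 * (n : ℤ) * content c')) := by
    intro c
    rw [sum_cells_transpose be (fun k => u ^ (2 * (n : ℤ) * (content c - k + 1))
      - (2 : ℤ) • u ^ (2 * (n : ℤ) * (content c - k)) + u ^ (2 * (n : ℤ) * (content c - k - 1)))]
    refine Finset.sum_congr rfl fun c' _ => ?_
    have e0 : u ^ (2 * (n : ℤ) * (content c - -content c'))
        = u ^ (2 * (n : ℤ) * content c) * u ^ (2 * (n : ℤ) * content c') := by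
      rw [← zpow_add₀ hu.1]
      congr 1
      ring
    have e1 : u ^ (2 * (n : ℤ) * (content c - -content c' + 1))
        = u ^ (2 * (n : ℤ) * content c) * u ^ (2 * (n : ℤ) * content c') * u ^ (n : ℤ) * u ^ (n : ℤ) := by
      rw [← zpow_add₀ hu.1, ← zpow_add₀ hu.1, ← zpow_add₀ hu.1]
      congr 1
      ring
    have e2 : u ^ (2 * (n : ℤ) * (content c - -content c' - 1))
        = u ^ (2 * (n : ℤ) * content c) * u ^ (2 * (n : ℤ) * content c') * u ^ (-(n : ℤ))
          * u ^ (-(n : ℤ)) := by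
      rw [← zpow_add₀ hu.1, ← zpow_add₀ hu.1, ← zpow_add₀ hu.1]
      congr 1
      ring
    have e3 : u ^ (n : ℤ) * u ^ (-(n : ℤ)) = 1 := by
      rw [← zpow_add₀ hu.1, add_neg_cancel, zpow_zero]
    rw [e0, e1, e2, br, zsmul_eq_mul]
    push_cast
    linear_combination (2 * (u ^ (2 * (n : ℤ) * content c) * u ^ (2 * (n : ℤ) * content c'))) * e3
  simp only [h1, ← Finset.mul_sum]
  rw [← Finset.sum_mul]
  simp only [neg_neg]
  field_simp
  ring

/-- The polynomial `∏_k (1 - q^k X)^{-netMult μ ν k}`. -/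
def crossPoly (u : ℂ) (mu nu : YoungDiagram) : Polynomial ℂ :=
  (netFinsupp mu nu).prod fun k n => (1 - Polynomial.C (u ^ (2 * k)) * Polynomial.X) ^ (-n).toNat

theorem netFinsupp_nonpos (mu nu : YoungDiagram) (k : ℤ) : netFinsupp mu nu k ≤ 0 := by
  rw [netFinsupp_apply]
  exact netMult_nonpos mu nu k

theorem newton_neg_nsmul {R : Type*} [CommRing R] [Algebra ℚ R] (w : R) (m : ℕ) :
    newton (fun n => -(m : R) * w ^ n) = (1 - PowerSeries.C w * PowerSeries.X) ^ m := by
  induction m with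
  | zero =>
    rw [pow_zero, ← newton_zero]
    congr 1
    ext n
    simp
  | succ m ih =>
    have : (fun n : ℕ => -((m + 1 : ℕ) : R) * w ^ n)
        = (fun n => -(m : R) * w ^ n) + fun n => -w ^ n := by
      ext n
      simp only [Pi.add_apply]
      push_cast
      ring
    rw [this, newton_add, ih, newton_neg_pow, pow_succ, map_neg]
    ring

theorem newton_finsetSum {R ι : Type*} [CommRing R] [Algebra ℚ R] (s : Finset ι) (p : ι → ℕ → R) :
    newton (∑ i ∈ s, p i) = ∏ i ∈ s, newton (p i) := by
  classical
  induction s using Finset.induction_on with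
  | empty => simp
  | insert a s ha ih => rw [Finset.sum_insert ha, Finset.prod_insert ha, newton_add, ih]

/-- A power sum q^{nk} with multiplicity m contributes (1 - q^k X)^{-m}, and m ≤ 0 makes the
exponent natural. -/
theorem crossPoly_eq_newton (u : ℂ) (mu nu : YoungDiagram) :
    (crossPoly u mu nu : PowerSeries ℂ)
      = newton fun n => netSum mu nu fun k => u ^ (2 * (n : ℤ) * k) := by
  have h1 : (fun n : ℕ => netSum mu nu fun k => u ^ (2 * (n : ℤ) * k))
      = ∑ k ∈ (netFinsupp mu nu).support,
        fun n : ℕ => -(((-netFinsupp mu nu k).toNat : ℕ) : ℂ) * (u ^ (2 * k)) ^ n := by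
    ext n
    rw [← sum_netMult_smul, Finsupp.sum, Finset.sum_apply]
    refine Finset.sum_congr rfl fun k _ => ?_
    have h2 := netFinsupp_nonpos mu nu k
    have h3 : (((-netFinsupp mu nu k).toNat : ℕ) : ℂ) = ((-netFinsupp mu nu k : ℤ) : ℂ) := by
      rw [← Int.cast_natCast, Int.toNat_of_nonneg (by omega)]
    rw [h3, zsmul_eq_mul, ← zpow_natCast, ← zpow_mul]
    push_cast
    rw [neg_neg]
    congr 2
    ring
  rw [h1, newton_finsetSum, crossPoly, Finsupp.prod, ← Polynomial.coeToPowerSeries.ringHom_apply,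
    map_prod]
  refine Finset.prod_congr rfl fun k _ => ?_
  rw [newton_neg_nsmul]
  simp

/-- The Cauchy product over two specializations, relative to the empty partitions. -/
theorem newton_specPowerSum_mul (hu : NotRoot u) (al be : YoungDiagram) :
    newton (specPowerSum u al * specPowerSum u be) * (crossPoly u al be.transpose : PowerSeries ℂ)
      = newton (specPowerSum u ⊥ * specPowerSum u ⊥) := by
  rw [crossPoly_eq_newton, ← newton_add]
  ext n
  refine coeff_newton_congr fun k h1 _ => ?_
  simp only [Pi.add_apply, Pi.mul_apply]
  rw [specPowerSum_mul hu al be (by omega)]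
  ring

theorem newton_neg_specPowerSum_mul (hu : NotRoot u) (al be : YoungDiagram) :
    newton (-(specPowerSum u al * specPowerSum u be))
      = newton (-(specPowerSum u ⊥ * specPowerSum u ⊥))
        * (crossPoly u al be.transpose : PowerSeries ℂ) := by
  rw [crossPoly_eq_newton, ← newton_add]
  ext n
  refine coeff_newton_congr fun k h1 _ => ?_
  simp only [Pi.add_apply, Pi.mul_apply, Pi.neg_apply]
  rw [specPowerSum_mul hu al be (by omega)]
  ring

end PowerSumProducts

/-! ### The weight of one square, summed over its vertical edges. -/

section Square

theorem sk_rescale {R : Type*} [CommRing R] [IsDomain R] {c : R} (hc : c ≠ 0) {H : PowerSeries R}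
    (hH : PowerSeries.constantCoeff H = 1) (lam : YoungDiagram) :
    sk (PowerSeries.rescale c H) lam ⊥ = c ^ lam.card * sk H lam ⊥ := by
  have hH' : PowerSeries.constantCoeff (PowerSeries.rescale c H) = 1 := by
    rw [← PowerSeries.coeff_zero_eq_constantCoeff_apply, PowerSeries.coeff_rescale]
    simpa using hH
  set N := len lam with hN
  rw [← jt_eq_sk _ hH' hN.ge (by simp : len ⊥ ≤ N), ← jt_eq_sk _ hH hN.ge (by simp : len ⊥ ≤ N)]
  have h1 : (∏ i : Fin N, c ^ (i : ℕ)) ≠ 0 := Finset.prod_ne_zero_iff.2 fun i _ => pow_ne_zero _ hc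
  refine mul_left_cancel₀ h1 ?_
  have h2 : (∏ i : Fin N, c ^ (i : ℕ)) * (c ^ lam.card * jt H N (bead lam) (bead ⊥))
      = (∏ i : Fin N, c ^ lam.rowLen i) * ((∏ j : Fin N, c ^ (j : ℕ))
        * jt H N (bead lam) (bead ⊥)) := by
    rw [card_eq_sum lam hN.ge, Finset.sum_range, Finset.prod_pow_eq_pow_sum (f := fun i : Fin N =>
      lam.rowLen i)]
    ring
  rw [h2, jt, jt, ← Matrix.det_mul_column, ← Matrix.det_mul_row, ← Matrix.det_mul_column]
  congr 1
  ext i j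
  simp only [Matrix.of_apply, hz]
  split_ifs with h0
  · rw [PowerSeries.coeff_rescale, ← mul_assoc, ← mul_assoc, ← pow_add, ← pow_add]
    congr 2
    simp only [bead, rowLen_bot] at h0 ⊢
    omega
  · simp

variable {u : ℂ}

/-- The weight of one square of the toric graph: `al`, `be` sit on the two horizontal edges, `ga`
and `de` on the vertical ones and `nu` on the edge leaving the square. -/
def squareWeight (u : ℂ) (al be ga de nu : YoungDiagram) : ℂ :=
  vertex u ⊥ de.transpose al * vertex u ⊥ be.transpose de * vertex u ⊥ ga.transpose be
    * vertex u nu al.transpose ga * u ^ (-kappa al - kappa be - kappa ga - kappa de)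

theorem subPartitions_bot : subPartitions ⊥ = {⊥} := by
  ext mu
  simp [mem_subPartitions]

theorem skewSchur_bot (u : ℂ) (nu : YoungDiagram) : skewSchur u ⊥ ⊥ nu = 1 := by
  rw [skewSchur_eq, sk_bot_bot _ (by simp)]

theorem vertex_bot (u : ℂ) (l2 l3 : YoungDiagram) :
    vertex u ⊥ l2 l3 = u ^ kappa l3 * skewSchur u l2 ⊥ ⊥ * skewSchur u l3.transpose ⊥ l2 := by
  rw [vertex, subPartitions_bot, Finset.sum_singleton, skewSchur_bot, one_mul]

/-- The framing -1 on each edge cancels the power of q of one vertex. Two of the vertices have a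
horizontal partition as index and a vertical one in the specialization; `skewSchur_symm` exchanges
the roles there. -/
theorem squareWeight_eq (hu : NotRoot u) (al be ga de nu : YoungDiagram) :
    squareWeight u al be ga de nu
      = skewSchur u al.transpose ⊥ ⊥ ^ 2 * skewSchur u be.transpose ⊥ ⊥ ^ 2
        * (skewSchur u de.transpose ⊥ al.transpose * skewSchur u de.transpose ⊥ be.transpose)
        * ∑ mu ∈ subPartitions nu, skewSchur u nu mu al
          * (skewSchur u ga.transpose mu al.transpose * skewSchur u ga.transpose ⊥ be.transpose) := by
  have h1 := skewSchur_symm hu al.transpose de.transpose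
  have h2 := skewSchur_symm hu be.transpose ga.transpose
  have hk : u ^ kappa al * u ^ kappa be * u ^ kappa ga * u ^ kappa de
      * u ^ (-kappa al - kappa be - kappa ga - kappa de) = 1 := by
    simp only [← zpow_add₀ hu.1]
    rw [← zpow_zero u]
    congr 1
    ring
  simp only [← mul_assoc]
  rw [← Finset.sum_mul, squareWeight, vertex_bot, vertex_bot, vertex_bot, vertex,
    YoungDiagram.transpose_transpose]
  set X := ∑ mu ∈ subPartitions nu, skewSchur u nu mu al * skewSchur u ga.transpose mu al.transpose
  linear_combination
    (skewSchur u al.transpose ⊥ de.transpose * skewSchur u de.transpose ⊥ ⊥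
      * skewSchur u be.transpose ⊥ ga.transpose * skewSchur u ga.transpose ⊥ ⊥
      * skewSchur u be.transpose ⊥ ⊥ * skewSchur u de.transpose ⊥ be.transpose
      * skewSchur u al.transpose ⊥ ⊥ * X) * hk
    + (skewSchur u be.transpose ⊥ ga.transpose * skewSchur u ga.transpose ⊥ ⊥
      * skewSchur u be.transpose ⊥ ⊥ * skewSchur u de.transpose ⊥ be.transpose
      * skewSchur u al.transpose ⊥ ⊥ * X) * h1
    + (skewSchur u de.transpose ⊥ al.transpose * skewSchur u al.transpose ⊥ ⊥
      * skewSchur u be.transpose ⊥ ⊥ * skewSchur u de.transpose ⊥ be.transpose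
      * skewSchur u al.transpose ⊥ ⊥ * X) * h2

theorem sum_partitionsOf_transpose {M : Type*} [AddCommMonoid M] (n : ℕ) (f : YoungDiagram → M) :
    ∑ lam ∈ partitionsOf n, f lam.transpose = ∑ lam ∈ partitionsOf n, f lam := by
  refine Finset.sum_bij' (fun lam _ => lam.transpose) (fun lam _ => lam.transpose) ?_ ?_ ?_ ?_ ?_
  all_goals simp [mem_partitionsOf, card_transpose]

/-- The power sums of the union of two sets of variables, the second one multiplied by `X`. -/
def mixPow (p p' : ℕ → ℂ) (n : ℕ) : PowerSeries ℂ :=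
  PowerSeries.C (p n) + PowerSeries.X ^ n * PowerSeries.C (p' n)

/-- The coproduct formula splits the two alphabets, and homogeneity turns the scaling of the second
into X^{|μ|}. It is applied over ℂ⟦X⟧, which is why `sk_add` was needed over domains. -/
theorem sk_mixPow (p p' : ℕ → ℂ) (nu : YoungDiagram) :
    sk (newton (mixPow p p')) nu ⊥ = ∑ mu ∈ subPartitions nu,
      PowerSeries.C (sk (newton p) nu mu * sk (newton p') mu ⊥) * PowerSeries.X ^ mu.card := by
  have h : mixPow p p' = (fun n => PowerSeries.C (p n))
      + fun n => PowerSeries.X ^ n * PowerSeries.C (p' n) := rfl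
  rw [h, sk_add_of_isDomain]
  refine Finset.sum_congr rfl fun mu _ => ?_
  rw [newton_rescale, sk_rescale PowerSeries.X_ne_zero (by simp), ← newton_map, ← newton_map, sk_map,
    sk_map, map_mul]
  ring

/-- The generating function of the weights of a square, summed over the vertical edges. -/
def squareSeries (u : ℂ) (al be nu : YoungDiagram) : PowerSeries ℂ :=
  PowerSeries.C (skewSchur u al.transpose ⊥ ⊥ ^ 2 * skewSchur u be.transpose ⊥ ⊥ ^ 2)
    * newton (specPowerSum u al.transpose * specPowerSum u be.transpose) ^ 2
    * sk (newton (mixPow (specPowerSum u al) (specPowerSum u be.transpose))) nu ⊥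

/-- The sum over `de` is a plain Cauchy sum. The sum over `ga` is a skew one, which yields the same
series times X^{|μ|} and a Schur function indexed by μ; the remaining sum over μ ⊆ ν is `sk_mixPow`.
-/
theorem coeff_squareSeries (hu : NotRoot u) (al be nu : YoungDiagram) (n : ℕ) :
    PowerSeries.coeff n (squareSeries u al be nu)
      = ∑ p ∈ Finset.HasAntidiagonal.antidiagonal n, ∑ ga ∈ partitionsOf p.1, ∑ de ∈ partitionsOf p.2,
        squareWeight u al be ga de nu := by
  set F := newton (specPowerSum u al.transpose * specPowerSum u be.transpose) with hF
  have hde : ∀ j, ∑ de ∈ partitionsOf j, skewSchur u de.transpose ⊥ al.transpose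
      * skewSchur u de.transpose ⊥ be.transpose = PowerSeries.coeff j F := by
    intro j
    rw [sum_partitionsOf_transpose j (fun de => skewSchur u de ⊥ al.transpose
      * skewSchur u de ⊥ be.transpose)]
    simp only [skewSchur_eq]
    rw [cauchy, sk_bot_bot _ (by simp), card_bot, if_pos (Nat.zero_le _), mul_one, Nat.sub_zero]
  have hga : ∀ i, ∑ ga ∈ partitionsOf i, ∑ mu ∈ subPartitions nu, skewSchur u nu mu al
      * (skewSchur u ga.transpose mu al.transpose * skewSchur u ga.transpose ⊥ be.transpose)
      = PowerSeries.coeff i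
        (F * sk (newton (mixPow (specPowerSum u al) (specPowerSum u be.transpose))) nu ⊥) := by
    intro i
    rw [Finset.sum_comm, sk_mixPow, Finset.mul_sum, map_sum]
    refine Finset.sum_congr rfl fun mu _ => ?_
    rw [← Finset.mul_sum, sum_partitionsOf_transpose i (fun ga => skewSchur u ga mu al.transpose
      * skewSchur u ga ⊥ be.transpose)]
    simp only [skewSchur_eq]
    rw [cauchy, mul_left_comm F, PowerSeries.coeff_C_mul, PowerSeries.coeff_mul_X_pow', ← hF]
    split_ifs <;> ring
  rw [squareSeries, ← hF, mul_assoc, PowerSeries.coeff_C_mul, sq F, mul_assoc F, mul_comm F (F * _),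
    PowerSeries.coeff_mul, Finset.mul_sum]
  refine Finset.sum_congr rfl fun p _ => ?_
  rw [← hga, ← hde, Finset.sum_mul_sum, Finset.mul_sum]
  refine Finset.sum_congr rfl fun ga _ => ?_
  rw [Finset.mul_sum]
  refine Finset.sum_congr rfl fun de _ => ?_
  rw [squareWeight_eq hu]
  ring

end Square

/-! ### The sum over the edges of X, grouped by variables. -/

section Pairs

/-- The pairs of partitions with `n` cells in total. -/
def pairsOf (n : ℕ) : Finset (YoungDiagram × YoungDiagram) :=
  open Classical in
  (Finset.HasAntidiagonal.antidiagonal n).biUnion fun p => partitionsOf p.1 ×ˢ partitionsOf p.2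

theorem mem_pairsOf {n : ℕ} {x : YoungDiagram × YoungDiagram} :
    x ∈ pairsOf n ↔ x.1.card + x.2.card = n := by
  simp [pairsOf, mem_partitionsOf]

theorem sum_pairsOf {M : Type*} [AddCommMonoid M] (n : ℕ) (f : YoungDiagram → YoungDiagram → M) :
    ∑ x ∈ pairsOf n, f x.1 x.2 = ∑ p ∈ Finset.HasAntidiagonal.antidiagonal n,
      ∑ ga ∈ partitionsOf p.1, ∑ de ∈ partitionsOf p.2, f ga de := by
  classical
  rw [pairsOf, Finset.sum_biUnion]
  · exact Finset.sum_congr rfl fun p _ => Finset.sum_product _ _ _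
  · intro p _ q _ hpq
    refine Finset.disjoint_left.2 fun x h1 h2 => hpq ?_
    simp only [Finset.mem_product, mem_partitionsOf] at h1 h2
    exact Prod.ext (h1.1.symm.trans h2.1) (h1.2.symm.trans h2.2)

end Pairs

section Weights

variable (u : ℂ)

/-- The weight of a configuration of partitions on the edges of the toric graph of `X`. -/
def edgeWeight (lam : Fin 9 → YoungDiagram) : ℂ :=
  (∏ e, (-1 : ℂ) ^ (((lam e).card : ℤ) * (graphX.framing e + 1)) *
      u ^ (kappa (lam e) * graphX.framing e)) *
    ∏ v, vertex u (graphX.label lam v 0) (graphX.label lam v 1) (graphX.label lam v 2)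

/-- The second square is the first one turned by a half turn, so bottom and top, and left and right,
change places. The joining edge arrives there, hence the conjugate; its framing 0 leaves only a
sign. -/
theorem edgeWeight_eq {u : ℂ} (hu : u ≠ 0) (lam : Fin 9 → YoungDiagram) :
    edgeWeight u lam = (-1) ^ (lam 4).card * squareWeight u (lam 0) (lam 2) (lam 1) (lam 3) (lam 4)
      * squareWeight u (lam 7) (lam 5) (lam 8) (lam 6) (lam 4).transpose := by
  have hE : (∏ e, (-1 : ℂ) ^ (((lam e).card : ℤ) * (graphX.framing e + 1)) *
      u ^ (kappa (lam e) * graphX.framing e))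
      = (-1) ^ (lam 4).card * (u ^ (-kappa (lam 0) - kappa (lam 2) - kappa (lam 1) - kappa (lam 3))
        * u ^ (-kappa (lam 7) - kappa (lam 5) - kappa (lam 8) - kappa (lam 6))) := by
    simp only [Fin.prod_univ_succ, Finset.univ_eq_empty, Finset.prod_empty, graphX, Fin.isValue,
      Matrix.cons_val_zero, Matrix.cons_val_succ, Fin.succ_zero_eq_one, mul_one, neg_add_cancel,
      mul_zero, zpow_zero, one_mul, zero_add, zpow_natCast, mul_neg]
    simp only [sub_eq_add_neg, zpow_add₀ hu]
    change u ^ (-kappa (lam 0)) * (u ^ (-kappa (lam 1)) * (u ^ (-kappa (lam 2)) *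
      (u ^ (-kappa (lam 3)) * ((-1) ^ (lam 4).card * (u ^ (-kappa (lam 5)) * (u ^ (-kappa (lam 6)) *
        (u ^ (-kappa (lam 7)) * u ^ (-kappa (lam 8))))))))) = _
    ring
  have hV : ∏ v, vertex u (graphX.label lam v 0) (graphX.label lam v 1) (graphX.label lam v 2)
      = (vertex u ⊥ (lam 3).transpose (lam 0) * vertex u ⊥ (lam 2).transpose (lam 3)
        * vertex u ⊥ (lam 1).transpose (lam 2) * vertex u (lam 4) (lam 0).transpose (lam 1))
        * (vertex u ⊥ (lam 6).transpose (lam 7) * vertex u ⊥ (lam 5).transpose (lam 6)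
        * vertex u ⊥ (lam 8).transpose (lam 5)
        * vertex u (lam 4).transpose (lam 7).transpose (lam 8)) := by
    simp only [Fin.prod_univ_succ, Finset.univ_eq_empty, Finset.prod_empty]
    change vertex u ⊥ (lam 3).transpose (lam 0) * (vertex u ⊥ (lam 2).transpose (lam 3)
        * (vertex u ⊥ (lam 1).transpose (lam 2) * (vertex u (lam 4) (lam 0).transpose (lam 1)
        * (vertex u (lam 4).transpose (lam 7).transpose (lam 8)
        * (vertex u ⊥ (lam 8).transpose (lam 5) * (vertex u ⊥ (lam 5).transpose (lam 6)
        * (vertex u ⊥ (lam 6).transpose (lam 7) * 1))))))) = _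
    ring
  rw [edgeWeight, hE, hV, squareWeight, squareWeight]
  ring

theorem mapDomain_edgeVarX (y : Fin 9 →₀ ℕ) (d : Fin 2 →₀ ℕ) (e : FVar →₀ ℕ) :
    Finsupp.mapDomain edgeVarX y = Finsupp.sumElim d e ↔
      y 0 + y 2 = d 0 ∧ y 5 + y 7 = d 1 ∧ y 1 + y 3 = e (.F 0) ∧ y 8 + y 6 = e (.F 1)
        ∧ y 4 = e .Q0 := by
  have h : ∀ v : XVar, Finsupp.mapDomain edgeVarX y v
      = ∑ i : Fin 9, if edgeVarX i = v then y i else 0 := by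
    intro v
    rw [Finsupp.mapDomain, Finsupp.sum_fintype _ _ (by simp), Finsupp.finsetSum_apply]
    exact Finset.sum_congr rfl fun i _ => Finsupp.single_apply
  have h0 : Finsupp.mapDomain edgeVarX y (.inl 0) = y 0 + y 2 := by
    rw [h]
    simp [Fin.sum_univ_succ, edgeVarX]
  have h1 : Finsupp.mapDomain edgeVarX y (.inl 1) = y 5 + y 7 := by
    rw [h]
    simp [Fin.sum_univ_succ, edgeVarX]
  have h2 : Finsupp.mapDomain edgeVarX y (.inr (.F 0)) = y 1 + y 3 := by
    rw [h]
    simp [Fin.sum_univ_succ, edgeVarX]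
  have h3 : Finsupp.mapDomain edgeVarX y (.inr (.F 1)) = y 6 + y 8 := by
    rw [h]
    simp [Fin.sum_univ_succ, edgeVarX]
  have h4 : Finsupp.mapDomain edgeVarX y (.inr .Q0) = y 4 := by
    rw [h]
    simp [Fin.sum_univ_succ, edgeVarX]
  rw [add_comm (y 8), ← h0, ← h1, ← h2, ← h3, ← h4]
  constructor
  · intro heq
    rw [heq]
    simp
  · rintro ⟨e0, e1, e2, e3, e4⟩
    ext v
    rcases v with k | (k | _)
    · fin_cases k
      · simpa using e0
      · simpa using e1
    · fin_cases k
      · simpa using e2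
      · simpa using e3
    · simpa using e4

/-- Two edges with a common variable form a pair of prescribed total size. The pair `h` lists the
edges 8 and 6 in the order in which the turned square uses them. -/
theorem coeff_ZX (d : Fin 2 →₀ ℕ) (e : FVar →₀ ℕ) :
    MvPowerSeries.coeff (Finsupp.sumElim d e) (ZX u)
      = ∑ x ∈ pairsOf (d 0), ∑ y ∈ pairsOf (d 1), ∑ nu ∈ partitionsOf (e .Q0),
        ∑ g ∈ pairsOf (e (.F 0)), ∑ h ∈ pairsOf (e (.F 1)),
          edgeWeight u ![x.1, g.1, x.2, g.2, nu, y.1, h.2, y.2, h.1] := by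
  rw [ZX, MvPowerSeries.coeff_rename]
  have h1 : ∀ y : Fin 9 →₀ ℕ, MvPowerSeries.coeff y (graphX.partitionFunction u)
      = ∑ lam ∈ Fintype.piFinset fun e => partitionsOf (y e), edgeWeight u lam := fun y => rfl
  simp only [h1, ← Finset.sum_product']
  rw [Finset.sum_sigma']
  refine Finset.sum_bij'
    (i := fun p _ => (((p.2 0, p.2 2), (p.2 5, p.2 7), p.2 4, (p.2 1, p.2 3), (p.2 8, p.2 6)) :
        (YoungDiagram × YoungDiagram) × (YoungDiagram × YoungDiagram) × YoungDiagram
        × (YoungDiagram × YoungDiagram) × (YoungDiagram × YoungDiagram)))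
    (j := fun t _ => ⟨Finsupp.equivFunOnFinite.symm fun i => (![t.1.1, t.2.2.2.1.1, t.1.2,
      t.2.2.2.1.2, t.2.2.1, t.2.1.1, t.2.2.2.2.2, t.2.1.2, t.2.2.2.2.1] i : YoungDiagram).card,
      ![t.1.1, t.2.2.2.1.1, t.1.2, t.2.2.2.1.2, t.2.2.1, t.2.1.1, t.2.2.2.2.2, t.2.1.2,
        t.2.2.2.2.1]⟩) ?_ ?_ ?_ ?_ ?_
  · rintro ⟨y, lam⟩ hp
    simp only [Finset.mem_sigma, Set.Finite.mem_toFinset, Set.mem_preimage, Set.mem_singleton_iff,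
      Fintype.mem_piFinset, mem_partitionsOf, mapDomain_edgeVarX] at hp
    obtain ⟨hp, hl⟩ := hp
    simp only [Finset.mem_product, mem_pairsOf, mem_partitionsOf, hl]
    exact ⟨hp.1, hp.2.1, hp.2.2.2.2, hp.2.2.1, hp.2.2.2.1⟩
  · rintro t ht
    simp only [Finset.mem_product, mem_pairsOf, mem_partitionsOf] at ht
    obtain ⟨ha, hb, hc, hd, he⟩ := ht
    simp only [Finset.mem_sigma, Set.Finite.mem_toFinset, Set.mem_preimage, Set.mem_singleton_iff,
      Fintype.mem_piFinset, mem_partitionsOf, mapDomain_edgeVarX]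
    exact ⟨⟨ha, hb, hd, he, hc⟩, fun _ => rfl⟩
  · rintro ⟨y, lam⟩ hp
    simp only [Finset.mem_sigma, Fintype.mem_piFinset, mem_partitionsOf] at hp
    obtain ⟨-, hl⟩ := hp
    have hlam : ![lam 0, lam 1, lam 2, lam 3, lam 4, lam 5, lam 6, lam 7, lam 8] = lam := by
      ext1 i
      fin_cases i <;> rfl
    simp only [hlam, Sigma.mk.injEq, heq_eq_eq, and_true]
    ext i
    simp [hl]
  · intro t _
    rfl
  · rintro ⟨y, lam⟩ _
    have hlam : ![lam 0, lam 1, lam 2, lam 3, lam 4, lam 5, lam 6, lam 7, lam 8] = lam := by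
      ext1 i
      fin_cases i <;> rfl
    simp only [hlam]

end Weights

/-! ### Iterated power series in Q_{F_1}, Q_{F_2}, Q_0. -/

section NestedSeries

/-- Power series in `Q_{F_1}`, then in `Q_{F_2}`, then in `Q_0`. -/
abbrev Nested : Type := PowerSeries (PowerSeries (PowerSeries ℂ))

/-- The exponent of `Q_{F_1}^a Q_{F_2}^b Q_0^c`. -/
def expo (a b c : ℕ) : FVar →₀ ℕ := Finsupp.equivFunOnFinite.symm fun
  | .F k => if k = 0 then a else b
  | .Q0 => c

@[simp] theorem expo_F0 (a b c : ℕ) : expo a b c (.F 0) = a := rfl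

@[simp] theorem expo_F1 (a b c : ℕ) : expo a b c (.F 1) = b := rfl

@[simp] theorem expo_Q0 (a b c : ℕ) : expo a b c .Q0 = c := rfl

theorem expo_ext {e e' : FVar →₀ ℕ} (h0 : e (.F 0) = e' (.F 0)) (h1 : e (.F 1) = e' (.F 1))
    (h2 : e .Q0 = e' .Q0) : e = e' := by
  ext v
  rcases v with k | _
  · fin_cases k
    · exact h0
    · exact h1
  · exact h2

theorem expo_eq (e : FVar →₀ ℕ) : expo (e (.F 0)) (e (.F 1)) (e .Q0) = e :=
  expo_ext (by simp) (by simp) (by simp)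

/-- The iterated power series of a power series in `Q_{F_1}, Q_{F_2}, Q_0`. -/
def toNested (f : MvPowerSeries FVar ℂ) : Nested :=
  PowerSeries.mk fun c => PowerSeries.mk fun b => PowerSeries.mk fun a =>
    MvPowerSeries.coeff (expo a b c) f

/-- The power series in `Q_{F_1}, Q_{F_2}, Q_0` of an iterated power series. -/
def ofNested (t : Nested) : MvPowerSeries FVar ℂ := fun e =>
  PowerSeries.coeff (e (.F 0)) (PowerSeries.coeff (e (.F 1)) (PowerSeries.coeff (e .Q0) t))

theorem coeff_ofNested (t : Nested) (e : FVar →₀ ℕ) :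
    MvPowerSeries.coeff e (ofNested t)
      = PowerSeries.coeff (e (.F 0)) (PowerSeries.coeff (e (.F 1)) (PowerSeries.coeff (e .Q0) t)) :=
  rfl

theorem coeff_toNested (f : MvPowerSeries FVar ℂ) (a b c : ℕ) :
    PowerSeries.coeff a (PowerSeries.coeff b (PowerSeries.coeff c (toNested f)))
      = MvPowerSeries.coeff (expo a b c) f := by
  simp only [toNested, PowerSeries.coeff_mk]

/-- Power series in the variables `Q_{F_1}, Q_{F_2}, Q_0` as iterated power series. -/
def nestedEquiv : MvPowerSeries FVar ℂ ≃+* Nested where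
  toFun := toNested
  invFun := ofNested
  left_inv f := by
    ext e
    rw [coeff_ofNested, coeff_toNested, expo_eq]
  right_inv t := by
    ext c b a
    rw [coeff_toNested, coeff_ofNested]
    simp
  map_add' f g := by
    ext c b a
    simp only [map_add, coeff_toNested]
  map_mul' f g := by
    classical
    ext c b a
    simp only [PowerSeries.coeff_mul, MvPowerSeries.coeff_mul, map_sum, coeff_toNested]
    simp only [← Finset.sum_product']
    refine Finset.sum_bij'
      (i := fun x _ => (((x.1 .Q0, x.2 .Q0), (x.1 (.F 1), x.2 (.F 1)), (x.1 (.F 0), x.2 (.F 0))) :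
        (ℕ × ℕ) × (ℕ × ℕ) × (ℕ × ℕ)))
      (j := fun t _ => (expo t.2.2.1 t.2.1.1 t.1.1, expo t.2.2.2 t.2.1.2 t.1.2)) ?_ ?_ ?_ ?_ ?_
    · intro x hx
      rw [Finset.HasAntidiagonal.mem_antidiagonal] at hx
      simp only [Finset.mem_product, Finset.HasAntidiagonal.mem_antidiagonal, ← Finsupp.add_apply, hx,
        expo_F0, expo_F1, expo_Q0, and_self]
    · intro t ht
      simp only [Finset.mem_product, Finset.HasAntidiagonal.mem_antidiagonal] at ht
      rw [Finset.HasAntidiagonal.mem_antidiagonal]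
      exact expo_ext (by simpa using ht.2.2) (by simpa using ht.2.1) (by simpa using ht.1)
    · intro x _
      simp only [expo_eq]
    · intro t _
      simp
    · intro x _
      simp only [expo_eq]

theorem coeff_nestedEquiv (f : MvPowerSeries FVar ℂ) (a b c : ℕ) :
    PowerSeries.coeff a (PowerSeries.coeff b (PowerSeries.coeff c (nestedEquiv f)))
      = MvPowerSeries.coeff (expo a b c) f := by
  exact coeff_toNested f a b c

theorem coeff_nestedEquiv_symm (t : Nested) (e : FVar →₀ ℕ) :
    MvPowerSeries.coeff e (nestedEquiv.symm t)
      = PowerSeries.coeff (e (.F 0)) (PowerSeries.coeff (e (.F 1)) (PowerSeries.coeff (e .Q0) t)) :=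
  rfl

theorem expo_eq_iff (a b c : ℕ) (e : FVar →₀ ℕ) :
    expo a b c = e ↔ a = e (.F 0) ∧ b = e (.F 1) ∧ c = e .Q0 := by
  constructor
  · rintro rfl
    simp
  · rintro ⟨rfl, rfl, rfl⟩
    exact expo_eq e

/-- The constants among the iterated power series in two variables. -/
def const₂ : ℂ →+* PowerSeries (PowerSeries ℂ) := PowerSeries.C.comp PowerSeries.C

theorem nestedEquiv_C (z : ℂ) :
    nestedEquiv (MvPowerSeries.C z) = PowerSeries.C (const₂ z) := by
  classical
  ext c b a
  rw [coeff_nestedEquiv, MvPowerSeries.coeff_C, const₂]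
  simp only [expo_eq_iff, PowerSeries.coeff_C, RingHom.comp_apply, Finsupp.coe_zero, Pi.zero_apply]
  split_ifs <;> simp_all [PowerSeries.coeff_C]
  split_ifs <;> simp_all [PowerSeries.coeff_C]

theorem nestedEquiv_F0 :
    nestedEquiv (MvPowerSeries.X (.F 0)) = PowerSeries.C (PowerSeries.C PowerSeries.X) := by
  classical
  ext c b a
  rw [coeff_nestedEquiv, MvPowerSeries.coeff_X]
  simp only [expo_eq_iff, PowerSeries.coeff_C, Finsupp.single_apply]
  split_ifs <;> simp_all [PowerSeries.coeff_C, PowerSeries.coeff_X]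
  split_ifs <;> simp_all [PowerSeries.coeff_X]

theorem nestedEquiv_F1 :
    nestedEquiv (MvPowerSeries.X (.F 1)) = PowerSeries.C PowerSeries.X := by
  classical
  ext c b a
  rw [coeff_nestedEquiv, MvPowerSeries.coeff_X]
  simp only [expo_eq_iff, PowerSeries.coeff_C, Finsupp.single_apply]
  split_ifs <;> simp_all [PowerSeries.coeff_X, PowerSeries.coeff_one]
  split_ifs <;> simp_all [PowerSeries.coeff_one]

theorem nestedEquiv_Q0 : nestedEquiv (MvPowerSeries.X .Q0) = PowerSeries.X := by
  classical
  ext c b a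
  rw [coeff_nestedEquiv, MvPowerSeries.coeff_X]
  simp only [expo_eq_iff, PowerSeries.coeff_X, Finsupp.single_apply]
  split_ifs <;> simp_all [PowerSeries.coeff_one]
  split_ifs <;> simp_all [PowerSeries.coeff_one]

/-- The value of a polynomial in one variable at a polynomial in `Q_{F_1}, Q_{F_2}, Q_0`. -/
def polyAt (f : Polynomial ℂ) (m : MvPolynomial FVar ℂ) : MvPolynomial FVar ℂ :=
  f.eval₂ MvPolynomial.C m

theorem eval_polyAt (f : Polynomial ℂ) (m : MvPolynomial FVar ℂ) (z : FVar → ℂ) :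
    MvPolynomial.eval z (polyAt f m) = f.eval (MvPolynomial.eval z m) := by
  rw [polyAt, Polynomial.hom_eval₂]
  congr 1
  ext1 w
  simp

theorem nestedEquiv_polyAt (f : Polynomial ℂ) (m : MvPolynomial FVar ℂ) :
    nestedEquiv (polyAt f m : MvPowerSeries FVar ℂ)
      = f.eval₂ (PowerSeries.C.comp const₂) (nestedEquiv (m : MvPowerSeries FVar ℂ)) := by
  have h := Polynomial.hom_eval₂ f MvPolynomial.C ((nestedEquiv : MvPowerSeries FVar ℂ →+* Nested).comp
    (MvPolynomial.coeToMvPowerSeries.ringHom)) m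
  refine h.trans ?_
  congr 1
  ext1 w
  simp only [RingHom.comp_apply, MvPolynomial.coeToMvPowerSeries.ringHom_apply,
    MvPolynomial.coe_C]
  exact nestedEquiv_C w

theorem coe_eq_eval₂ {R : Type*} [CommRing R] (f : Polynomial R) :
    (f : PowerSeries R) = f.eval₂ PowerSeries.C PowerSeries.X := by
  have h := Polynomial.hom_eval₂ f Polynomial.C (Polynomial.coeToPowerSeries.ringHom (R := R))
    Polynomial.X
  rw [Polynomial.eval₂_C_X] at h
  refine h.trans ?_
  rw [Polynomial.coeToPowerSeries.ringHom_apply, Polynomial.coe_X]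
  congr 1
  ext1 w
  simp

/-- The right side has the shape of `nestedEquiv_polyAt`, so factors in c Q_0 can be recognised as
polynomials; `C_C_coe` and `C_map_coe` serve the same purpose for Q_{F_1} and Q_{F_2}. -/
theorem rescale_map_coe (f : Polynomial ℂ) (c : PowerSeries (PowerSeries ℂ)) :
    PowerSeries.rescale c (PowerSeries.map const₂ (f : PowerSeries ℂ))
      = f.eval₂ (PowerSeries.C.comp const₂) (PowerSeries.C c * PowerSeries.X) := by
  rw [coe_eq_eval₂, Polynomial.hom_eval₂, Polynomial.hom_eval₂]
  simp only [PowerSeries.map_X, PowerSeries.rescale_X]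
  congr 1
  ext1 w
  simp only [RingHom.comp_apply, PowerSeries.map_C]
  ext n
  rw [PowerSeries.coeff_rescale, PowerSeries.coeff_C]
  split_ifs with h <;> simp [h]

theorem C_C_coe (f : Polynomial ℂ) :
    (PowerSeries.C (PowerSeries.C (f : PowerSeries ℂ)) : Nested)
      = f.eval₂ (PowerSeries.C.comp const₂) (PowerSeries.C (PowerSeries.C PowerSeries.X)) := by
  rw [coe_eq_eval₂, Polynomial.hom_eval₂, Polynomial.hom_eval₂]
  rfl

theorem C_map_coe (f : Polynomial ℂ) :
    (PowerSeries.C (PowerSeries.map PowerSeries.C (f : PowerSeries ℂ)) : Nested)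
      = f.eval₂ (PowerSeries.C.comp const₂) (PowerSeries.C PowerSeries.X) := by
  rw [coe_eq_eval₂, Polynomial.hom_eval₂, Polynomial.hom_eval₂, PowerSeries.map_X]
  congr 1
  ext1 w
  simp [const₂]

end NestedSeries

/-! ### Joining the two squares. -/

section Glueing

variable {u : ℂ}

/-- The generating function of the weights with fixed partitions on the horizontal edges, as an
iterated power series in the variables of the other edges. -/
def stripSeries (u : ℂ) (l0 l2 l5 l7 : YoungDiagram) : Nested :=
  PowerSeries.mk fun c => ∑ nu ∈ partitionsOf c, (-1) ^ c *
    (PowerSeries.C (squareSeries u l0 l2 nu)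
      * PowerSeries.map PowerSeries.C (squareSeries u l7 l5 nu.transpose))

theorem coeffB_ZX (hu : NotRoot u) (d : Fin 2 →₀ ℕ) :
    coeffB d (ZX u) = ∑ x ∈ pairsOf (d 0), ∑ y ∈ pairsOf (d 1),
      nestedEquiv.symm (stripSeries u x.1 x.2 y.1 y.2) := by
  ext e
  rw [map_sum]
  simp only [map_sum]
  change MvPowerSeries.coeff (Finsupp.sumElim d e) (ZX u) = _
  rw [coeff_ZX]
  refine Finset.sum_congr rfl fun x _ => Finset.sum_congr rfl fun y _ => ?_
  rw [coeff_nestedEquiv_symm, stripSeries, PowerSeries.coeff_mk, map_sum, map_sum]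
  refine Finset.sum_congr rfl fun nu hnu => ?_
  rw [mem_partitionsOf] at hnu
  have hs : ((-1) ^ (e .Q0) : PowerSeries (PowerSeries ℂ))
      = PowerSeries.C (PowerSeries.C ((-1) ^ (e .Q0))) := by simp
  rw [hs, ← mul_assoc, ← map_mul, PowerSeries.coeff_C_mul, PowerSeries.coeff_map, mul_assoc,
    PowerSeries.coeff_C_mul, PowerSeries.coeff_mul_C, coeff_squareSeries hu, coeff_squareSeries hu,
    ← sum_pairsOf, ← sum_pairsOf, Finset.sum_mul_sum, Finset.mul_sum]
  refine Finset.sum_congr rfl fun g _ => ?_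
  rw [Finset.mul_sum]
  refine Finset.sum_congr rfl fun h _ => ?_
  rw [edgeWeight_eq hu.1]
  simp only [Matrix.cons_val, hnu]
  ring

end Glueing

/-! ### The sum over the joining edge as a product. -/

section StripProduct

variable {u : ℂ}

/-- The series of the products `p_i p'_j`, with the variable multiplied by a constant. -/
def negCauchy (c : PowerSeries (PowerSeries ℂ)) (p p' : ℕ → ℂ) : Nested :=
  PowerSeries.rescale c (PowerSeries.map const₂ (newton (-(p * p'))))

theorem negCauchy_specPowerSum (hu : NotRoot u) (c : PowerSeries (PowerSeries ℂ))
    (al be : YoungDiagram) :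
    negCauchy c (specPowerSum u al) (specPowerSum u be)
      = negCauchy c (specPowerSum u ⊥) (specPowerSum u ⊥)
        * (crossPoly u al be.transpose).eval₂ (PowerSeries.C.comp const₂)
            (PowerSeries.C c * PowerSeries.X) := by
  rw [negCauchy, newton_neg_specPowerSum_mul hu, map_mul, map_mul, rescale_map_coe, negCauchy]

/-- The signs (-1)^{|ν|} and those of ω combine to the power sums -p p', that is, to products of 1 -
Q x y. Both alphabets are unions of two, which gives the four factors. -/
theorem sum_neg_mul_sk (p1 p2 p3 p4 : ℕ → ℂ) :
    (PowerSeries.mk fun c => ∑ nu ∈ partitionsOf c, (-1) ^ c *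
      (PowerSeries.C (sk (newton (mixPow p1 p2)) nu ⊥)
        * PowerSeries.map PowerSeries.C (sk (newton (mixPow p3 p4)) nu.transpose ⊥)) : Nested)
      = negCauchy 1 p1 p3 * negCauchy (PowerSeries.C PowerSeries.X) p2 p3
        * negCauchy PowerSeries.X p1 p4
        * negCauchy (PowerSeries.C PowerSeries.X * PowerSeries.X) p2 p4 := by
  have h1 : (PowerSeries.mk fun c => ∑ nu ∈ partitionsOf c, (-1) ^ c *
      (PowerSeries.C (sk (newton (mixPow p1 p2)) nu ⊥)
        * PowerSeries.map PowerSeries.C (sk (newton (mixPow p3 p4)) nu.transpose ⊥)) : Nested)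
      = PowerSeries.rescale (-1) (newton ((fun n => PowerSeries.C (mixPow p1 p2 n))
        * omegaPow fun n => PowerSeries.map PowerSeries.C (mixPow p3 p4 n))) := by
    ext1 c
    rw [PowerSeries.coeff_mk, PowerSeries.coeff_rescale, ← dual_cauchy, Finset.mul_sum]
    refine Finset.sum_congr rfl fun nu _ => ?_
    rw [← newton_map, ← newton_map, sk_map, sk_map]
  rw [h1, ← newton_rescale]
  have h2 : ∀ (c : PowerSeries (PowerSeries ℂ)) (p p' : ℕ → ℂ), negCauchy c p p'
      = newton fun n => c ^ n * const₂ (-(p n * p' n)) := by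
    intro c p p'
    rw [negCauchy, newton_map, newton_rescale]
    rfl
  simp only [h2, ← newton_add]
  congr 1
  ext1 n
  have h3 : ((-1) ^ n * (-1) ^ n : PowerSeries (PowerSeries ℂ)) = 1 := by
    rw [← mul_pow]
    simp
  simp only [Pi.mul_apply, Pi.add_apply, omegaPow, mixPow, const₂, RingHom.comp_apply, map_add,
    map_mul, map_pow, PowerSeries.map_X, PowerSeries.map_C, map_neg]
  linear_combination (-(PowerSeries.C (PowerSeries.C (p1 n))
    + PowerSeries.C PowerSeries.X ^ n * PowerSeries.C (PowerSeries.C (p2 n)))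
    * (PowerSeries.C (PowerSeries.C (p3 n))
      + PowerSeries.X ^ n * PowerSeries.C (PowerSeries.C (p4 n)))) * h3

/-- The product of the squares of the four principal specializations. -/
def specConst (u : ℂ) (mu : Fin 2 → Fin 2 → YoungDiagram) : ℂ :=
  skewSchur u (mu 0 1).transpose ⊥ ⊥ ^ 2 * skewSchur u (mu 0 0) ⊥ ⊥ ^ 2
    * (skewSchur u (mu 1 1) ⊥ ⊥ ^ 2 * skewSchur u (mu 1 0).transpose ⊥ ⊥ ^ 2)

/-- `stripSeries` in terms of the quadruple of partitions of the product formula. -/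
def quadSeries (u : ℂ) (mu : Fin 2 → Fin 2 → YoungDiagram) : Nested :=
  stripSeries u (mu 0 1) (mu 0 0).transpose (mu 1 0) (mu 1 1).transpose

theorem quadSeries_eq (mu : Fin 2 → Fin 2 → YoungDiagram) :
    quadSeries u mu = PowerSeries.C (const₂ (specConst u mu))
      * (PowerSeries.C (PowerSeries.C (newton (specPowerSum u (mu 0 1).transpose
            * specPowerSum u (mu 0 0)))) ^ 2
        * PowerSeries.C (PowerSeries.map PowerSeries.C (newton (specPowerSum u (mu 1 1)
            * specPowerSum u (mu 1 0).transpose))) ^ 2)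
      * (negCauchy 1 (specPowerSum u (mu 0 1)) (specPowerSum u (mu 1 1).transpose)
        * negCauchy (PowerSeries.C PowerSeries.X) (specPowerSum u (mu 0 0))
            (specPowerSum u (mu 1 1).transpose)
        * negCauchy PowerSeries.X (specPowerSum u (mu 0 1)) (specPowerSum u (mu 1 0).transpose)
        * negCauchy (PowerSeries.C PowerSeries.X * PowerSeries.X) (specPowerSum u (mu 0 0))
            (specPowerSum u (mu 1 0).transpose)) := by
  rw [← sum_neg_mul_sk, quadSeries, stripSeries]
  simp only [← map_pow, ← map_mul]
  ext1 c
  rw [PowerSeries.coeff_C_mul, PowerSeries.coeff_mk, PowerSeries.coeff_mk, Finset.mul_sum]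
  refine Finset.sum_congr rfl fun nu _ => ?_
  simp only [squareSeries, YoungDiagram.transpose_transpose, specConst, const₂, RingHom.comp_apply,
    map_mul, map_pow, PowerSeries.map_C]
  ring

/-- The denominator of a quotient of two `quadSeries`. -/
def quadDen (u : ℂ) (mu : Fin 2 → Fin 2 → YoungDiagram) : MvPolynomial FVar ℂ :=
  polyAt (crossPoly u (mu 0 1).transpose (mu 0 0).transpose) (MvPolynomial.X (.F 0)) ^ 2
    * polyAt (crossPoly u (mu 1 1) (mu 1 0)) (MvPolynomial.X (.F 1)) ^ 2

/-- The numerator of a quotient of two `quadSeries`. -/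
def quadNum (u : ℂ) (mu : Fin 2 → Fin 2 → YoungDiagram) : MvPolynomial FVar ℂ :=
  MvPolynomial.C (specConst u mu)
    * (polyAt (crossPoly u (mu 0 1) (mu 1 1)) (MvPolynomial.X .Q0)
      * polyAt (crossPoly u (mu 0 0) (mu 1 1)) (MvPolynomial.X (.F 0) * MvPolynomial.X .Q0)
      * polyAt (crossPoly u (mu 0 1) (mu 1 0)) (MvPolynomial.X (.F 1) * MvPolynomial.X .Q0)
      * polyAt (crossPoly u (mu 0 0) (mu 1 0))
          (MvPolynomial.X (.F 0) * MvPolynomial.X (.F 1) * MvPolynomial.X .Q0))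

theorem specConst_bot (u : ℂ) : specConst u (fun _ _ => ⊥) = 1 := by
  simp [specConst, transpose_bot, skewSchur_bot]

/-- Every infinite product is its empty value times or divided by a `crossPoly`. The joining edge
contributes the four numerators; the denominators are squared because each square has two vertical
edges. -/
theorem quadSeries_mul_quadDen (hu : NotRoot u) (mu : Fin 2 → Fin 2 → YoungDiagram) :
    (quadDen u mu : MvPowerSeries FVar ℂ) * nestedEquiv.symm (quadSeries u mu)
      = (quadNum u mu : MvPowerSeries FVar ℂ)
        * nestedEquiv.symm (quadSeries u fun _ _ => ⊥) := by
  apply nestedEquiv.injective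
  rw [map_mul, map_mul, RingEquiv.apply_symm_apply, RingEquiv.apply_symm_apply, quadDen, quadNum]
  simp only [MvPolynomial.coe_mul, MvPolynomial.coe_pow, MvPolynomial.coe_C, map_mul, map_pow,
    nestedEquiv_polyAt, MvPolynomial.coe_X, nestedEquiv_F0, nestedEquiv_F1, nestedEquiv_Q0,
    nestedEquiv_C]
  rw [quadSeries_eq, quadSeries_eq, specConst_bot,
    negCauchy_specPowerSum hu _ (mu 0 1) (mu 1 1).transpose,
    negCauchy_specPowerSum hu _ (mu 0 0) (mu 1 1).transpose,
    negCauchy_specPowerSum hu _ (mu 0 1) (mu 1 0).transpose,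
    negCauchy_specPowerSum hu _ (mu 0 0) (mu 1 0).transpose]
  simp only [YoungDiagram.transpose_transpose, transpose_bot]
  have hL := congrArg (fun f => (PowerSeries.C (PowerSeries.C f) : Nested))
    (newton_specPowerSum_mul hu (mu 0 1).transpose (mu 0 0))
  have hR := congrArg (fun f => (PowerSeries.C (PowerSeries.map PowerSeries.C f) : Nested))
    (newton_specPowerSum_mul hu (mu 1 1) (mu 1 0).transpose)
  simp only [map_mul, C_C_coe, C_map_coe, YoungDiagram.transpose_transpose] at hL hR
  rw [← hL, ← hR]
  simp only [map_mul, map_one, one_mul]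
  ring

end StripProduct

/-! ### Division by the part free of Q_{B_1}, Q_{B_2}. -/

section BaseCoefficients

/-- A power series without `Q_{B_1}, Q_{B_2}` as a power series in all variables. -/
def constB (g : MvPowerSeries FVar ℂ) : MvPowerSeries XVar ℂ := fun e =>
  if ∀ k : Fin 2, e (.inl k) = 0 then
    MvPowerSeries.coeff (Finsupp.equivFunOnFinite.symm fun v => e (.inr v)) g else 0

theorem sumElim_restrict (e : XVar →₀ ℕ) :
    Finsupp.sumElim (Finsupp.equivFunOnFinite.symm fun k => e (.inl k))
      (Finsupp.equivFunOnFinite.symm fun v => e (.inr v)) = e := by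
  ext v
  rcases v with k | v <;> simp

theorem setBZero_eq (f : MvPowerSeries XVar ℂ) : setBZero f = constB (coeffB 0 f) := by
  ext e
  change (if ∀ k : Fin 2, e (.inl k) = 0 then MvPowerSeries.coeff e f else 0)
    = if ∀ k : Fin 2, e (.inl k) = 0 then MvPowerSeries.coeff (Finsupp.sumElim 0
      (Finsupp.equivFunOnFinite.symm fun v => e (.inr v))) f else 0
  refine ite_congr rfl (fun h => ?_) fun _ => rfl
  congr 1
  conv_lhs => rw [← sumElim_restrict e]
  congr 2
  ext k
  simpa using h k

theorem ext_coeffB {f g : MvPowerSeries XVar ℂ} (h : ∀ d, coeffB d f = coeffB d g) : f = g := by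
  ext e
  have h1 := congrArg (MvPowerSeries.coeff (Finsupp.equivFunOnFinite.symm fun v => e (.inr v)))
    (h (Finsupp.equivFunOnFinite.symm fun k => e (.inl k)))
  change MvPowerSeries.coeff (Finsupp.sumElim _ _) f = MvPowerSeries.coeff (Finsupp.sumElim _ _) g
    at h1
  rwa [sumElim_restrict] at h1

/-- The whole exponent d must come from the first factor, so normalising by such a series acts on
each coefficient separately. -/
theorem coeffB_mul_constB (d : Fin 2 →₀ ℕ) (f : MvPowerSeries XVar ℂ) (g : MvPowerSeries FVar ℂ) :
    coeffB d (f * constB g) = coeffB d f * g := by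
  classical
  ext e
  change MvPowerSeries.coeff (Finsupp.sumElim d e) (f * constB g) = _
  rw [MvPowerSeries.coeff_mul, MvPowerSeries.coeff_mul]
  symm
  refine Finset.sum_of_injOn (fun p => (Finsupp.sumElim d p.1, Finsupp.sumElim 0 p.2)) ?_ ?_ ?_ ?_
  · rintro p _ q _ h
    simp only [Prod.mk.injEq] at h
    refine Prod.ext (Finsupp.ext fun v => ?_) (Finsupp.ext fun v => ?_)
    · simpa using DFunLike.congr_fun h.1 (.inr v)
    · simpa using DFunLike.congr_fun h.2 (.inr v)
  · intro p hp
    simp only [Finset.mem_coe, Finset.HasAntidiagonal.mem_antidiagonal] at hp ⊢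
    ext v
    rcases v with k | v
    · simp
    · simp [← hp]
  · rintro ⟨x, y⟩ hxy hnot
    rw [Finset.HasAntidiagonal.mem_antidiagonal] at hxy
    simp only at hxy
    suffices h0 : MvPowerSeries.coeff y (constB g) = 0 by rw [h0, mul_zero]
    change (if ∀ k : Fin 2, y (.inl k) = 0 then _ else _) = _
    refine if_neg fun hy => hnot ?_
    refine ⟨(Finsupp.equivFunOnFinite.symm fun v => x (.inr v),
      Finsupp.equivFunOnFinite.symm fun v => y (.inr v)), ?_, ?_⟩
    · rw [Finset.mem_coe, Finset.HasAntidiagonal.mem_antidiagonal]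
      ext v
      have := DFunLike.congr_fun hxy (.inr v)
      simpa using this
    · refine Prod.ext (Finsupp.ext fun v => ?_) (Finsupp.ext fun v => ?_)
      · rcases v with k | v
        · have := DFunLike.congr_fun hxy (.inl k)
          simp only [Finsupp.add_apply, hy, add_zero, Finsupp.sumElim_inl] at this
          simp [this]
        · simp
      · rcases v with k | v
        · simp [hy]
        · simp
  · intro p _
    have h : MvPowerSeries.coeff (Finsupp.sumElim 0 p.2) (constB g) = MvPowerSeries.coeff p.2 g := by
      have h1 : ∀ y : XVar →₀ ℕ, MvPowerSeries.coeff y (constB g)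
          = if ∀ k : Fin 2, y (.inl k) = 0 then
            MvPowerSeries.coeff (Finsupp.equivFunOnFinite.symm fun v => y (.inr v)) g else 0 :=
        fun y => rfl
      rw [h1, if_pos fun k => by simp]
      congr 2
      ext v
      simp
    rw [h]
    rfl

theorem coeffB_constB (d : Fin 2 →₀ ℕ) (g : MvPowerSeries FVar ℂ) :
    coeffB d (constB g) = coeffB d 1 * g := by
  rw [← coeffB_mul_constB, one_mul]

theorem constB_mul (g h : MvPowerSeries FVar ℂ) : constB (g * h) = constB g * constB h := by
  refine ext_coeffB fun d => ?_
  rw [coeffB_mul_constB, coeffB_constB, coeffB_constB, mul_assoc]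

theorem constB_one : constB 1 = 1 := by
  refine ext_coeffB fun d => ?_
  rw [coeffB_constB, mul_one]

theorem constB_inv {g : MvPowerSeries FVar ℂ} (hg : MvPowerSeries.constantCoeff g ≠ 0) :
    (constB g)⁻¹ = constB g⁻¹ := by
  have h1 : constB g⁻¹ * constB g = 1 := by
    rw [← constB_mul, MvPowerSeries.inv_mul_cancel _ hg, constB_one]
  have h2 : MvPowerSeries.constantCoeff (constB g) ≠ 0 := by
    intro h
    have := congrArg MvPowerSeries.constantCoeff h1
    rw [map_mul, h, mul_zero, map_one] at this
    exact zero_ne_one this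
  exact ((MvPowerSeries.eq_inv_iff_mul_eq_one h2).2 h1).symm

theorem coeffB_ZXInst {u : ℂ} (h0 : MvPowerSeries.constantCoeff (coeffB 0 (ZX u)) ≠ 0)
    (d : Fin 2 →₀ ℕ) : coeffB d (ZXInst u) = coeffB d (ZX u) * (coeffB 0 (ZX u))⁻¹ := by
  rw [ZXInst, setBZero_eq, constB_inv h0, coeffB_mul_constB]

end BaseCoefficients

/-! ### The coefficients of Z_X^inst as rational functions. -/

section RationalValues

theorem HasRationalValue.zero {s : Type} (z : s → ℂ) : HasRationalValue 0 z 0 :=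
  ⟨0, 1, by simp, by simp, by simp⟩

theorem HasRationalValue.add {s : Type} {f g : MvPowerSeries s ℂ} {z : s → ℂ} {b c : ℂ}
    (hf : HasRationalValue f z b) (hg : HasRationalValue g z c) :
    HasRationalValue (f + g) z (b + c) := by
  obtain ⟨P, D, h1, h2, rfl⟩ := hf
  obtain ⟨P', D', h1', h2', rfl⟩ := hg
  refine ⟨P * D' + D * P', D * D', ?_, ?_, ?_⟩
  · push_cast
    rw [← h1, ← h1']
    ring
  · rw [map_mul]
    exact mul_ne_zero h2 h2'
  · simp only [map_add, map_mul]
    exact div_add_div _ _ h2 h2'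

theorem HasRationalValue.sum {s ι : Type} {t : Finset ι} {f : ι → MvPowerSeries s ℂ} {z : s → ℂ}
    {c : ι → ℂ} (h : ∀ i ∈ t, HasRationalValue (f i) z (c i)) :
    HasRationalValue (∑ i ∈ t, f i) z (∑ i ∈ t, c i) := by
  classical
  induction t using Finset.induction_on with
  | empty => simpa using HasRationalValue.zero z
  | insert a t ha ih =>
    rw [Finset.sum_insert ha, Finset.sum_insert ha]
    exact (h a (Finset.mem_insert_self _ _)).add
      (ih fun i hi => h i (Finset.mem_insert_of_mem hi))

variable {u : ℂ}

theorem constantCoeff_negCauchy (c : PowerSeries (PowerSeries ℂ)) (p p' : ℕ → ℂ) :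
    PowerSeries.constantCoeff (negCauchy c p p') = 1 := by
  rw [negCauchy, ← PowerSeries.coeff_zero_eq_constantCoeff_apply, PowerSeries.coeff_rescale,
    PowerSeries.coeff_map, PowerSeries.coeff_zero_eq_constantCoeff_apply, constantCoeff_newton]
  simp

theorem constantCoeff_quadSeries_bot (u : ℂ) :
    MvPowerSeries.constantCoeff (nestedEquiv.symm (quadSeries u fun _ _ => ⊥)) = 1 := by
  rw [← MvPowerSeries.coeff_zero_eq_constantCoeff_apply, coeff_nestedEquiv_symm]
  simp only [Finsupp.coe_zero, Pi.zero_apply, PowerSeries.coeff_zero_eq_constantCoeff_apply]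
  rw [quadSeries_eq]
  simp only [map_mul, map_pow, constantCoeff_negCauchy, PowerSeries.constantCoeff_C,
    specConst_bot, map_one, one_mul, mul_one, constantCoeff_newton, one_pow]
  have h : ∀ F : PowerSeries ℂ, PowerSeries.constantCoeff (PowerSeries.map PowerSeries.C F)
      = PowerSeries.C (PowerSeries.constantCoeff F) := fun F => by
    rw [← PowerSeries.coeff_zero_eq_constantCoeff_apply, PowerSeries.coeff_map,
      PowerSeries.coeff_zero_eq_constantCoeff_apply]
  simp [h]

/-- A reindexing: the top edges carry μ^1_2 and μ^2_1, the bottom edges the conjugates of μ^1_1 and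
μ^2_2. Conjugation preserves sizes. -/
theorem coeffB_ZX_eq (hu : NotRoot u) (d : Fin 2 →₀ ℕ) :
    coeffB d (ZX u) = ∑ mu ∈ quadruples d, nestedEquiv.symm (quadSeries u mu) := by
  rw [coeffB_ZX hu]
  simp only [← Finset.sum_product']
  symm
  refine Finset.sum_bij'
    (i := fun mu _ => ((mu 0 1, (mu 0 0).transpose), (mu 1 0, (mu 1 1).transpose)))
    (j := fun t _ => ![![t.1.2.transpose, t.1.1], ![t.2.1, t.2.2.transpose]]) ?_ ?_ ?_ ?_ ?_
  · intro mu hmu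
    have h0 := mem_quadruples.1 hmu 0
    have h1 := mem_quadruples.1 hmu 1
    simp only [Finset.mem_product, mem_pairsOf, card_transpose]
    exact ⟨by omega, by omega⟩
  · intro t ht
    simp only [Finset.mem_product, mem_pairsOf] at ht
    rw [mem_quadruples]
    intro k
    fin_cases k <;> simp [card_transpose] <;> omega
  · intro mu _
    funext k l
    fin_cases k <;> fin_cases l <;> simp [YoungDiagram.transpose_transpose]
  · intro t _
    simp [YoungDiagram.transpose_transpose]
  · intro mu _
    rfl

theorem quadruples_zero : quadruples 0 = {fun _ _ => ⊥} := by
  ext mu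
  rw [mem_quadruples, Finset.mem_singleton]
  constructor
  · intro h
    funext k l
    have := h k
    simp only [Finsupp.coe_zero, Pi.zero_apply, Nat.add_eq_zero_iff, card_eq_zero] at this
    fin_cases l
    · exact this.1
    · exact this.2
  · rintro rfl k
    simp [card_bot]

theorem hasRationalValue_coeffB_ZXInst (hu : NotRoot u) (d : Fin 2 →₀ ℕ) (z : FVar → ℂ)
    (hz : ∀ mu, MvPolynomial.eval z (quadDen u mu) ≠ 0) :
    HasRationalValue (coeffB d (ZXInst u)) z (∑ mu ∈ quadruples d,
      MvPolynomial.eval z (quadNum u mu) / MvPolynomial.eval z (quadDen u mu)) := by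
  set W0 := nestedEquiv.symm (quadSeries u fun _ _ => ⊥) with hW0
  have h0 : coeffB 0 (ZX u) = W0 := by
    rw [coeffB_ZX_eq hu, quadruples_zero, Finset.sum_singleton]
  have hc : MvPowerSeries.constantCoeff W0 ≠ 0 := by
    rw [hW0, constantCoeff_quadSeries_bot]
    exact one_ne_zero
  rw [coeffB_ZXInst (by rwa [h0]), h0, coeffB_ZX_eq hu, Finset.sum_mul]
  refine HasRationalValue.sum fun mu _ => ⟨quadNum u mu, quadDen u mu, ?_, hz mu, rfl⟩
  rw [← mul_assoc, quadSeries_mul_quadDen hu, mul_assoc, ← hW0, MvPowerSeries.mul_inv_cancel _ hc,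
    mul_one]

end RationalValues

/-! ### Rules for products over net multiplicities. -/

section CrossProductRules

/-- Second differences kill constants and linear functions. So here and in `sum_mul_netMult` only
the single sums over cells survive; the two results extract scalar and exponential prefactors from
products. -/
theorem sum_netMult (mu nu : YoungDiagram) :
    ((netFinsupp mu nu).sum fun _ n => n) = -((mu.card : ℤ) + nu.card) := by
  have h := sum_netMult_smul mu nu fun _ => (1 : ℤ)
  simp only [smul_eq_mul, mul_one] at h
  rw [h, netSum]
  simp only [Finset.sum_const, nsmul_eq_mul, mul_one, YoungDiagram.card]
  simp
  ring

theorem sum_mul_netMult (mu nu : YoungDiagram) :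
    ((netFinsupp mu nu).sum fun k n => k * n)
      = -(∑ c ∈ mu.cells, content c - ∑ c ∈ nu.cells, content c) := by
  have h := sum_netMult_smul mu nu fun k => k
  simp only [smul_eq_mul] at h
  rw [show (fun k n : ℤ => k * n) = fun k n => n * k from funext₂ fun k n => mul_comm k n, h, netSum,
    Finset.sum_neg_distrib, Finset.sum_eq_zero (s := mu.cells) (f := fun c =>
    ∑ c' ∈ nu.cells, (content c - content c' + 1 - (2 : ℤ) • (content c - content c')
      + (content c - content c' - 1)))]
  · ring
  · intro c _
    refine Finset.sum_eq_zero fun c' _ => ?_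
    rw [smul_eq_mul]
    ring

theorem prod_zpow_eq {ι : Type*} {w : ℂ} (hw : w ≠ 0) (s : Finset ι) (f : ι → ℤ) :
    ∏ i ∈ s, w ^ f i = w ^ ∑ i ∈ s, f i := by
  classical
  induction s using Finset.induction_on with
  | empty => simp
  | insert a s ha ih => rw [Finset.prod_insert ha, Finset.sum_insert ha, zpow_add₀ hw, ih]

variable (mu nu : YoungDiagram)

theorem crossProdInv_eq_inv (phi : ℤ → ℂ) : crossProdInv mu nu phi = (crossProd mu nu phi)⁻¹ := by
  rw [crossProdInv_eq, crossProd_eq, Finsupp.prod, Finsupp.prod, ← Finset.prod_inv_distrib]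
  exact Finset.prod_congr rfl fun k _ => zpow_neg _ _

theorem crossProd_mul (phi psi : ℤ → ℂ) :
    crossProd mu nu (fun k => phi k * psi k) = crossProd mu nu phi * crossProd mu nu psi := by
  simp only [crossProd_eq, mul_zpow, Finsupp.prod_mul]

theorem crossProd_const {w : ℂ} (hw : w ≠ 0) :
    crossProd mu nu (fun _ => w) = w ^ (-((mu.card : ℤ) + nu.card)) := by
  rw [crossProd_eq, Finsupp.prod, prod_zpow_eq hw, ← sum_netMult]
  rfl

theorem crossProd_zpow {w : ℂ} (hw : w ≠ 0) : crossProd mu nu (fun k => w ^ k)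
    = w ^ (-(∑ c ∈ mu.cells, content c - ∑ c ∈ nu.cells, content c)) := by
  rw [crossProd_eq, Finsupp.prod]
  simp only [← zpow_mul]
  rw [prod_zpow_eq hw, ← sum_mul_netMult]
  rfl

theorem crossProd_swap (phi : ℤ → ℂ) :
    crossProd mu nu phi = crossProd nu mu fun k => phi (-k) := by
  rw [crossProd, crossProd, ← finprod_comp_equiv (Equiv.neg ℤ)]
  refine finprod_congr fun k => ?_
  rw [Equiv.neg_apply, netMult_swap, neg_neg]

/-- Conjugation negates contents, and in `netSum` this has the same effect as exchanging the two
partitions. -/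
theorem netMult_transpose (k : ℤ) : netMult mu.transpose nu.transpose k = netMult nu mu k := by
  rw [← netFinsupp_apply, ← netFinsupp_apply, netFinsupp, netFinsupp]
  congr 1
  simp only [netSum]
  rw [sum_cells_transpose mu (fun x => Finsupp.single x (1 : ℤ)),
    sum_cells_transpose nu (fun x => Finsupp.single (-x) (1 : ℤ)),
    sum_cells_transpose mu (fun x => ∑ c' ∈ nu.transpose.cells,
      (Finsupp.single (x - content c' + 1) (1 : ℤ) - (2 : ℤ) • Finsupp.single (x - content c') 1
        + Finsupp.single (x - content c' - 1) 1)), Finset.sum_comm (s := nu.cells)]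
  simp only [neg_neg]
  congr 1
  · abel
  · refine Finset.sum_congr rfl fun c _ => ?_
    rw [sum_cells_transpose nu (fun x => Finsupp.single (-content c - x + 1) (1 : ℤ)
      - (2 : ℤ) • Finsupp.single (-content c - x) 1 + Finsupp.single (-content c - x - 1) 1)]
    refine Finset.sum_congr rfl fun c' _ => ?_
    have h : -content c - -content c' = content c' - content c := by ring
    rw [h]

theorem crossProd_transpose (phi : ℤ → ℂ) :
    crossProd mu.transpose nu.transpose phi = crossProd nu mu phi := by
  simp only [crossProd, netMult_transpose]

theorem crossProd_neg (phi : ℤ → ℂ) :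
    crossProd mu nu (fun k => -phi k) = (-1) ^ (mu.card + nu.card) * crossProd mu nu phi := by
  have h := crossProd_mul mu nu (fun _ => -1) phi
  simp only [neg_one_mul] at h
  rw [h, crossProd_const mu nu (by norm_num), ← Nat.cast_add, zpow_neg, zpow_natCast]
  congr 1
  rw [← inv_pow]
  norm_num

theorem crossProd_ne_zero {phi : ℤ → ℂ} (h : ∀ k, phi k ≠ 0) : crossProd mu nu phi ≠ 0 := by
  rw [crossProd_eq, Finsupp.prod]
  exact Finset.prod_ne_zero_iff.2 fun k _ => zpow_ne_zero _ (h k)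

theorem eval_crossPoly (u Q : ℂ) : (crossPoly u mu nu).eval Q
    = (crossProd mu nu fun k => 1 - u ^ (2 * k) * Q)⁻¹ := by
  rw [← crossProdInv_eq_inv, crossProdInv_eq, crossPoly, Finsupp.prod, Polynomial.eval_prod]
  refine Finset.prod_congr rfl fun k _ => ?_
  have h := netFinsupp_nonpos mu nu k
  simp only [Polynomial.eval_pow, Polynomial.eval_sub, Polynomial.eval_one, Polynomial.eval_mul,
    Polynomial.eval_C, Polynomial.eval_X]
  rw [← zpow_natCast, Int.toNat_of_nonneg (by omega)]

end CrossProductRules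

/-! ### Passage to hyperbolic functions and the vector factors. -/

section Hyperbolic

variable (R hb : ℂ)

/-- `∏ sinh R(A + ħ(μ_i - ν_j + j - i)) / sinh R(A + ħ(j - i))`. -/
def sinhCross (A : ℂ) (mu nu : YoungDiagram) : ℂ :=
  crossProd mu nu fun s => Complex.sinh (R * (A + hb * s))

variable {R hb}

theorem exp_zpow (k : ℤ) : Complex.exp (-R * hb) ^ k = Complex.exp (-(R * (hb * k))) := by
  rw [← Complex.exp_int_mul]
  congr 1
  ring

theorem br_exp (k : ℤ) : br (Complex.exp (-R * hb)) k = -2 * Complex.sinh (R * (hb * k)) := by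
  rw [br, exp_zpow, exp_zpow, Complex.sinh]
  push_cast
  rw [show -(R * (hb * -(k : ℂ))) = R * (hb * k) by ring]
  ring

/-- Each factor is 1 - q^k e^{-2RA} = 2 e^{-RA} q^{k/2} sinh R(A + ħk). The total multiplicity
collects the powers of 2 e^{-RA}, the first moment those of q^{1/2}. -/
theorem eval_crossPoly_exp (A : ℂ) (mu nu : YoungDiagram) :
    (crossPoly (Complex.exp (-R * hb)) mu nu).eval (Complex.exp (-2 * R * A))
      = (2 * Complex.exp (-R * A)) ^ (mu.card + nu.card)
        * Complex.exp (-R * hb) ^ (∑ c ∈ mu.cells, content c - ∑ c ∈ nu.cells, content c)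
        * (sinhCross R hb A mu nu)⁻¹ := by
  have h1 : ∀ k : ℤ, 1 - Complex.exp (-R * hb) ^ (2 * k) * Complex.exp (-2 * R * A)
      = 2 * Complex.exp (-R * A)
        * (Complex.exp (-R * hb) ^ k * Complex.sinh (R * (A + hb * k))) := by
    intro k
    rw [exp_zpow, exp_zpow, Complex.sinh]
    have e1 : Complex.exp (-R * A) * (Complex.exp (-(R * (hb * k)))
        * Complex.exp (R * (A + hb * k))) = 1 := by
      rw [← Complex.exp_add, ← Complex.exp_add, ← Complex.exp_zero]
      congr 1
      ring
    have e2 : Complex.exp (-R * A) * (Complex.exp (-(R * (hb * k)))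
        * Complex.exp (-(R * (A + hb * k))))
        = Complex.exp (-(R * (hb * (2 * k : ℤ)))) * Complex.exp (-2 * R * A) := by
      rw [← Complex.exp_add, ← Complex.exp_add, ← Complex.exp_add]
      congr 1
      push_cast
      ring
    linear_combination e2 - e1
  rw [eval_crossPoly]
  have hw : 2 * Complex.exp (-R * A) ≠ 0 := mul_ne_zero two_ne_zero (Complex.exp_ne_zero _)
  simp only [h1]
  generalize 2 * Complex.exp (-R * A) = w at hw ⊢
  rw [crossProd_mul, crossProd_mul, crossProd_const _ _ hw, crossProd_zpow _ _ (Complex.exp_ne_zero _), mul_inv, mul_inv,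
    zpow_neg, zpow_neg, inv_inv, inv_inv, ← Nat.cast_add, zpow_natCast, mul_assoc]
  rfl

theorem sinhCross_neg_mul (A : ℂ) (mu nu : YoungDiagram) :
    sinhCross R hb (-A) nu mu = (-1) ^ (mu.card + nu.card) * sinhCross R hb A mu nu := by
  rw [sinhCross, sinhCross, ← crossProd_neg, crossProd_swap]
  congr 1
  ext k
  rw [← Complex.sinh_neg]
  congr 1
  push_cast
  ring

variable {a : Fin 2 → ℂ}

theorem Generic.notRoot (h : Generic R hb a) : NotRoot (Complex.exp (-R * hb)) := by
  refine ⟨Complex.exp_ne_zero _, fun n hn => ?_⟩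
  rw [br_exp]
  exact mul_ne_zero (by norm_num) (h.1 n hn)

theorem Generic.sinhCross_ne_zero (h : Generic R hb a) (k : Fin 2) (mu nu : YoungDiagram) :
    sinhCross R hb (2 * a k) mu nu ≠ 0 :=
  crossProd_ne_zero _ _ fun n => h.2 k n

theorem Generic.skewSchur_sq (h : Generic R hb a) (lam : YoungDiagram) :
    skewSchur (Complex.exp (-R * hb)) lam ⊥ ⊥ ^ 2
      = (-1 / 4) ^ lam.card * Complex.exp (-R * hb) ^ kappa lam * sinhCross R hb 0 lam lam := by
  rw [skewSchur_bot_sq h.notRoot, sinhCross]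
  simp only [zero_add]
  have h1 : br (Complex.exp (-R * hb)) = fun k : ℤ => -2 * Complex.sinh (R * (hb * k)) :=
    funext br_exp
  rw [h1, crossProd_mul, crossProd_const _ _ (by norm_num), div_pow]
  have h2 : ((-2 : ℂ)) ^ (-((lam.card : ℤ) + lam.card)) = 1 / 4 ^ lam.card := by
    rw [zpow_neg, zpow_add₀ (by norm_num), zpow_natCast, ← mul_pow, one_div]
    norm_num
  rw [h2]
  ring

theorem sinhCross_transpose (A : ℂ) (mu nu : YoungDiagram) :
    sinhCross R hb A mu.transpose nu.transpose = sinhCross R hb A nu mu :=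
  crossProd_transpose _ _ _

variable {m : ℂ}

theorem eval_quadDen (mu : Fin 2 → Fin 2 → YoungDiagram) :
    MvPolynomial.eval (paramPoint R m a) (quadDen (Complex.exp (-R * hb)) mu)
      = (4 * Complex.exp (-4 * R * a 0)) ^ ((mu 0 0).card + (mu 0 1).card)
        * Complex.exp (-R * hb) ^ (kappa (mu 0 0) - kappa (mu 0 1))
        * (sinhCross R hb (2 * a 0) (mu 0 0) (mu 0 1) ^ 2)⁻¹
        * ((4 * Complex.exp (-4 * R * a 1)) ^ ((mu 1 0).card + (mu 1 1).card)
        * Complex.exp (-R * hb) ^ (kappa (mu 1 1) - kappa (mu 1 0))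
        * (sinhCross R hb (2 * a 1) (mu 1 1) (mu 1 0) ^ 2)⁻¹) := by
  have e : ∀ k : Fin 2, Complex.exp (-4 * R * a k) = Complex.exp (-2 * R * (2 * a k)) := by
    intro k
    congr 1
    ring
  have e2 : ∀ k : Fin 2, Complex.exp (-2 * R * (2 * a k)) = Complex.exp (-R * (2 * a k)) ^ 2 := by
    intro k
    rw [← Complex.exp_nat_mul]
    congr 1
    push_cast
    ring
  have hk : ∀ x : ℤ, (Complex.exp (-R * hb) ^ x) ^ 2 = Complex.exp (-R * hb) ^ (2 * x) := by
    intro x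
    rw [← zpow_natCast, ← zpow_mul]
    congr 1
    push_cast
    ring
  rw [quadDen, map_mul, map_pow, map_pow, eval_polyAt, eval_polyAt, MvPolynomial.eval_X,
    MvPolynomial.eval_X, paramPoint, paramPoint, e, e, eval_crossPoly_exp, eval_crossPoly_exp,
    sinhCross_transpose]
  simp only [card_transpose, mul_pow, hk, mul_sub, sum_content_eq_kappa, kappa_transpose, inv_pow,
    e2, ← pow_mul]
  rw [show (4 : ℂ) = 2 ^ 2 by norm_num, ← pow_mul, ← pow_mul, mul_comm _ 2, mul_comm _ 2,
    add_comm (mu 0 1).card, add_comm (mu 1 1).card,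
    show -kappa (mu 0 1) - -kappa (mu 0 0) = kappa (mu 0 0) - kappa (mu 0 1) by ring]

theorem Generic.eval_quadDen_ne_zero (h : Generic R hb a) (mu : Fin 2 → Fin 2 → YoungDiagram) :
    MvPolynomial.eval (paramPoint R m a) (quadDen (Complex.exp (-R * hb)) mu) ≠ 0 := by
  rw [eval_quadDen]
  have h0 := h.sinhCross_ne_zero
  have h1 : ∀ x : ℂ, 4 * Complex.exp x ≠ 0 :=
    fun x => mul_ne_zero (by norm_num) (Complex.exp_ne_zero x)
  exact mul_ne_zero (mul_ne_zero (mul_ne_zero (pow_ne_zero _ (h1 _))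
    (zpow_ne_zero _ (Complex.exp_ne_zero _))) (inv_ne_zero (pow_ne_zero _ (h0 _ _ _))))
    (mul_ne_zero (mul_ne_zero (pow_ne_zero _ (h1 _))
    (zpow_ne_zero _ (Complex.exp_ne_zero _))) (inv_ne_zero (pow_ne_zero _ (h0 _ _ _))))

/-- The diagonal products come from s(q^ρ)^2. The two off-diagonal ones agree up to sign
(`sinhCross_neg_mul`) and make up the square in `quadDen`. The powers of q cancel, and the signs and
powers of 4 match those of (-1/4)^{|μ|}. -/
theorem Generic.specConst_div (h : Generic R hb a) (mu : Fin 2 → Fin 2 → YoungDiagram) :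
    specConst (Complex.exp (-R * hb)) mu
      / MvPolynomial.eval (paramPoint R m a) (quadDen (Complex.exp (-R * hb)) mu)
      = ∏ k : Fin 2, (1 / (2 ^ 4 * Complex.exp (-4 * R * a k))) ^ ((mu k 0).card + (mu k 1).card) *
        ∏ l : Fin 2, ∏ n : Fin 2,
          crossProd (mu k l) (mu k n) fun s => Complex.sinh (R * (aVec a k l n + hb * s)) := by
  rw [div_eq_iff (h.eval_quadDen_ne_zero mu), eval_quadDen]
  change _ = (∏ k : Fin 2, _ * ∏ l : Fin 2, ∏ n : Fin 2,
    sinhCross R hb (aVec a k l n) (mu k l) (mu k n)) * _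
  simp only [Fin.prod_univ_two]
  have a0 : aVec a 0 0 0 = 0 := rfl
  have a1 : aVec a 0 0 1 = 2 * a 0 := rfl
  have a2 : aVec a 0 1 0 = -(2 * a 0) := rfl
  have a3 : aVec a 0 1 1 = 0 := rfl
  have b0 : aVec a 1 0 0 = 0 := rfl
  have b1 : aVec a 1 0 1 = -(2 * a 1) := rfl
  have b2 : aVec a 1 1 0 = 2 * a 1 := rfl
  have b3 : aVec a 1 1 1 = 0 := rfl
  rw [a0, a1, a2, a3, b0, b1, b2, b3, sinhCross_neg_mul, sinhCross_neg_mul, specConst,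
    h.skewSchur_sq, h.skewSchur_sq, h.skewSchur_sq, h.skewSchur_sq]
  simp only [sinhCross_transpose, kappa_transpose, card_transpose]
  have s0 := h.sinhCross_ne_zero 0 (mu 0 0) (mu 0 1)
  have s1 := h.sinhCross_ne_zero 1 (mu 1 1) (mu 1 0)
  have c0 : ∀ (x : ℂ) (j : ℕ), (1 / (2 ^ 4 * Complex.exp x)) ^ j * (4 * Complex.exp x) ^ j
      = (1 / 4) ^ j := by
    intro x j
    rw [← mul_pow]
    congr 1
    have := Complex.exp_ne_zero x
    field_simp
    norm_num
  have c1 : ∀ i j : ℕ, (-1 / 4 : ℂ) ^ i * (-1 / 4) ^ j = (1 / 4) ^ (i + j) * (-1) ^ (i + j) := by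
    intro i j
    rw [← pow_add, ← mul_pow]
    norm_num
  set w := Complex.exp (-R * hb) with hw
  have hw0 : w ≠ 0 := Complex.exp_ne_zero _
  rw [sub_eq_add_neg, sub_eq_add_neg, zpow_add₀ hw0, zpow_add₀ hw0]
  have d0 := c0 (-4 * R * a 0) ((mu 0 0).card + (mu 0 1).card)
  have d1 := c0 (-4 * R * a 1) ((mu 1 0).card + (mu 1 1).card)
  have e0 := c1 (mu 0 0).card (mu 0 1).card
  have e1 := c1 (mu 1 0).card (mu 1 1).card
  set S0 := sinhCross R hb (2 * a 0) (mu 0 0) (mu 0 1)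
  set S1 := sinhCross R hb (2 * a 1) (mu 1 1) (mu 1 0)
  have f0 : S0 ^ 2 * (S0 ^ 2)⁻¹ = 1 := mul_inv_cancel₀ (pow_ne_zero 2 s0)
  have f1 : S1 ^ 2 * (S1 ^ 2)⁻¹ = 1 := mul_inv_cancel₀ (pow_ne_zero 2 s1)
  rw [add_comm (mu 1 1).card]
  generalize sinhCross R hb 0 (mu 0 0) (mu 0 0) = t0
  generalize sinhCross R hb 0 (mu 0 1) (mu 0 1) = t1
  generalize sinhCross R hb 0 (mu 1 0) (mu 1 0) = t2
  generalize sinhCross R hb 0 (mu 1 1) (mu 1 1) = t3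
  generalize w ^ kappa (mu 0 0) = k0
  generalize w ^ (-kappa (mu 0 1)) = k1
  generalize w ^ kappa (mu 1 1) = k3
  generalize w ^ (-kappa (mu 1 0)) = k2
  calc _ = ((-1 / 4 : ℂ) ^ (mu 0 0).card * (-1 / 4) ^ (mu 0 1).card)
        * ((-1 / 4 : ℂ) ^ (mu 1 0).card * (-1 / 4) ^ (mu 1 1).card)
        * (k0 * k1 * k2 * k3) * (t0 * t1 * t2 * t3) := by ring
    _ = _ := by
      rw [e0, e1, ← d0, ← d1]
      generalize (1 / (2 ^ 4 * Complex.exp (-4 * R * a 0))) ^ ((mu 0 0).card + (mu 0 1).card) = x0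
      generalize (1 / (2 ^ 4 * Complex.exp (-4 * R * a 1))) ^ ((mu 1 0).card + (mu 1 1).card) = x1
      generalize (4 * Complex.exp (-4 * R * a 0)) ^ ((mu 0 0).card + (mu 0 1).card) = y0
      generalize (4 * Complex.exp (-4 * R * a 1)) ^ ((mu 1 0).card + (mu 1 1).card) = y1
      generalize (-1 : ℂ) ^ ((mu 0 0).card + (mu 0 1).card) = g0
      generalize (-1 : ℂ) ^ ((mu 1 0).card + (mu 1 1).card) = g1
      calc _ = x0 * y0 * x1 * y1 * g0 * g1 * (k0 * k1 * k2 * k3) * (t0 * t1 * t2 * t3)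
          * (S0 ^ 2 * (S0 ^ 2)⁻¹) * (S1 ^ 2 * (S1 ^ 2)⁻¹) := by
            rw [f0, f1]
            ring
        _ = _ := by ring

end Hyperbolic

/-! ### The matter factors and the product formula. -/

section SinhFormula

variable {R hb m : ℂ} {a : Fin 2 → ℂ}

/-- The matter factors of the product formula. -/
theorem eval_quadNum (mu : Fin 2 → Fin 2 → YoungDiagram) :
    MvPolynomial.eval (paramPoint R m a) (quadNum (Complex.exp (-R * hb)) mu)
      = specConst (Complex.exp (-R * hb)) mu *
        (Complex.exp (-R * hb) ^
          (kappa (mu 0 0) + kappa (mu 0 1) - kappa (mu 1 0) - kappa (mu 1 1)) *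
        (2 ^ 2 * Complex.exp (2 * R * (a 0 + a 1 - m))) ^
          ((mu 0 0).card + (mu 0 1).card + (mu 1 0).card + (mu 1 1).card) *
        Complex.exp (-2 * R * a 0) ^ (2 * (mu 0 0).card + (mu 1 0).card + (mu 1 1).card) *
        Complex.exp (-2 * R * a 1) ^ ((mu 0 0).card + (mu 0 1).card + 2 * (mu 1 0).card) *
        ∏ l : Fin 2, ∏ n : Fin 2,
          crossProdInv (mu 0 l) (mu 1 n) fun s =>
            Complex.sinh (R * (aBif a l n + m + hb * s))) := by
  have hA : ∀ l n, crossProdInv (mu 0 l) (mu 1 n)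
      (fun s => Complex.sinh (R * (aBif a l n + m + hb * s)))
      = (sinhCross R hb (aBif a l n + m) (mu 0 l) (mu 1 n))⁻¹ :=
    fun l n => crossProdInv_eq_inv _ _ _
  simp only [hA, Fin.prod_univ_two]
  have b0 : aBif a 0 0 = a 0 + a 1 := rfl
  have b1 : aBif a 0 1 = a 0 - a 1 := rfl
  have b2 : aBif a 1 0 = -a 0 + a 1 := rfl
  have b3 : aBif a 1 1 = -a 0 - a 1 := rfl
  -- The four monomials in the arguments of `quadNum` become e^{-2RA} with A the four values
  -- a^{(1,2)}_{ln} + m.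
  have z3 : paramPoint R m a .Q0 = Complex.exp (-2 * R * (-a 0 - a 1 + m)) := by
    rw [paramPoint]
    congr 1
    ring
  have z1 : paramPoint R m a (.F 0) * paramPoint R m a .Q0
      = Complex.exp (-2 * R * (a 0 - a 1 + m)) := by
    rw [paramPoint, paramPoint, ← Complex.exp_add]
    congr 1
    ring
  have z2 : paramPoint R m a (.F 1) * paramPoint R m a .Q0
      = Complex.exp (-2 * R * (-a 0 + a 1 + m)) := by
    rw [paramPoint, paramPoint, ← Complex.exp_add]
    congr 1
    ring
  have z0 : paramPoint R m a (.F 0) * paramPoint R m a (.F 1) * paramPoint R m a .Q0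
      = Complex.exp (-2 * R * (a 0 + a 1 + m)) := by
    rw [paramPoint, paramPoint, paramPoint, ← Complex.exp_add, ← Complex.exp_add]
    congr 1
    ring
  rw [b0, b1, b2, b3, quadNum]
  simp only [map_mul, MvPolynomial.eval_C, eval_polyAt, MvPolynomial.eval_X, z0, z1, z2]
  rw [z3]
  simp only [eval_crossPoly_exp, ← sum_content_eq_kappa]
  set w := Complex.exp (-R * hb) with hw
  have hw0 : w ≠ 0 := Complex.exp_ne_zero _
  generalize ∑ c ∈ (mu 0 0).cells, content c = c0
  generalize ∑ c ∈ (mu 0 1).cells, content c = c1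
  generalize ∑ c ∈ (mu 1 0).cells, content c = c2
  generalize ∑ c ∈ (mu 1 1).cells, content c = c3
  generalize (mu 0 0).card = n0
  generalize (mu 0 1).card = n1
  generalize (mu 1 0).card = n2
  generalize (mu 1 1).card = n3
  have hz : w ^ (c1 - c3) * w ^ (c0 - c3) * w ^ (c1 - c2) * w ^ (c0 - c2)
      = w ^ (2 * c0 + 2 * c1 - 2 * c2 - 2 * c3) := by
    rw [← zpow_add₀ hw0, ← zpow_add₀ hw0, ← zpow_add₀ hw0]
    congr 1
    ring
  have he : (2 * Complex.exp (-R * (-a 0 - a 1 + m))) ^ (n1 + n3)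
      * (2 * Complex.exp (-R * (a 0 - a 1 + m))) ^ (n0 + n3)
      * (2 * Complex.exp (-R * (-a 0 + a 1 + m))) ^ (n1 + n2)
      * (2 * Complex.exp (-R * (a 0 + a 1 + m))) ^ (n0 + n2)
      = (2 ^ 2 * Complex.exp (2 * R * (a 0 + a 1 - m))) ^ (n0 + n1 + n2 + n3)
        * Complex.exp (-2 * R * a 0) ^ (2 * n0 + n2 + n3)
        * Complex.exp (-2 * R * a 1) ^ (n0 + n1 + 2 * n2) := by
    simp only [mul_pow, ← Complex.exp_nat_mul]
    have h2 : ∀ t x0 x1 x2 x3 : ℂ, t ^ (n1 + n3) * x0 * (t ^ (n0 + n3) * x1)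
        * (t ^ (n1 + n2) * x2) * (t ^ (n0 + n2) * x3)
        = (t ^ 2) ^ (n0 + n1 + n2 + n3) * (x0 * x1 * x2 * x3) := by
      intro t x0 x1 x2 x3
      ring
    have h3 : ∀ t x0 x1 x2 : ℂ, t * x0 * x1 * x2 = t * (x0 * x1 * x2) := by
      intro t x0 x1 x2
      ring
    rw [h2, h3 ((2 ^ 2) ^ _)]
    simp only [← Complex.exp_add]
    congr 2
    push_cast
    ring
  rw [← hz]
  generalize 2 * Complex.exp (-R * (-a 0 - a 1 + m)) = x3 at he ⊢
  generalize 2 * Complex.exp (-R * (a 0 - a 1 + m)) = x1 at he ⊢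
  generalize 2 * Complex.exp (-R * (-a 0 + a 1 + m)) = x2 at he ⊢
  generalize 2 * Complex.exp (-R * (a 0 + a 1 + m)) = x0 at he ⊢
  generalize (2 ^ 2 * Complex.exp (2 * R * (a 0 + a 1 - m))) ^ (n0 + n1 + n2 + n3) = y0 at he ⊢
  generalize Complex.exp (-2 * R * a 0) ^ (2 * n0 + n2 + n3) = y1 at he ⊢
  generalize Complex.exp (-2 * R * a 1) ^ (n0 + n1 + 2 * n2) = y2 at he ⊢
  generalize (sinhCross R hb (a 0 + a 1 + m) (mu 0 0) (mu 1 0))⁻¹ = s0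
  generalize (sinhCross R hb (a 0 - a 1 + m) (mu 0 0) (mu 1 1))⁻¹ = s1
  generalize (sinhCross R hb (-a 0 + a 1 + m) (mu 0 1) (mu 1 0))⁻¹ = s2
  generalize (sinhCross R hb (-a 0 - a 1 + m) (mu 0 1) (mu 1 1))⁻¹ = s3
  generalize w ^ (c1 - c3) = k0
  generalize w ^ (c0 - c3) = k1
  generalize w ^ (c1 - c2) = k2
  generalize w ^ (c0 - c2) = k3
  linear_combination (specConst w mu * k0 * k1 * k2 * k3 * s0 * s1 * s2 * s3) * he

theorem hasRationalValue_instCoeff (h : Generic R hb a) (d : Fin 2 →₀ ℕ) :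
    HasRationalValue (instCoeff R hb d) (paramPoint R m a)
      (MvPowerSeries.coeff d (sinhSeries R hb m a)) := by
  have h1 := hasRationalValue_coeffB_ZXInst h.notRoot d (paramPoint R m a)
    h.eval_quadDen_ne_zero
  have h2 : MvPowerSeries.coeff d (sinhSeries R hb m a) = ∑ mu ∈ quadruples d,
      MvPolynomial.eval (paramPoint R m a) (quadNum (Complex.exp (-R * hb)) mu)
        / MvPolynomial.eval (paramPoint R m a) (quadDen (Complex.exp (-R * hb)) mu) := by
    refine Finset.sum_congr rfl fun mu _ => ?_
    rw [eval_quadNum, mul_div_right_comm, h.specConst_div]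
    ring
  rw [h2]
  exact h1

end SinhFormula

/-! ### The limit R → 0. -/

section FourDimensionalLimit

variable (hb m : ℂ) (a : Fin 2 → ℂ)

theorem countable_sinh_eq_zero {c : ℂ} (hc : c ≠ 0) :
    {R : ℂ | Complex.sinh (R * c) = 0}.Countable := by
  refine (Set.countable_range fun k : ℤ => (k * Real.pi : ℂ) / (c * Complex.I)).mono ?_
  intro R hR
  rw [Set.mem_ofPred_eq] at hR
  have h1 : Complex.sin (R * c * Complex.I) = 0 := by
    rw [Complex.sin_mul_I, hR, zero_mul]
  obtain ⟨k, hk⟩ := Complex.sin_eq_zero_iff.1 h1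
  refine ⟨k, ?_⟩
  simp only
  rw [← hk]
  field_simp [Complex.I_ne_zero]

/-- The excluded R are the zeros of countably many functions sinh(Rc) with c ≠ 0, a countable set,
and the complement of a countable set is dense in ℂ. -/
theorem nhdsWithin_generic_neBot (hhb : hb ≠ 0)
    (ha : ∀ (k : Fin 2) (n : ℤ), 2 * a k + hb * n ≠ 0) :
    (𝓝[{R : ℂ | Generic R hb a}] 0).NeBot := by
  have h1 : ((⋃ n ∈ {n : ℤ | n ≠ 0}, {R : ℂ | Complex.sinh (R * (hb * n)) = 0})
      ∪ ⋃ k : Fin 2, ⋃ n : ℤ, {R : ℂ | Complex.sinh (R * (2 * a k + hb * n)) = 0}).Countable := by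
    refine Set.Countable.union ?_ ?_
    · exact (Set.to_countable _).biUnion fun n hn =>
        countable_sinh_eq_zero (mul_ne_zero hhb (Int.cast_ne_zero.2 hn))
    · exact Set.countable_iUnion fun k => Set.countable_iUnion fun n =>
        countable_sinh_eq_zero (ha k n)
  rw [← mem_closure_iff_nhdsWithin_neBot]
  refine closure_mono ?_ ((h1.dense_compl ℂ) 0)
  intro R hR
  simp only [Set.mem_compl_iff, Set.mem_union, Set.mem_iUnion, Set.mem_ofPred_eq, not_or, not_exists]
    at hR
  exact ⟨fun n hn => hR.1 n hn, fun k n => hR.2 k n⟩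

variable {hb m a}

theorem Generic.ne_zero {R : ℂ} (h : Generic R hb a) : R ≠ 0 := by
  rintro rfl
  exact h.1 1 one_ne_zero (by simp)

theorem tendsto_sinh_div (x : ℂ) :
    Tendsto (fun R : ℂ => Complex.sinh (R * x) / R) (𝓝[≠] 0) (𝓝 x) := by
  have h1 : HasDerivAt (fun R : ℂ => Complex.sinh (R * x)) (Complex.cosh (0 * x) * x) 0 :=
    by
    simpa using ((hasDerivAt_id (0 : ℂ)).mul_const x).csinh
  have h2 := hasDerivAt_iff_tendsto_slope.1 h1
  simp only [zero_mul, Complex.cosh_zero, one_mul] at h2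
  refine h2.congr fun R => ?_
  simp [slope_def_field]

theorem tendsto_crossProd (mu nu : YoungDiagram) {l : Filter ℂ} {phi : ℂ → ℤ → ℂ} {psi : ℤ → ℂ}
    (h : ∀ k, Tendsto (fun R => phi R k) l (𝓝 (psi k)))
    (h0 : ∀ k, netMult mu nu k ≠ 0 → psi k ≠ 0) :
    Tendsto (fun R => crossProd mu nu (phi R)) l (𝓝 (crossProd mu nu psi)) := by
  simp only [crossProd_eq, Finsupp.prod]
  refine tendsto_finsetProd _ fun k hk => (h k).zpow₀ _ (Or.inl (h0 k ?_))
  rwa [Finsupp.mem_support_iff, netFinsupp_apply] at hk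

/-- The exponents are nonnegative here, so factors tending to 0 are harmless; this is why m is
unrestricted. -/
theorem tendsto_crossProdInv (mu nu : YoungDiagram) {l : Filter ℂ} {phi : ℂ → ℤ → ℂ} {psi : ℤ → ℂ}
    (h : ∀ k, Tendsto (fun R => phi R k) l (𝓝 (psi k))) :
    Tendsto (fun R => crossProdInv mu nu (phi R)) l (𝓝 (crossProdInv mu nu psi)) := by
  simp only [crossProdInv_eq, Finsupp.prod]
  refine tendsto_finsetProd _ fun k _ => (h k).zpow₀ _ (Or.inr ?_)
  have := netFinsupp_nonpos mu nu k
  omega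

theorem crossProd_sinh_eq {R : ℂ} (hR : R ≠ 0) (A : ℂ) (mu nu : YoungDiagram) :
    crossProd mu nu (fun s => Complex.sinh (R * (A + hb * s)))
      = (R ^ (mu.card + nu.card))⁻¹
        * crossProd mu nu fun s => Complex.sinh (R * (A + hb * s)) / R := by
  have h := crossProd_mul mu nu (fun _ => R) fun s => Complex.sinh (R * (A + hb * s)) / R
  rw [crossProd_const _ _ hR, zpow_neg, ← Nat.cast_add, zpow_natCast] at h
  rw [← h]
  congr 1
  ext s
  field_simp

theorem crossProdInv_sinh_eq {R : ℂ} (hR : R ≠ 0) (A : ℂ) (mu nu : YoungDiagram) :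
    crossProdInv mu nu (fun s => Complex.sinh (R * (A + hb * s)))
      = R ^ (mu.card + nu.card)
        * crossProdInv mu nu fun s => Complex.sinh (R * (A + hb * s)) / R := by
  rw [crossProdInv_eq_inv, crossProdInv_eq_inv, crossProd_sinh_eq hR, mul_inv, inv_inv]

/-- The summand of the rescaled product formula, as a function regular at `R = 0`. -/
def scaledTerm (hb m : ℂ) (a : Fin 2 → ℂ) (mu : Fin 2 → Fin 2 → YoungDiagram) (R : ℂ) : ℂ :=
  (∏ k : Fin 2, (1 / Complex.exp (-4 * R * a k)) ^ ((mu k 0).card + (mu k 1).card)) *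
    Complex.exp (-R * hb) ^ (kappa (mu 0 0) + kappa (mu 0 1) - kappa (mu 1 0) - kappa (mu 1 1)) *
    Complex.exp (2 * R * (a 0 + a 1 - m)) ^
      ((mu 0 0).card + (mu 0 1).card + (mu 1 0).card + (mu 1 1).card) *
    Complex.exp (-2 * R * a 0) ^ (2 * (mu 0 0).card + (mu 1 0).card + (mu 1 1).card) *
    Complex.exp (-2 * R * a 1) ^ ((mu 0 0).card + (mu 0 1).card + 2 * (mu 1 0).card) *
    ((∏ k : Fin 2, ∏ l : Fin 2, ∏ n : Fin 2,
      crossProd (mu k l) (mu k n) fun s => Complex.sinh (R * (aVec a k l n + hb * s)) / R) *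
    ∏ l : Fin 2, ∏ n : Fin 2,
      crossProdInv (mu 0 l) (mu 1 n) fun s => Complex.sinh (R * (aBif a l n + m + hb * s)) / R)

theorem coeff_rescale_sinhSeries {R : ℂ} (hR : R ≠ 0) (d : Fin 2 →₀ ℕ) :
    (2 ^ 2 * R ^ 2) ^ d 0 * (2 ^ 2 * R ^ 2) ^ d 1 * MvPowerSeries.coeff d (sinhSeries R hb m a)
      = ∑ mu ∈ quadruples d, scaledTerm hb m a mu R := by
  change _ * ∑ mu ∈ quadruples d, _ = _
  rw [Finset.mul_sum]
  refine Finset.sum_congr rfl fun mu hmu => ?_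
  rw [← mem_quadruples.1 hmu 0, ← mem_quadruples.1 hmu 1, scaledTerm]
  simp only [crossProd_sinh_eq hR, crossProdInv_sinh_eq hR, Fin.prod_univ_two]
  have h4 : ∀ (x : ℂ) (n : ℕ), (1 / (2 ^ 4 * x)) ^ n = ((2 ^ n) ^ 4)⁻¹ * (1 / x) ^ n := by
    intro x n
    rw [pow_right_comm, ← inv_pow, ← mul_pow]
    congr 1
    rw [one_div, mul_inv, one_div]
  have h2 : ∀ n : ℕ, ((2 : ℂ) ^ 2) ^ n = (2 ^ n) ^ 2 := fun n => pow_right_comm _ _ _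
  have hR2 : ∀ n : ℕ, (R ^ 2) ^ n = (R ^ n) ^ 2 := fun n => pow_right_comm _ _ _
  simp only [h4]
  rw [mul_pow (2 ^ 2 : ℂ) (Complex.exp (2 * R * (a 0 + a 1 - m)))]
  generalize (mu 0 0).card = n0
  generalize (mu 0 1).card = n1
  generalize (mu 1 0).card = n2
  generalize (mu 1 1).card = n3
  generalize (1 / Complex.exp (-4 * R * a 0)) ^ (n0 + n1) = y0
  generalize (1 / Complex.exp (-4 * R * a 1)) ^ (n2 + n3) = y1
  generalize Complex.exp (2 * R * (a 0 + a 1 - m)) ^ (n0 + n1 + n2 + n3) = y2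
  generalize Complex.exp (-2 * R * a 0) ^ (2 * n0 + n2 + n3) = y3
  generalize Complex.exp (-2 * R * a 1) ^ (n0 + n1 + 2 * n2) = y4
  generalize crossProd (mu 0 0) (mu 0 0) _ = v0
  generalize crossProd (mu 0 0) (mu 0 1) _ = v1
  generalize crossProd (mu 0 1) (mu 0 0) _ = v2
  generalize crossProd (mu 0 1) (mu 0 1) _ = v3
  generalize crossProd (mu 1 0) (mu 1 0) _ = v4
  generalize crossProd (mu 1 0) (mu 1 1) _ = v5
  generalize crossProd (mu 1 1) (mu 1 0) _ = v6
  generalize crossProd (mu 1 1) (mu 1 1) _ = v7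
  generalize crossProdInv (mu 0 0) (mu 1 0) _ = w0
  generalize crossProdInv (mu 0 0) (mu 1 1) _ = w1
  generalize crossProdInv (mu 0 1) (mu 1 0) _ = w2
  generalize crossProdInv (mu 0 1) (mu 1 1) _ = w3
  simp only [mul_pow, pow_add, hR2, h2, mul_inv]
  have hr : ∀ n : ℕ, R ^ n * (R ^ n)⁻¹ = 1 := fun n => mul_inv_cancel₀ (pow_ne_zero n hR)
  have ht : ∀ n : ℕ, (2 : ℂ) ^ n * (2 ^ n)⁻¹ = 1 :=
    fun n => mul_inv_cancel₀ (pow_ne_zero n two_ne_zero)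
  -- Per cell: 2^2 from the substitution for Q_{B_k}, 2^2 next to Q_0 and 2^{-4} next to Q_{F_k};
  -- R^2 from the substitution, R^2 from the matter factors and R^{-4} from the vector factors.
  have key : ∀ n : ℕ, (2 ^ n) ^ 2 * (2 ^ n) ^ 2 * ((2 ^ n)⁻¹) ^ 4 * ((R ^ n) ^ 4 * ((R ^ n)⁻¹) ^ 4)
      = (1 : ℂ) := by
    intro n
    rw [← mul_pow (R ^ n), hr, ← pow_add, ← mul_pow, ht, one_pow, mul_one]
  simp only [← inv_pow] at key ⊢
  have k0 := key n0
  have k1 := key n1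
  have k2 := key n2
  have k3 := key n3
  generalize Complex.exp (-R * hb) ^ (_ : ℤ) = y5
  generalize (2 : ℂ)⁻¹ ^ n0 = i0 at k0 ⊢
  generalize (2 : ℂ) ^ n0 = t0 at k0 ⊢
  generalize R⁻¹ ^ n0 = j0 at k0 ⊢
  generalize R ^ n0 = r0 at k0 ⊢
  generalize (2 : ℂ)⁻¹ ^ n1 = i1 at k1 ⊢
  generalize (2 : ℂ) ^ n1 = t1 at k1 ⊢
  generalize R⁻¹ ^ n1 = j1 at k1 ⊢
  generalize R ^ n1 = r1 at k1 ⊢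
  generalize (2 : ℂ)⁻¹ ^ n2 = i2 at k2 ⊢
  generalize (2 : ℂ) ^ n2 = t2 at k2 ⊢
  generalize R⁻¹ ^ n2 = j2 at k2 ⊢
  generalize R ^ n2 = r2 at k2 ⊢
  generalize (2 : ℂ)⁻¹ ^ n3 = i3 at k3 ⊢
  generalize (2 : ℂ) ^ n3 = t3 at k3 ⊢
  generalize R⁻¹ ^ n3 = j3 at k3 ⊢
  generalize R ^ n3 = r3 at k3 ⊢
  calc _ = y0 * y1 * y5 * y2 * y3 * y4
        * (v0 * v1 * (v2 * v3) * (v4 * v5 * (v6 * v7)) * (w0 * w1 * (w2 * w3)))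
        * (t0 ^ 2 * t0 ^ 2 * i0 ^ 4 * (r0 ^ 4 * j0 ^ 4))
        * (t1 ^ 2 * t1 ^ 2 * i1 ^ 4 * (r1 ^ 4 * j1 ^ 4))
        * (t2 ^ 2 * t2 ^ 2 * i2 ^ 4 * (r2 ^ 4 * j2 ^ 4))
        * (t3 ^ 2 * t3 ^ 2 * i3 ^ 4 * (r3 ^ 4 * j3 ^ 4)) := by ring
    _ = _ := by rw [k0, k1, k2, k3, mul_one, mul_one, mul_one, mul_one]

theorem tendsto_scaledTerm (hhb : hb ≠ 0) (ha : ∀ (k : Fin 2) (n : ℤ), 2 * a k + hb * n ≠ 0)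
    (mu : Fin 2 → Fin 2 → YoungDiagram) :
    Tendsto (scaledTerm hb m a mu) (𝓝[≠] 0)
      (𝓝 ((∏ k : Fin 2, ∏ l : Fin 2, ∏ n : Fin 2,
        crossProd (mu k l) (mu k n) fun s => aVec a k l n + hb * s) *
      ∏ l : Fin 2, ∏ n : Fin 2,
        crossProdInv (mu 0 l) (mu 1 n) fun s => aBif a l n + m + hb * s)) := by
  have ha' : ∀ (k : Fin 2) (n : ℤ), -(2 * a k) + hb * n ≠ 0 := by
    intro k n h
    apply ha k (-n)
    push_cast
    linear_combination -h
  have hself : ∀ (lam : YoungDiagram) (n : ℤ), netMult lam lam n ≠ 0 → (0 : ℂ) + hb * n ≠ 0 := by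
    intro lam n hn
    rw [zero_add]
    refine mul_ne_zero hhb (Int.cast_ne_zero.2 ?_)
    rintro rfl
    exact hn (netMult_self_zero lam)
  -- Vector factors have nonpositive exponents, so their limits must not vanish. On the diagonal
  -- only s = 0 would be dangerous, and it has multiplicity 0.
  have hvec : ∀ k l n (s : ℤ), netMult (mu k l) (mu k n) s ≠ 0 → aVec a k l n + hb * s ≠ 0 := by
    intro k l n s hs
    fin_cases k <;> fin_cases l <;> fin_cases n
    · exact hself _ _ hs
    · exact ha 0 s
    · exact ha' 0 s
    · exact hself _ _ hs
    · exact hself _ _ hs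
    · exact ha' 1 s
    · exact ha 1 s
    · exact hself _ _ hs
  have hexp : ∀ c : ℂ, Tendsto (fun R : ℂ => Complex.exp (R * c)) (𝓝[≠] 0) (𝓝 1) := by
    intro c
    have h : Continuous fun R : ℂ => Complex.exp (R * c) := by fun_prop
    have h1 := h.tendsto 0
    rw [zero_mul, Complex.exp_zero] at h1
    exact h1.mono_left nhdsWithin_le_nhds
  have hexp4 : ∀ k, Tendsto (fun R : ℂ => 1 / Complex.exp (-4 * R * a k)) (𝓝[≠] 0) (𝓝 1) := by
    intro k
    refine (hexp (4 * a k)).congr fun R => ?_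
    rw [one_div, ← Complex.exp_neg]
    congr 1
    ring
  have hexp2 : ∀ k, Tendsto (fun R : ℂ => Complex.exp (-2 * R * a k)) (𝓝[≠] 0) (𝓝 1) := by
    intro k
    refine (hexp (-2 * a k)).congr fun R => ?_
    congr 1
    ring
  have hexpQ : Tendsto (fun R : ℂ => Complex.exp (2 * R * (a 0 + a 1 - m))) (𝓝[≠] 0) (𝓝 1) := by
    refine (hexp (2 * (a 0 + a 1 - m))).congr fun R => ?_
    congr 1
    ring
  have hexpu : Tendsto (fun R : ℂ => Complex.exp (-R * hb)) (𝓝[≠] 0) (𝓝 1) := by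
    refine (hexp (-hb)).congr fun R => ?_
    congr 1
    ring
  have hprod := (((((tendsto_finsetProd (Finset.univ : Finset (Fin 2)) fun k _ =>
    (hexp4 k).pow ((mu k 0).card + (mu k 1).card)).mul
    (hexpu.zpow₀ (kappa (mu 0 0) + kappa (mu 0 1) - kappa (mu 1 0) - kappa (mu 1 1))
      (Or.inl one_ne_zero))).mul
    (hexpQ.pow ((mu 0 0).card + (mu 0 1).card + (mu 1 0).card + (mu 1 1).card))).mul
    ((hexp2 0).pow (2 * (mu 0 0).card + (mu 1 0).card + (mu 1 1).card))).mul
    ((hexp2 1).pow ((mu 0 0).card + (mu 0 1).card + 2 * (mu 1 0).card))).mul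
    ((tendsto_finsetProd (Finset.univ : Finset (Fin 2)) fun k _ =>
      tendsto_finsetProd (Finset.univ : Finset (Fin 2)) fun l _ =>
      tendsto_finsetProd (Finset.univ : Finset (Fin 2)) fun n _ =>
        tendsto_crossProd (mu k l) (mu k n)
          (fun s => tendsto_sinh_div (aVec a k l n + hb * s)) (hvec k l n)).mul
      (tendsto_finsetProd (Finset.univ : Finset (Fin 2)) fun l _ =>
      tendsto_finsetProd (Finset.univ : Finset (Fin 2)) fun n _ =>
        tendsto_crossProdInv (mu 0 l) (mu 1 n)
          (fun s => tendsto_sinh_div (aBif a l n + m + hb * s))))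
  simp only [one_pow, one_zpow, Finset.prod_const_one, one_mul] at hprod
  exact hprod

theorem tendsto_ZXInstAt (hhb : hb ≠ 0) (ha : ∀ (k : Fin 2) (n : ℤ), 2 * a k + hb * n ≠ 0)
    (d : Fin 2 →₀ ℕ) :
    Tendsto (fun R : ℂ => MvPowerSeries.coeff d
        (MvPowerSeries.rescale (fun _ : Fin 2 => 2 ^ 2 * R ^ 2) (ZXInstAt R hb m a)))
      (𝓝[{R : ℂ | Generic R hb a}] 0)
      (𝓝 (MvPowerSeries.coeff d (nekrasovSeries hb m a))) := by
  have hle : 𝓝[{R : ℂ | Generic R hb a}] (0 : ℂ) ≤ 𝓝[≠] 0 :=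
    nhdsWithin_mono _ fun R hR => Generic.ne_zero hR
  have h1 : Tendsto (fun R => ∑ mu ∈ quadruples d, scaledTerm hb m a mu R)
      (𝓝[{R : ℂ | Generic R hb a}] 0) (𝓝 (MvPowerSeries.coeff d (nekrasovSeries hb m a))) :=
    (tendsto_finsetSum _ fun mu _ => tendsto_scaledTerm hhb ha mu).mono_left hle
  refine h1.congr' ?_
  -- For generic R part (1) applies, and uniqueness of rational values identifies the coefficient of
  -- `ZXInstAt` with that of `sinhSeries`.
  filter_upwards [self_mem_nhdsWithin] with R hR
  rw [← coeff_rescale_sinhSeries (Generic.ne_zero hR), MvPowerSeries.coeff_rescale,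
    Finsupp.prod_fintype _ _ (fun _ => pow_zero _), Fin.prod_univ_two]
  congr 1
  exact (hasRationalValue_instCoeff hR d).rationalValue_eq.symm

end FourDimensionalLimit

end ToricCY

end

theorem proposition4p1 (hb m : ℂ) (a : Fin 2 → ℂ) :
    (∀ R : ℂ, ToricCY.Generic R hb a → ∀ d : Fin 2 →₀ ℕ,
      ToricCY.HasRationalValue (ToricCY.instCoeff R hb d) (ToricCY.paramPoint R m a)
        (MvPowerSeries.coeff d (ToricCY.sinhSeries R hb m a))) ∧
    (hb ≠ 0 → (∀ (k : Fin 2) (n : ℤ), 2 * a k + hb * n ≠ 0) →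
      (𝓝[{R : ℂ | ToricCY.Generic R hb a}] 0).NeBot ∧
      ∀ d : Fin 2 →₀ ℕ, Tendsto
        (fun R : ℂ => MvPowerSeries.coeff d
          (MvPowerSeries.rescale (fun _ : Fin 2 => 2 ^ 2 * R ^ 2) (ToricCY.ZXInstAt R hb m a)))
        (𝓝[{R : ℂ | ToricCY.Generic R hb a}] 0)
        (𝓝 (MvPowerSeries.coeff d (ToricCY.nekrasovSeries hb m a)))) := by
  exact ⟨fun R hR d => ToricCY.hasRationalValue_instCoeff hR d, fun hhb ha =>
    ⟨ToricCY.nhdsWithin_generic_neBot hb a hhb ha, ToricCY.tendsto_ZXInstAt hhb ha⟩⟩
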